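/- Let $N\ge 1$ and let $\alpha_1,\dots,\alpha_N,\beta_1,\dots,\beta_N>0$. Let $\{W_{i,j}: i,j\ge 1,\ i\le N,\ i+j\le 2N+1\}$ be independent random variables, where $W_{i,j}$ is exponentially distributed with rate $\alpha_i+\beta_j$ if $j\le N$, and with rate $\alpha_i+\alpha_{2N-j+1}$ if $N<j\le 2N-i+1$. Let $$\tau_{2N}=\max_{\pi}\sum_{(i,j)\in\pi}W_{i,j},$$ the maximum being over all directed lattice paths $\pi$ with $2N$ vertices that start at $(1,1)$, have steps $(i,j)\to(i+1,j)$ or $(i,j)\to(i,j+1)$, and end at a point $(i,j)$ with $i+j=2N+1$ and $i\le j$. Let $u>0$. Let $\Gamma_1,\Gamma_2$ be any positively oriented (piecewise $C^1$) simple closed contours in the open right half-plane $\{\operatorname{Re} z>0\}$ such that $\Gamma_1$ encloses $\alpha_1,\dots,\alpha_N$, and $\Gamma_2$ encloses $\beta_1,\dots,\beta_N$ as well as the whole of $\Gamma_1$. Put $$\widehat H_u(z,w)=\frac{e^{-u(z+w)}}{z+w}+\frac{e^{-u(z+w)}}{z-w}+\frac{e^{-2uz}}{w-z},$$ $$K_{N,u}(\lambda,\xi)=\frac1{(2\pi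 \mathrm i)^2}\int_{\Gamma_1}dz\int_{\Gamma_2}dw\; e^{-\lambda z-\xi w}\,\widehat H_u(z,w)\prod_{m=1}^N\frac{(z+\beta_m)(w+\alpha_m)}{(z-\alpha_m)(w-\beta_m)} .$$ Then the kernel $K_{N,u}$ defines a bounded operator on $L^2(\mathbb R_+)$ by $(K_{N,u}h)(\lambda)=\int_0^\infty K_{N,u}(\lambda,\xi)h(\xi)\,d\xi$, its Fredholm determinant $$\det(I-K_{N,u})_{L^2(\mathbb R_+)}=1+\sum_{n=1}^\infty\frac{(-1)^n}{n!}\int_{(0,\infty)^n}\det\big(K_{N,u}(\lambda_i,\lambda_j)\big)_{i,j=1}^n\,d\lambda_1\cdots d\lambda_n$$ converges absolutely (each of the integrals, and the series), and $$\mathbb P(\tau_{2N}\le u)=\det(I-K_{N,u})_{L^2(\mathbb R_+)} .$$ -/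

import Mathlib

open MeasureTheory ProbabilityTheory

/-! ### Point-to-half-line directed last passage percolation -/

/-- The directed lattice paths with `L` vertices in `{1, 2, …}²` that start from `(1, 1)`, move at
each step from `(i, j)` to `(i + 1, j)` or to `(i, j + 1)`, and end on the half-line
`{(i, j) : i + j = L + 1, i ≤ j}`. The path `π` visits the vertices `π 0, …, π (L - 1)`. -/
def halfLinePaths (L : ℕ) : Set (Fin L → ℕ × ℕ) :=
  {π | (∀ k : Fin L, (k : ℕ) = 0 → π k = (1, 1)) ∧
    (∀ k l : Fin L, (l : ℕ) = k + 1 →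
      π l = ((π k).1 + 1, (π k).2) ∨ π l = ((π k).1, (π k).2 + 1)) ∧
    (∀ k : Fin L, (k : ℕ) + 1 = L → (π k).1 + (π k).2 = L + 1 ∧ (π k).1 ≤ (π k).2)}

/-- The point-to-half-line last passage time `max_π ∑_{(i,j) ∈ π} w (i, j)`, the maximum being over
`π ∈ halfLinePaths L`. -/
noncomputable def lastPassageTime (L : ℕ) (w : ℕ × ℕ → ℝ) : ℝ :=
  sSup ((fun π : Fin L → ℕ × ℕ => ∑ k, w (π k)) '' halfLinePaths L)

theorem halfLinePaths_finite (L : ℕ) : (halfLinePaths L).Finite := by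
  have hfin : (Set.pi (Set.univ : Set (Fin L)) fun _ =>
      Set.Icc ((0, 0) : ℕ × ℕ) (L + 1, L + 1)).Finite :=
    Set.Finite.pi fun _ => Set.finite_Icc _ _
  refine hfin.subset ?_
  rintro π ⟨h0, hs, -⟩
  have key : ∀ n : ℕ, ∀ h : n < L, (π ⟨n, h⟩).1 + (π ⟨n, h⟩).2 = n + 2 := by
    intro n
    induction n with
    | zero => intro h; simp [h0 ⟨0, h⟩ rfl]
    | succ n ih =>
      intro h
      have h1 := ih (by omega)
      rcases hs ⟨n, by omega⟩ ⟨n + 1, h⟩ rfl with h2 | h2 <;> rw [h2] <;> dsimp only <;> omega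
  intro k _
  have h1 : (π k).1 + (π k).2 = (k : ℕ) + 2 := key k k.2
  have h2 := k.2
  refine ⟨⟨Nat.zero_le _, Nat.zero_le _⟩, ⟨?_, ?_⟩⟩
  · dsimp only; omega
  · dsimp only; omega

theorem halfLinePaths_nonempty (L : ℕ) : (halfLinePaths L).Nonempty := by
  refine ⟨fun k => (1, (k : ℕ) + 1), ?_, ?_, ?_⟩
  · intro k hk; simp [hk]
  · intro k l h; right; simp [h]
  · intro k h; simp only; omega

/-- The supremum in `lastPassageTime` is a maximum. -/
theorem lastPassageTime_isGreatest (L : ℕ) (w : ℕ × ℕ → ℝ) :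
    IsGreatest ((fun π : Fin L → ℕ × ℕ => ∑ k, w (π k)) '' halfLinePaths L)
      (lastPassageTime L w) :=
  ⟨((halfLinePaths_nonempty L).image _).csSup_mem ((halfLinePaths_finite L).image _),
    fun _ hx => le_csSup ((halfLinePaths_finite L).image _).bddAbove hx⟩

/-- The trapezoidal index set `{(i, j) : i, j ≥ 1, i + j ≤ 2N + 1, i ≤ N}`. -/
def trapezoid (N : ℕ) : Set (ℕ × ℕ) :=
  {p | 1 ≤ p.1 ∧ 1 ≤ p.2 ∧ p.1 + p.2 ≤ 2 * N + 1 ∧ p.1 ≤ N}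

/-- The rate of the exponential weight at `p = (i, j)` in the trapezoid: `α_i + β_j` for `j ≤ N` and
`α_i + α_{2N-j+1}` for `N < j` (there `j ≤ 2N`, so the subtraction does not truncate). -/
def weightRate (N : ℕ) (α β : ℕ → ℝ) (p : ℕ × ℕ) : ℝ :=
  if p.2 ≤ N then α p.1 + β p.2 else α p.1 + α (2 * N - p.2 + 1)

/-! ### Contours -/

/-- `γ`, restricted to `[0, 1]`, is a piecewise `C¹` simple closed curve in the plane. -/
structure IsSimpleClosedContour (γ : ℝ → ℂ) : Prop where
  continuousOn : ContinuousOn γ (Set.Icc 0 1)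
  piecewise : ∃ (n : ℕ) (t : ℕ → ℝ), t 0 = 0 ∧ t n = 1 ∧
    ∀ k < n, t k < t (k + 1) ∧ ContDiffOn ℝ 1 γ (Set.Icc (t k) (t (k + 1)))
  closed : γ 0 = γ 1
  simple : Set.InjOn γ (Set.Ico 0 1)

/-- The trace of the curve `γ`. -/
def contourTrace (γ : ℝ → ℂ) : Set ℂ := γ '' Set.Icc 0 1

/-- The contour integral `∫_γ f(z) dz`. -/
noncomputable def contourIntegral (γ : ℝ → ℂ) (f : ℂ → ℂ) : ℂ :=
  ∫ t in (0 : ℝ)..1, f (γ t) * deriv γ t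

/-- The closed curve `γ` encloses the point `p`: `p` is not on the curve and lies in a bounded
component of its complement. -/
def Encloses (γ : ℝ → ℂ) (p : ℂ) : Prop :=
  p ∉ contourTrace γ ∧ Bornology.IsBounded (connectedComponentIn (contourTrace γ)ᶜ p)

/-- `γ` is positively oriented: it winds once, counterclockwise, around every enclosed point. -/
def IsPositivelyOriented (γ : ℝ → ℂ) : Prop :=
  ∀ p : ℂ, Encloses γ p →
    (2 * Real.pi * Complex.I)⁻¹ * contourIntegral γ (fun z => (z - p)⁻¹) = 1

/-- The open right half-plane. -/
def rightHalfPlane : Set ℂ := {z | 0 < z.re}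

/-- `γ` is a positively oriented simple closed contour in the open right half-plane. -/
def IsContourInRightHalfPlane (γ : ℝ → ℂ) : Prop :=
  IsSimpleClosedContour γ ∧ IsPositivelyOriented γ ∧ contourTrace γ ⊆ rightHalfPlane

/-! ### Fredholm determinants -/

section Fredholm

variable {X : Type*} [MeasurableSpace X]

/-- The function `(x₁, …, xₙ) ↦ det (K(x_i, x_j))` on `Xⁿ`. -/
noncomputable def kernelMinor (K : X → X → ℂ) (n : ℕ) (x : Fin n → X) : ℂ :=
  (Matrix.of fun i j => K (x i) (x j)).det

/-- The `n`-th term `(1 / n!) ∫_{Xⁿ} det (K(x_i, x_j)) μ(dx₁) ⋯ μ(dxₙ)` of the Fredholm series. -/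
noncomputable def fredholmTerm (μ : Measure X) (K : X → X → ℂ) (n : ℕ) : ℂ :=
  ((n.factorial : ℂ))⁻¹ * ∫ x : Fin n → X, kernelMinor K n x ∂(Measure.pi fun _ => μ)

/-- The Fredholm determinant `det (I + K)_{L²(X, μ)}`. -/
noncomputable def fredholmDet (μ : Measure X) (K : X → X → ℂ) : ℂ :=
  1 + ∑' n : ℕ, fredholmTerm μ K (n + 1)

/-- All integrals in the Fredholm series converge absolutely, and so does the series. -/
def FredholmConverges (μ : Measure X) (K : X → X → ℂ) : Prop :=
  (∀ n : ℕ, Integrable (kernelMinor K n) (Measure.pi fun _ => μ)) ∧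
    Summable fun n : ℕ => fredholmTerm μ K (n + 1)

/-- `T` is the operator `(T h)(x) = ∫ K(x, y) h(y) μ(dy)` on `L²(X, μ)`. -/
def IsIntegralOperator (μ : Measure X) (K : X → X → ℂ)
    (T : Lp ℂ 2 μ →L[ℂ] Lp ℂ 2 μ) : Prop :=
  ∀ h : Lp ℂ 2 μ, ∀ᵐ x ∂μ,
    Integrable (fun y => K x y * h y) μ ∧ T h x = ∫ y, K x y * h y ∂μ

end Fredholm

/-- Lebesgue measure on the positive half-line. -/
noncomputable def halfLineMeasure : Measure ℝ := volume.restrict (Set.Ioi 0)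

/-! ### The kernel -/

/-- The function `e^{-u(z+w)}/(z+w) + e^{-u(z+w)}/(z-w) + e^{-2uz}/(w-z)`. -/
noncomputable def Hhat (u : ℝ) (z w : ℂ) : ℂ :=
  Complex.exp (-u * (z + w)) / (z + w) + Complex.exp (-u * (z + w)) / (z - w)
    + Complex.exp (-2 * u * z) / (w - z)

/-- The double contour integral kernel of the point-to-half-line model. -/
noncomputable def Khat (N : ℕ) (α β : ℕ → ℝ) (u : ℝ) (Γ₁ Γ₂ : ℝ → ℂ) (lam ξ : ℝ) : ℂ :=
  1 / (2 * Real.pi * Complex.I) ^ 2 *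
    contourIntegral Γ₁ fun z => contourIntegral Γ₂ fun w =>
      Complex.exp (-lam * z - ξ * w) * Hhat u z w *
        ∏ m ∈ Finset.Icc 1 N, ((z + β m) * (w + α m)) / ((z - α m) * (w - β m))

/-!
The proof goes through a determinant of size `N` that can be reached from both sides.

**Last passage percolation.** Since the weights are nonnegative, `τ_{2N} ≤ u` says that the last
passage times to the points `(k + 1, 2N - k)`, `k < N`, are at most `u` (`lastPassageTime_le_iff`).
Build the trapezoid box by box, column by column, and follow the joint distribution function of the
last passage times at the ends of the rows. Conditioning on the weight of the new box gives an
integral recursion (`measureReal_rowEvent_update_succ`). The determinant `pathDet`, whose entries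
are, up to exponential factors, the contour integrals
`(2πi)⁻¹ ∮ e^{wt} ∏_{m<k} (w - aₘ) / (∏_{m≤l} (w - aₘ) ∏_{j<c} (w + bⱼ))
dw`, satisfies the same recursion (`pathDet_update_succ`): differentiating an entry raises `k`, so
that the derivative of a column truncated at the running level is a multiple of the next column.
Here `aₘ = α_{m+1}`, and `bⱼ` is the parameter of column `j + 1` (`columnRate`).

**The kernel.** Off the diagonal `z = w`, the function `Hhat` agrees with a function of `z` that is
holomorphic in the right half-plane. Newton interpolation at `a₀, …, a_{N-1}` therefore writes the
kernel as a sum of `N` products (`Khat_eq_sum`), whose factors decay exponentially. So the operator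
is bounded, the Fredholm series is a finite sum, and the Fredholm determinant is `det (1 - A)`,
where `A` is the matrix of the pairings of the factors (`fredholmDet_of_finiteRank`,
`integral_leftFactor_mul_rightFactor`).

**The comparison.** For the trapezoid, the entries of `pathDet` involve `e^{wu} ∏_{m<k} (w² - aₘ²)`.
Multiplying the matrix from the right by a lower triangular matrix `gaugeEntry`, whose determinant
is the product of all rates and of the factors `e^{-a_k u}` in `pathDet`, makes the sum over the
inner index telescope to a Cauchy kernel `2z / (w² - z²)`. After `w ↦ -w` this is the part of `Hhat`
with the factor `e^{-u(z+w)}`, and moving the contour from a big circle to `Γ₂` crosses the pole at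
`w = -z`, whose residue produces the identity matrix. Hence the product is `1 - A`
(`sum_pathEntry_mul_gaugeEntry`, `pathDet_columnRate_eq_det`).

The only facts about contours that are used are Cauchy's theorem for closed paths in a half-plane or
a disc and the winding numbers around the points `αₘ` and `βₘ`; residues are computed by divided
differences (`dslope`) and partial fractions.
-/

/-! ### Contour integrals and Cauchy's theorem -/

/-- A closed curve `γ : [0, 1] → ℂ` that is continuous, differentiable off a countable set, and whose
derivative is integrable: the regularity that the fundamental theorem of calculus needs. -/
structure IsClosedPath (γ : ℝ → ℂ) : Prop where
  continuousOn : ContinuousOn γ (Set.Icc 0 1)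
  differentiableAt : ∃ s : Set ℝ, s.Countable ∧
    ∀ t ∈ Set.Ioo (0 : ℝ) 1 \ s, DifferentiableAt ℝ γ t
  integrable_deriv : IntervalIntegrable (deriv γ) volume 0 1
  closed : γ 0 = γ 1

theorem IsSimpleClosedContour.isClosedPath {γ : ℝ → ℂ} (h : IsSimpleClosedContour γ) :
    IsClosedPath γ := by
  obtain ⟨n, t, ht0, htn, hk⟩ := h.piecewise
  refine ⟨h.continuousOn, ⟨Set.range t, Set.countable_range t, ?_⟩, ?_, h.closed⟩
  · rintro x ⟨⟨hx0, hx1⟩, hxt⟩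
    have hex : ∃ k, x < t k := ⟨n, by rw [htn]; exact hx1⟩
    classical
    have hlt := Nat.find_spec hex
    have hle : Nat.find hex ≤ n := Nat.find_min' hex (by rw [htn]; exact hx1)
    have hne : Nat.find hex ≠ 0 := by
      intro h0
      rw [h0, ht0] at hlt
      exact absurd hlt (not_lt.2 hx0.le)
    -- `x` lies strictly between the consecutive nodes `t k` and `t (k + 1)`.
    obtain ⟨k, hkk⟩ := Nat.exists_eq_succ_of_ne_zero hne
    have hmin : ¬ x < t k := Nat.find_min hex (by omega)
    have hlt' : t k < x := lt_of_le_of_ne (not_lt.1 hmin) fun he => hxt ⟨k, he⟩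
    rw [hkk] at hlt
    exact (((hk k (by omega)).2).contDiffAt (Icc_mem_nhds hlt' hlt)).differentiableAt one_ne_zero
  · rw [← ht0, ← htn]
    refine IntervalIntegrable.trans_iterate fun k hkn => ?_
    obtain ⟨hlt, hc⟩ := hk k hkn
    rw [intervalIntegrable_iff_integrableOn_Ioo_of_le hlt.le]
    have hcd := hc.continuousOn_derivWithin (uniqueDiffOn_Icc hlt) le_rfl
    have h1 : IntegrableOn (derivWithin γ (Set.Icc (t k) (t (k + 1)))) (Set.Ioo (t k) (t (k + 1))) :=
      (hcd.integrableOn_Icc).mono_set Set.Ioo_subset_Icc_self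
    refine h1.congr_fun (fun x hx => ?_) measurableSet_Ioo
    exact derivWithin_of_mem_nhds (Icc_mem_nhds hx.1 hx.2)

theorem isCompact_contourTrace {γ : ℝ → ℂ} (h : IsClosedPath γ) : IsCompact (contourTrace γ) :=
  isCompact_Icc.image_of_continuousOn h.continuousOn

theorem mem_contourTrace {γ : ℝ → ℂ} {t : ℝ} (ht : t ∈ Set.Icc (0 : ℝ) 1) :
    γ t ∈ contourTrace γ := ⟨t, ht, rfl⟩

section ContourIntegral

variable {γ γ₁ γ₂ : ℝ → ℂ} {f g : ℂ → ℂ}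

theorem IsClosedPath.intervalIntegrable (h : IsClosedPath γ) (hf : ContinuousOn f (contourTrace γ)) :
    IntervalIntegrable (fun t => f (γ t) * deriv γ t) volume 0 1 := by
  refine h.integrable_deriv.continuousOn_mul ?_
  rw [Set.uIcc_of_le zero_le_one]
  exact hf.comp h.continuousOn fun t ht => mem_contourTrace ht

theorem contourIntegral_congr (hfg : ∀ z ∈ contourTrace γ, f z = g z) :
    contourIntegral γ f = contourIntegral γ g := by
  refine intervalIntegral.integral_congr fun t ht => ?_
  rw [Set.uIcc_of_le zero_le_one] at ht
  simp only [hfg _ (mem_contourTrace ht)]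

theorem contourIntegral_add (h : IsClosedPath γ) (hf : ContinuousOn f (contourTrace γ))
    (hg : ContinuousOn g (contourTrace γ)) :
    contourIntegral γ (fun z => f z + g z) = contourIntegral γ f + contourIntegral γ g := by
  simp only [contourIntegral, add_mul]
  exact intervalIntegral.integral_add (h.intervalIntegrable hf) (h.intervalIntegrable hg)

theorem contourIntegral_sub (h : IsClosedPath γ) (hf : ContinuousOn f (contourTrace γ))
    (hg : ContinuousOn g (contourTrace γ)) :
    contourIntegral γ (fun z => f z - g z) = contourIntegral γ f - contourIntegral γ g := by
  simp only [contourIntegral, sub_mul]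
  exact intervalIntegral.integral_sub (h.intervalIntegrable hf) (h.intervalIntegrable hg)

theorem contourIntegral_const_mul (γ : ℝ → ℂ) (c : ℂ) (f : ℂ → ℂ) :
    contourIntegral γ (fun z => c * f z) = c * contourIntegral γ f := by
  simp only [contourIntegral, mul_assoc]
  exact intervalIntegral.integral_const_mul _ _

theorem contourIntegral_mul_const (γ : ℝ → ℂ) (c : ℂ) (f : ℂ → ℂ) :
    contourIntegral γ (fun z => f z * c) = contourIntegral γ f * c := by
  simp only [mul_comm _ c, contourIntegral_const_mul]

theorem contourIntegral_finsetSum {ι : Type*} (h : IsClosedPath γ) (s : Finset ι) (F : ι → ℂ → ℂ)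
    (hF : ∀ i ∈ s, ContinuousOn (F i) (contourTrace γ)) :
    contourIntegral γ (fun z => ∑ i ∈ s, F i z) = ∑ i ∈ s, contourIntegral γ (F i) := by
  simp only [contourIntegral, Finset.sum_mul]
  exact intervalIntegral.integral_finsetSum fun i hi => h.intervalIntegrable (hF i hi)

/-- The fundamental theorem of calculus: the integral of a derivative along a closed path
vanishes. -/
theorem contourIntegral_eq_zero_of_hasDerivAt (h : IsClosedPath γ) {F : ℂ → ℂ}
    (hF : ∀ z ∈ contourTrace γ, HasDerivAt F (f z) z) (hf : ContinuousOn f (contourTrace γ)) :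
    contourIntegral γ f = 0 := by
  obtain ⟨s, hs, hd⟩ := h.differentiableAt
  have hFc : ContinuousOn F (contourTrace γ) := fun z hz => (hF z hz).continuousAt.continuousWithinAt
  have := integral_eq_of_hasDerivAt_off_countable_of_le (fun t => F (γ t))
    (fun t => f (γ t) * deriv γ t) zero_le_one hs
    (hFc.comp h.continuousOn fun t ht => mem_contourTrace ht) (fun t ht => ?_)
    (h.intervalIntegrable hf)
  · rw [contourIntegral, this, h.closed, sub_self]
  · exact (hF _ (mem_contourTrace (Set.Ioo_subset_Icc_self ht.1))).comp_of_eq t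
      (hd t ht).hasDerivAt rfl

theorem contourIntegral_eq_zero_of_differentiableOn_ball (h : IsClosedPath γ) {c : ℂ} {r : ℝ}
    (htr : contourTrace γ ⊆ Metric.ball c r) (hf : DifferentiableOn ℂ f (Metric.ball c r)) :
    contourIntegral γ f = 0 := by
  obtain ⟨F, hF⟩ := hf.isExactOn_ball
  exact contourIntegral_eq_zero_of_hasDerivAt h (fun z hz => hF z (htr hz)) (hf.continuousOn.mono htr)

theorem isOpen_rightHalfPlane : IsOpen rightHalfPlane :=
  isOpen_lt continuous_const Complex.continuous_re

/-- A compact subset of the open right half-plane lies in a disc tangent to the imaginary axis. -/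
theorem exists_subset_ball_of_subset_rightHalfPlane {K : Set ℂ} (hK : IsCompact K)
    (hsub : K ⊆ rightHalfPlane) :
    ∃ (c : ℂ) (r : ℝ), K ⊆ Metric.ball c r ∧ Metric.ball c r ⊆ rightHalfPlane := by
  rcases K.eq_empty_or_nonempty with rfl | hne
  · exact ⟨0, 0, by simp, by simp⟩
  obtain ⟨z₀, hz₀, hmin⟩ := hK.exists_isMinOn hne Complex.continuous_re.continuousOn
  obtain ⟨M, hM⟩ := hK.isBounded.exists_norm_le
  have hpos : 0 < z₀.re := hsub hz₀
  -- The disc of centre `R` and radius `R` is given by `|z|² < 2R Re z`.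
  set R : ℝ := (M ^ 2 + 1) / (2 * z₀.re) with hR
  have hRpos : 0 < R := by positivity
  have hR2 : 2 * R * z₀.re = M ^ 2 + 1 := by rw [hR]; field_simp
  refine ⟨(R : ℂ), R, fun z hz => ?_, fun z hz => ?_⟩
  · rw [Metric.mem_ball, dist_eq_norm]
    have h1 : z₀.re ≤ z.re := hmin hz
    have h2 : z.re * z.re + z.im * z.im ≤ M ^ 2 := by
      rw [← Complex.normSq_apply, Complex.normSq_eq_norm_sq]
      exact pow_le_pow_left₀ (norm_nonneg _) (hM z hz) 2
    refine lt_of_pow_lt_pow_left₀ 2 hRpos.le ?_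
    rw [← Complex.normSq_eq_norm_sq, Complex.normSq_apply]
    simp only [Complex.sub_re, Complex.ofReal_re, Complex.sub_im, Complex.ofReal_im, sub_zero]
    nlinarith [mul_le_mul_of_nonneg_left h1 hRpos.le]
  · rw [Metric.mem_ball, dist_eq_norm] at hz
    have h1 := (Complex.abs_re_le_norm (z - R)).trans_lt hz
    rw [Complex.sub_re, Complex.ofReal_re, abs_lt] at h1
    change 0 < z.re
    linarith

/-- Cauchy's theorem in the right half-plane. -/
theorem contourIntegral_eq_zero_of_differentiableOn (h : IsClosedPath γ)
    (htr : contourTrace γ ⊆ rightHalfPlane) (hf : DifferentiableOn ℂ f rightHalfPlane) :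
    contourIntegral γ f = 0 := by
  obtain ⟨c, r, h1, h2⟩ := exists_subset_ball_of_subset_rightHalfPlane (isCompact_contourTrace h) htr
  exact contourIntegral_eq_zero_of_differentiableOn_ball h h1 (hf.mono h2)

/-- Cauchy's theorem for entire functions. -/
theorem contourIntegral_eq_zero_of_differentiable (h : IsClosedPath γ) (hf : Differentiable ℂ f) :
    contourIntegral γ f = 0 := by
  obtain ⟨F, hF⟩ := hf.isExactOn_univ
  exact contourIntegral_eq_zero_of_hasDerivAt h (fun z _ => hF z (Set.mem_univ z))
    hf.continuous.continuousOn

/-- `γ` avoids the point `a` and winds around it once, counterclockwise. -/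
def WindsOnce (γ : ℝ → ℂ) (a : ℂ) : Prop :=
  a ∉ contourTrace γ ∧ contourIntegral γ (fun z => (z - a)⁻¹) = 2 * Real.pi * Complex.I

theorem IsPositivelyOriented.windsOnce (h : IsPositivelyOriented γ) {a : ℂ} (ha : Encloses γ a) :
    WindsOnce γ a := by
  refine ⟨ha.1, ?_⟩
  have := h a ha
  rwa [inv_mul_eq_one₀ Complex.two_pi_I_ne_zero, eq_comm] at this

theorem continuousOn_prod_inv {ι : Type*} (s : Finset ι) (a : ι → ℂ) {K : Set ℂ}
    (h : ∀ i ∈ s, a i ∉ K) : ContinuousOn (fun z => (∏ i ∈ s, (z - a i))⁻¹) K := by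
  refine ContinuousOn.inv₀ (by fun_prop) fun z hz => Finset.prod_ne_zero_iff.2 fun i hi => ?_
  exact sub_ne_zero.2 fun he => h i hi (he ▸ hz)

/-- If two of the points differ, partial fractions lower the number of factors; if all of them coincide
and there are at least two, the integrand has a primitive. -/
theorem contourIntegral_inv_multiset (h : IsClosedPath γ) (s : Multiset ℂ)
    (hs : ∀ a ∈ s, WindsOnce γ a) (hcard : 1 ≤ Multiset.card s) :
    contourIntegral γ (fun z => ((s.map fun a => z - a).prod)⁻¹) =
      if Multiset.card s = 1 then 2 * Real.pi * Complex.I else 0 := by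
  obtain ⟨n, hn⟩ : ∃ n, Multiset.card s = n + 1 := ⟨Multiset.card s - 1, by omega⟩
  clear hcard
  induction n generalizing s with
  | zero =>
    obtain ⟨a, rfl⟩ := Multiset.card_eq_one.1 hn
    simpa using (hs a (by simp)).2
  | succ n ih =>
    have hcont : ∀ t : Multiset ℂ, (∀ a ∈ t, WindsOnce γ a) →
        ContinuousOn (fun z => ((t.map fun a => z - a).prod)⁻¹) (contourTrace γ) := by
      intro t ht
      refine ContinuousOn.inv₀ ?_ fun z hz => ?_
      · refine Continuous.continuousOn ?_
        exact continuous_multiset_prod (f := fun (a : ℂ) (z : ℂ) => z - a) t (by intros; fun_prop)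
      · rw [Ne, Multiset.prod_eq_zero_iff, Multiset.mem_map]
        rintro ⟨a, hat, ha⟩
        exact (ht a hat).1 (sub_eq_zero.1 ha ▸ hz)
    obtain ⟨a, t, rfl⟩ : ∃ a t, s = a ::ₘ t := by
      obtain ⟨a, ha⟩ := Multiset.card_pos_iff_exists_mem.1 (by omega : 0 < Multiset.card s)
      exact ⟨a, _, (Multiset.cons_erase ha).symm⟩
    rw [if_neg (by omega)]
    by_cases hall : ∀ b ∈ t, b = a
    · have ht : t = Multiset.replicate (n + 1) a := by
        rw [Multiset.eq_replicate]
        exact ⟨by simpa using hn, hall⟩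
      subst ht
      have hne : ∀ z ∈ contourTrace γ, z - a ≠ 0 := fun z hz =>
        sub_ne_zero.2 fun he => (hs a (by simp)).1 (he ▸ hz)
      refine contourIntegral_eq_zero_of_hasDerivAt h
        (F := fun z => -((n : ℂ) + 1)⁻¹ * ((z - a) ^ (n + 1))⁻¹) (fun z hz => ?_) (hcont _ hs)
      have h1 := (((((hasDerivAt_id z).sub_const a).pow (n + 1)).inv
        (pow_ne_zero _ (hne z hz))).const_mul (-((n : ℂ) + 1)⁻¹))
      refine h1.congr_deriv ?_
      have h2 := hne z hz
      have h3 : (n : ℂ) + 1 ≠ 0 := Nat.cast_add_one_ne_zero n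
      simp only [Multiset.map_cons, Multiset.map_replicate, Multiset.prod_cons,
        Multiset.prod_replicate, id]
      push_cast
      field_simp
      simp
      ring
    · push Not at hall
      obtain ⟨b, hbt, hba⟩ := hall
      obtain ⟨t', rfl⟩ : ∃ t', t = b ::ₘ t' := ⟨_, (Multiset.cons_erase hbt).symm⟩
      have hsa : ∀ c ∈ a ::ₘ t', WindsOnce γ c := fun c hc => hs c (by
        simp only [Multiset.mem_cons] at hc ⊢; tauto)
      have hsb : ∀ c ∈ b ::ₘ t', WindsOnce γ c := fun c hc => hs c (by
        simp only [Multiset.mem_cons] at hc ⊢; tauto)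
      have hca : Multiset.card (a ::ₘ t') = n + 1 := by simpa using hn
      have hcb : Multiset.card (b ::ₘ t') = n + 1 := by simpa using hn
      have key : ∀ z ∈ contourTrace γ,
          (((a ::ₘ b ::ₘ t').map fun a => z - a).prod)⁻¹ = (a - b)⁻¹ *
            ((((a ::ₘ t').map fun a => z - a).prod)⁻¹ -
              (((b ::ₘ t').map fun a => z - a).prod)⁻¹) := by
        intro z hz
        have h1 : z - a ≠ 0 := sub_ne_zero.2 fun he => (hs a (by simp)).1 (he ▸ hz)
        have h2 : z - b ≠ 0 := sub_ne_zero.2 fun he => (hs b (by simp)).1 (he ▸ hz)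
        have h3 : a - b ≠ 0 := sub_ne_zero.2 hba.symm
        simp only [Multiset.map_cons, Multiset.prod_cons, mul_inv]
        field_simp
        ring
      rw [contourIntegral_congr key, contourIntegral_const_mul,
        contourIntegral_sub h (hcont _ hsa) (hcont _ hsb), ih _ hsa hca, ih _ hsb hcb, hca, hcb,
        sub_self, mul_zero]

/-- The contour integral of `1 / ∏ (z - aᵢ)` around all the `aᵢ` is `2πi` if there is one factor, and
vanishes if there are at least two. -/
theorem contourIntegral_prod_inv {ι : Type*} (h : IsClosedPath γ) (s : Finset ι) (a : ι → ℂ)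
    (hs : ∀ i ∈ s, WindsOnce γ (a i)) (hne : s.Nonempty) :
    contourIntegral γ (fun z => (∏ i ∈ s, (z - a i))⁻¹) =
      if s.card = 1 then 2 * Real.pi * Complex.I else 0 := by
  have := contourIntegral_inv_multiset h (s.1.map a)
    (fun b hb => by
      obtain ⟨i, hi, rfl⟩ := Multiset.mem_map.1 hb
      exact hs i hi)
    (by simpa using Finset.card_pos.2 hne)
  simpa [Multiset.map_map, Function.comp_def] using this

end ContourIntegral

/-! ### Residues through divided differences -/

section Residues

variable {γ γ₁ γ₂ : ℝ → ℂ} {f g : ℂ → ℂ}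

theorem continuousOn_dslope_of_isOpen {U K : Set ℂ} (hU : IsOpen U) (hK : K ⊆ U) {a : ℂ} (ha : a ∈ U)
    (hf : DifferentiableOn ℂ f U) : ContinuousOn (dslope f a) K :=
  ((Complex.differentiableOn_dslope (hU.mem_nhds ha)).2 hf).continuousOn.mono hK

theorem eq_add_mul_dslope (f : ℂ → ℂ) (a z : ℂ) : f z = f a + (z - a) * dslope f a z := by
  have := sub_smul_dslope f a z
  rw [smul_eq_mul] at this
  rw [this]; ring

/-- Taking the value at one of the poles out of the numerator: the remainder `f - f (aᵢ)` is divisible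
by `z - aᵢ`, and `dslope f (aᵢ)` is the quotient. -/
theorem contourIntegral_mul_prod_inv_insert {ι : Type*} [DecidableEq ι] (h : IsClosedPath γ)
    {U : Set ℂ} (hU : IsOpen U) (htr : contourTrace γ ⊆ U) (hf : DifferentiableOn ℂ f U)
    {s : Finset ι} {i : ι} (hi : i ∉ s) (a : ι → ℂ) (hs : ∀ j ∈ insert i s, WindsOnce γ (a j))
    (ha : a i ∈ U) :
    contourIntegral γ (fun z => f z * (∏ j ∈ insert i s, (z - a j))⁻¹) =
      f (a i) * contourIntegral γ (fun z => (∏ j ∈ insert i s, (z - a j))⁻¹) +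
        contourIntegral γ (fun z => dslope f (a i) z * (∏ j ∈ s, (z - a j))⁻¹) := by
  have h1 := continuousOn_prod_inv (K := contourTrace γ) (insert i s) a fun j hj => (hs j hj).1
  have h2 := continuousOn_prod_inv (K := contourTrace γ) s a
    fun j hj => (hs j (Finset.mem_insert_of_mem hj)).1
  have h3 := continuousOn_dslope_of_isOpen hU htr ha hf
  rw [← contourIntegral_const_mul, ← contourIntegral_add h (h1.const_mul _) (h3.fun_mul h2)]
  refine contourIntegral_congr fun z hz => ?_
  have hne : z - a i ≠ 0 :=
    sub_ne_zero.2 fun he => (hs i (Finset.mem_insert_self i s)).1 (he ▸ hz)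
  conv_lhs => rw [eq_add_mul_dslope f (a i) z]
  rw [add_mul, Finset.prod_insert hi, mul_inv]
  field_simp

/-- Two closed paths that wind once around the poles of `f / ∏ (z - aᵢ)`, with `f` entire, give the
same integral: successive divided differences reduce the numerator to constants. -/
theorem contourIntegral_mul_prod_inv_eq {ι : Type*} (h₁ : IsClosedPath γ₁) (h₂ : IsClosedPath γ₂)
    (hf : Differentiable ℂ f) (s : Finset ι) (a : ι → ℂ) (hs₁ : ∀ i ∈ s, WindsOnce γ₁ (a i))
    (hs₂ : ∀ i ∈ s, WindsOnce γ₂ (a i)) :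
    contourIntegral γ₁ (fun z => f z * (∏ i ∈ s, (z - a i))⁻¹) =
      contourIntegral γ₂ (fun z => f z * (∏ i ∈ s, (z - a i))⁻¹) := by
  classical
  induction s using Finset.induction_on generalizing f with
  | empty =>
    simp only [Finset.prod_empty, inv_one, mul_one]
    rw [contourIntegral_eq_zero_of_differentiable h₁ hf,
      contourIntegral_eq_zero_of_differentiable h₂ hf]
  | insert i s hi ih =>
    have hd : Differentiable ℂ (dslope f (a i)) := by
      rw [← differentiableOn_univ]
      exact (Complex.differentiableOn_dslope Filter.univ_mem).2 hf.differentiableOn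
    rw [contourIntegral_mul_prod_inv_insert h₁ isOpen_univ (Set.subset_univ _) hf.differentiableOn hi
        a hs₁ (Set.mem_univ _),
      contourIntegral_mul_prod_inv_insert h₂ isOpen_univ (Set.subset_univ _) hf.differentiableOn hi
        a hs₂ (Set.mem_univ _),
      ih hd (fun j hj => hs₁ j (Finset.mem_insert_of_mem hj))
        (fun j hj => hs₂ j (Finset.mem_insert_of_mem hj)),
      contourIntegral_prod_inv h₁ _ a hs₁ ⟨i, Finset.mem_insert_self i s⟩,
      contourIntegral_prod_inv h₂ _ a hs₂ ⟨i, Finset.mem_insert_self i s⟩]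

/-- The sum of the residues at the enclosed poles `aᵢ` is minus the residue at the pole `p`, around which
the path does not wind. -/
theorem contourIntegral_inv_sub_mul_prod_inv {ι : Type*} (h : IsClosedPath γ) {p : ℂ}
    (hp : p ∉ contourTrace γ) (hp0 : contourIntegral γ (fun z => (z - p)⁻¹) = 0)
    (s : Finset ι) (a : ι → ℂ) (hs : ∀ i ∈ s, WindsOnce γ (a i)) (hpa : ∀ i ∈ s, a i ≠ p)
    (hne : s.Nonempty) :
    contourIntegral γ (fun z => (z - p)⁻¹ * (∏ i ∈ s, (z - a i))⁻¹) =
      -(2 * Real.pi * Complex.I) * (∏ i ∈ s, (p - a i))⁻¹ := by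
  classical
  have hzp : ∀ z ∈ contourTrace γ, z - p ≠ 0 := fun z hz => sub_ne_zero.2 fun he => hp (he ▸ hz)
  have hcp : ContinuousOn (fun z => (z - p)⁻¹) (contourTrace γ) :=
    ContinuousOn.inv₀ (by fun_prop) hzp
  induction s using Finset.induction_on with
  | empty => exact absurd rfl hne.ne_empty
  | insert i s hi ih =>
    have hs' : ∀ j ∈ s, WindsOnce γ (a j) := fun j hj => hs j (Finset.mem_insert_of_mem hj)
    have hpi : p - a i ≠ 0 := sub_ne_zero.2 (hpa i (Finset.mem_insert_self i s)).symm
    have key : ∀ z ∈ contourTrace γ,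
        (z - p)⁻¹ * (∏ j ∈ insert i s, (z - a j))⁻¹ = (p - a i)⁻¹ *
          ((z - p)⁻¹ * (∏ j ∈ s, (z - a j))⁻¹ - (∏ j ∈ insert i s, (z - a j))⁻¹) := by
      intro z hz
      have h1 := hzp z hz
      have h2 : z - a i ≠ 0 :=
        sub_ne_zero.2 fun he => (hs i (Finset.mem_insert_self i s)).1 (he ▸ hz)
      rw [Finset.prod_insert hi, mul_inv]
      field_simp
      ring
    rw [contourIntegral_congr key, contourIntegral_const_mul, contourIntegral_sub h
      (hcp.fun_mul (continuousOn_prod_inv _ _ fun j hj => (hs' j hj).1))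
      (continuousOn_prod_inv _ _ fun j hj => (hs j hj).1),
      contourIntegral_prod_inv h _ a hs hne, Finset.prod_insert hi, mul_inv]
    rcases s.eq_empty_or_nonempty with rfl | hsne
    · simp only [Finset.prod_empty, inv_one, mul_one, hp0, insert_empty_eq, Finset.card_singleton,
        if_true]
      ring
    · rw [ih hs' (fun j hj => hpa j (Finset.mem_insert_of_mem hj)) hsne,
        if_neg (by rw [Finset.card_insert_of_notMem hi]; have := hsne.card_pos; omega)]
      ring

/-- Leibniz' rule for divided differences, in contour integral form (Newton interpolation of `f`
at the points `a₀, a₁, …`). -/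
theorem contourIntegral_mul_eq_sum_range (h : IsClosedPath γ) {g : ℂ → ℂ}
    (htr : contourTrace γ ⊆ rightHalfPlane) (hf : DifferentiableOn ℂ f rightHalfPlane)
    (hg : DifferentiableOn ℂ g rightHalfPlane) (n : ℕ) (a : ℕ → ℂ)
    (ha : ∀ m < n, WindsOnce γ (a m)) (har : ∀ m < n, a m ∈ rightHalfPlane) :
    2 * Real.pi * Complex.I *
        contourIntegral γ (fun z => f z * g z * (∏ m ∈ Finset.range n, (z - a m))⁻¹) =
      ∑ k ∈ Finset.range n,
        contourIntegral γ (fun z => f z * (∏ m ∈ Finset.range (k + 1), (z - a m))⁻¹) *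
        contourIntegral γ (fun z => g z * (∏ m ∈ Finset.Ico k n, (z - a m))⁻¹) := by
  induction n generalizing a f with
  | zero =>
    simp only [Finset.range_zero, Finset.prod_empty, inv_one, mul_one, Finset.sum_empty]
    rw [contourIntegral_eq_zero_of_differentiableOn h htr (hf.fun_mul hg), mul_zero]
  | succ n ih =>
    have ha0 := ha 0 n.succ_pos
    have har0 := har 0 n.succ_pos
    have hU := isOpen_rightHalfPlane
    have hf1 : DifferentiableOn ℂ (dslope f (a 0)) rightHalfPlane :=
      (Complex.differentiableOn_dslope (hU.mem_nhds har0)).2 hf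
    have hprod : ∀ (k : ℕ) (z : ℂ), ∏ m ∈ Finset.range (k + 1), (z - a m) =
        (z - a 0) * ∏ m ∈ Finset.range k, (z - a (m + 1)) := fun k z => by
      rw [Finset.prod_range_succ', mul_comm]
    have hIco : ∀ (k : ℕ) (z : ℂ), ∏ m ∈ Finset.Ico (k + 1) (n + 1), (z - a m) =
        ∏ m ∈ Finset.Ico k n, (z - a (m + 1)) := fun k z =>
      (Finset.prod_Ico_add' (fun m => z - a m) k n 1).symm
    have hne : ∀ z ∈ contourTrace γ, z - a 0 ≠ 0 := fun z hz =>
      sub_ne_zero.2 fun he => ha0.1 (he ▸ hz)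
    have hfc := hf.continuousOn.mono htr
    have hgc := hg.continuousOn.mono htr
    have hf1c := hf1.continuousOn.mono htr
    have hPc : ∀ k ≤ n, ContinuousOn (fun z => (∏ m ∈ Finset.range k, (z - a (m + 1)))⁻¹)
        (contourTrace γ) := fun k hk =>
      continuousOn_prod_inv _ (fun m => a (m + 1)) fun m hm =>
        (ha (m + 1) (by have := Finset.mem_range.1 hm; omega)).1
    have hPc' : ∀ k ≤ n, ContinuousOn (fun z => (∏ m ∈ Finset.range (k + 1), (z - a m))⁻¹)
        (contourTrace γ) := fun k hk =>
      continuousOn_prod_inv _ a fun m hm => (ha m (by have := Finset.mem_range.1 hm; omega)).1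
    -- The integral of `f / ∏_{m ≤ k}` sees `f (a 0)` only if `k = 0`.
    have hstep : ∀ k ≤ n, ∀ φ : ℂ → ℂ, ContinuousOn φ (contourTrace γ) →
        contourIntegral γ (fun z => f z * φ z * (∏ m ∈ Finset.range (k + 1), (z - a m))⁻¹) =
          f (a 0) * contourIntegral γ (fun z => φ z * (∏ m ∈ Finset.range (k + 1), (z - a m))⁻¹) +
          contourIntegral γ (fun z => dslope f (a 0) z * φ z *
            (∏ m ∈ Finset.range k, (z - a (m + 1)))⁻¹) := by
      intro k hk φ hφ
      rw [← contourIntegral_const_mul, ← contourIntegral_add h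
        ((hφ.fun_mul (hPc' k hk)).const_mul _) ((hf1c.fun_mul hφ).fun_mul (hPc k hk))]
      refine contourIntegral_congr fun z hz => ?_
      have := hne z hz
      conv_lhs => rw [eq_add_mul_dslope f (a 0) z]
      rw [hprod, mul_inv]
      field_simp
    have hcoef : ∀ k ≤ n, contourIntegral γ (fun z => f z *
        (∏ m ∈ Finset.range (k + 1), (z - a m))⁻¹) =
        f (a 0) * (if k = 0 then 2 * Real.pi * Complex.I else 0) +
          contourIntegral γ (fun z => dslope f (a 0) z *
            (∏ m ∈ Finset.range k, (z - a (m + 1)))⁻¹) := by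
      intro k hk
      have := hstep k hk (fun _ => 1) continuousOn_const
      simp only [mul_one, one_mul] at this
      rw [this, contourIntegral_prod_inv h _ a
        (fun m hm => ha m (by have := Finset.mem_range.1 hm; omega)) ⟨0, by simp⟩]
      simp
    rw [hstep n le_rfl g hgc, mul_add, ih hf1 (fun m => a (m + 1)) (fun m hm => ha _ (by omega))
      (fun m hm => har _ (by omega)), Finset.sum_range_succ', add_comm]
    congr 1
    · refine Finset.sum_congr rfl fun k hk => ?_
      have hk' := Finset.mem_range.1 hk
      rw [hcoef (k + 1) (by omega), if_neg (by omega), mul_zero, zero_add]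
      simp only [hIco]
    · rw [hcoef 0 (by omega), if_pos rfl]
      simp only [Finset.range_zero, Finset.prod_empty, inv_one, mul_one]
      rw [contourIntegral_eq_zero_of_differentiableOn h htr hf1, add_zero, Finset.range_eq_Ico]
      ring

end Residues

/-! ### Contour integrals with a parameter -/

section Fubini

variable {γ γ₁ γ₂ : ℝ → ℂ}

/-- A contour integral is continuous in a parameter that ranges over a compact set. -/
theorem continuousOn_contourIntegral {X : Type*} [TopologicalSpace X] [FirstCountableTopology X]
    (h : IsClosedPath γ) {K : Set X} (hK : IsCompact K) {F : X → ℂ → ℂ}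
    (hF : ContinuousOn (fun p : X × ℂ => F p.1 p.2) (K ×ˢ contourTrace γ)) :
    ContinuousOn (fun x => contourIntegral γ (F x)) K := by
  obtain ⟨M, hM⟩ := (hK.prod (isCompact_contourTrace h)).exists_bound_of_continuousOn hF
  have hFx : ∀ x ∈ K, ContinuousOn (F x) (contourTrace γ) := fun x hx =>
    hF.comp (f := fun w => (x, w)) (by fun_prop) fun w hw => ⟨hx, hw⟩
  intro x hx
  have hsub : Set.uIoc (0 : ℝ) 1 ⊆ Set.Icc 0 1 := by
    rw [Set.uIoc_of_le zero_le_one]; exact Set.Ioc_subset_Icc_self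
  refine intervalIntegral.continuousWithinAt_of_dominated_interval
    (bound := fun t => M * ‖deriv γ t‖) ?_ ?_ ?_ ?_
  · filter_upwards [self_mem_nhdsWithin] with y hy
    have := (h.intervalIntegrable (hFx y hy)).aestronglyMeasurable
    rwa [Set.uIoc_of_le zero_le_one]
  · filter_upwards [self_mem_nhdsWithin] with y hy
    refine Filter.Eventually.of_forall fun t ht => ?_
    rw [norm_mul]
    gcongr
    exact hM (y, γ t) ⟨hy, mem_contourTrace (hsub ht)⟩
  · exact h.integrable_deriv.norm.const_mul M
  · refine Filter.Eventually.of_forall fun t ht => ?_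
    have h1 : ContinuousOn (fun y => F y (γ t)) K :=
      hF.comp (f := fun y => (y, γ t)) (by fun_prop) fun y hy => ⟨hy, mem_contourTrace (hsub ht)⟩
    exact (h1 x hx).mul continuousWithinAt_const

/-- A product of a function bounded and continuous on a product of (measurable) sets with integrable
functions of each of the variables is integrable. -/
theorem integrable_prod_of_continuousOn {s t : Set ℝ} (hs : MeasurableSet s) (ht : MeasurableSet t)
    {F : ℝ × ℝ → ℂ} (hF : ContinuousOn F (s ×ˢ t)) {M : ℝ} (hM : ∀ p ∈ s ×ˢ t, ‖F p‖ ≤ M)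
    {f g : ℝ → ℂ} (hf : IntegrableOn f s) (hg : IntegrableOn g t) :
    Integrable (fun p : ℝ × ℝ => F p * (f p.1 * g p.2))
      ((volume.restrict s).prod (volume.restrict t)) := by
  refine (hf.mul_prod hg).bdd_mul (c := M) ?_ ?_
  · rw [Measure.prod_restrict]
    exact hF.aestronglyMeasurable (hs.prod ht)
  · rw [Measure.prod_restrict]
    exact (ae_restrict_iff' (hs.prod ht)).2 (Filter.Eventually.of_forall hM)

/-- Fubini's theorem for two contour integrals. -/
theorem contourIntegral_comm (h₁ : IsClosedPath γ₁) (h₂ : IsClosedPath γ₂) {F : ℂ → ℂ → ℂ}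
    (hF : ContinuousOn (fun p : ℂ × ℂ => F p.1 p.2) (contourTrace γ₁ ×ˢ contourTrace γ₂)) :
    contourIntegral γ₁ (fun z => contourIntegral γ₂ fun w => F z w) =
      contourIntegral γ₂ (fun w => contourIntegral γ₁ fun z => F z w) := by
  obtain ⟨M, hM⟩ := ((isCompact_contourTrace h₁).prod
    (isCompact_contourTrace h₂)).exists_bound_of_continuousOn hF
  have hsub : Set.Ioc (0 : ℝ) 1 ⊆ Set.Icc 0 1 := Set.Ioc_subset_Icc_self
  have hint : Integrable (fun p : ℝ × ℝ => F (γ₁ p.1) (γ₂ p.2) * (deriv γ₁ p.1 * deriv γ₂ p.2))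
      ((volume.restrict (Set.Ioc 0 1)).prod (volume.restrict (Set.Ioc 0 1))) := by
    refine integrable_prod_of_continuousOn (F := fun p => F (γ₁ p.1) (γ₂ p.2)) (M := M)
      measurableSet_Ioc measurableSet_Ioc ?_ ?_ ?_ ?_
    · refine hF.comp (f := fun p : ℝ × ℝ => (γ₁ p.1, γ₂ p.2)) ?_ fun p hp =>
        ⟨mem_contourTrace (hsub hp.1), mem_contourTrace (hsub hp.2)⟩
      exact ((h₁.continuousOn.mono hsub).comp continuousOn_fst fun p hp => hp.1).prodMk
        ((h₂.continuousOn.mono hsub).comp continuousOn_snd fun p hp => hp.2)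
    · exact fun p hp => hM (γ₁ p.1, γ₂ p.2)
        ⟨mem_contourTrace (hsub hp.1), mem_contourTrace (hsub hp.2)⟩
    · exact (intervalIntegrable_iff_integrableOn_Ioc_of_le zero_le_one).1 h₁.integrable_deriv
    · exact (intervalIntegrable_iff_integrableOn_Ioc_of_le zero_le_one).1 h₂.integrable_deriv
  simp only [contourIntegral, intervalIntegral.integral_of_le zero_le_one, ← integral_mul_const]
  rw [integral_integral_swap]
  · congr 1
    funext t
    congr 1
    funext s
    ring
  · refine hint.congr (Filter.Eventually.of_forall fun p => ?_)
    simp only [Function.uncurry]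
    ring

/-- Fubini for a Laplace-type superposition `∮ e^{-ξw} h(w) dw` of decaying exponentials. -/
theorem integral_mul_contourIntegral_exp (h : IsClosedPath γ)
    (htr : contourTrace γ ⊆ rightHalfPlane) {φ : ℂ → ℂ} (hφ : ContinuousOn φ (contourTrace γ))
    {f : ℝ → ℂ} (hf : Continuous f) {M : ℝ} (hM : ∀ ξ, 0 < ξ → ‖f ξ‖ ≤ M) :
    ∫ ξ in Set.Ioi (0 : ℝ), f ξ * contourIntegral γ (fun w => Complex.exp (-ξ * w) * φ w) =
      contourIntegral γ fun w => φ w * ∫ ξ in Set.Ioi (0 : ℝ), f ξ * Complex.exp (-ξ * w) := by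
  have hsub : Set.Ioc (0 : ℝ) 1 ⊆ Set.Icc 0 1 := Set.Ioc_subset_Icc_self
  obtain ⟨δ, hδ, hδw⟩ : ∃ δ > 0, ∀ w ∈ contourTrace γ, δ ≤ w.re := by
    obtain ⟨w₀, hw₀, hmin⟩ := (isCompact_contourTrace h).exists_isMinOn
      ⟨γ 0, mem_contourTrace (by simp)⟩ Complex.continuous_re.continuousOn
    exact ⟨w₀.re, htr hw₀, fun w hw => hmin hw⟩
  obtain ⟨C, hC⟩ := (isCompact_contourTrace h).exists_bound_of_continuousOn hφ
  -- The factor `e^{-δξ}` is split off; the rest of the integrand is bounded.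
  have hint : Integrable (fun p : ℝ × ℝ => (f p.1 * Complex.exp (-p.1 * (γ p.2 - δ)) * φ (γ p.2)) *
      (Complex.exp (-δ * p.1) * deriv γ p.2))
      ((volume.restrict (Set.Ioi 0)).prod (volume.restrict (Set.Ioc 0 1))) := by
    have hγ : ContinuousOn (fun p : ℝ × ℝ => γ p.2) (Set.Ioi 0 ×ˢ Set.Ioc 0 1) :=
      (h.continuousOn.mono hsub).comp continuousOn_snd fun p hp => hp.2
    refine integrable_prod_of_continuousOn (M := M * 1 * C)
      (F := fun p => f p.1 * Complex.exp (-p.1 * (γ p.2 - δ)) * φ (γ p.2))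
      (f := fun ξ : ℝ => Complex.exp (-δ * ξ))
      measurableSet_Ioi measurableSet_Ioc ?_ ?_ ?_ ?_
    · refine ContinuousOn.mul (ContinuousOn.mul (by fun_prop) ?_)
        (hφ.comp hγ fun p hp => mem_contourTrace (hsub hp.2))
      refine Complex.continuous_exp.comp_continuousOn ?_
      have h1 : Continuous fun p : ℝ × ℝ => -(p.1 : ℂ) :=
        (Complex.continuous_ofReal.comp continuous_fst).neg
      exact h1.continuousOn.mul (hγ.sub continuousOn_const)
    · rintro ⟨ξ, t⟩ ⟨hξ, ht⟩
      have h1 := hM ξ hξ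
      have h2 := hC _ (mem_contourTrace (γ := γ) (hsub ht))
      have h3 : ‖Complex.exp (-ξ * (γ t - δ))‖ ≤ 1 := by
        rw [Complex.norm_exp, Real.exp_le_one_iff]
        have := hδw _ (mem_contourTrace (γ := γ) (hsub ht))
        have hξ' : 0 < ξ := hξ
        simp only [Complex.mul_re, Complex.neg_re, Complex.ofReal_re, Complex.sub_re,
          Complex.neg_im, Complex.ofReal_im, Complex.sub_im]
        nlinarith
      rw [norm_mul, norm_mul]
      have h4 : 0 ≤ M := (norm_nonneg _).trans h1
      gcongr
    · exact_mod_cast integrableOn_exp_mul_complex_Ioi (a := (-δ : ℂ)) (by simpa using hδ) 0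
    · exact (intervalIntegrable_iff_integrableOn_Ioc_of_le zero_le_one).1 h.integrable_deriv
  simp only [contourIntegral, intervalIntegral.integral_of_le zero_le_one, ← integral_const_mul,
    ← integral_mul_const]
  rw [integral_integral_swap]
  · congr 1
    funext t
    congr 1
    funext s
    ring
  · refine hint.congr (Filter.Eventually.of_forall fun p => ?_)
    simp only [Function.uncurry]
    rw [show -(p.1 : ℂ) * γ p.2 = -p.1 * (γ p.2 - δ) + -δ * p.1 by ring, Complex.exp_add]
    ring

theorem hasDerivAt_contourIntegral_exp (h : IsClosedPath γ) {φ : ℂ → ℂ}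
    (hφ : ContinuousOn φ (contourTrace γ)) (t : ℝ) :
    HasDerivAt (fun t : ℝ => contourIntegral γ fun w => Complex.exp (w * t) * φ w)
      (contourIntegral γ fun w => Complex.exp (w * t) * (w * φ w)) t := by
  have hsub : Set.uIoc (0 : ℝ) 1 ⊆ Set.Icc 0 1 := by
    rw [Set.uIoc_of_le zero_le_one]; exact Set.Ioc_subset_Icc_self
  have hK : IsCompact (Metric.closedBall t 1 ×ˢ contourTrace γ) :=
    (isCompact_closedBall t 1).prod (isCompact_contourTrace h)
  have hF : ContinuousOn (fun p : ℝ × ℂ => Complex.exp (p.2 * p.1) * (p.2 * φ p.2))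
      (Metric.closedBall t 1 ×ˢ contourTrace γ) := by
    refine ContinuousOn.mul (by fun_prop) (continuousOn_snd.mul ?_)
    exact hφ.comp continuousOn_snd fun p hp => hp.2
  obtain ⟨M, hM⟩ := hK.exists_bound_of_continuousOn hF
  have hII : ∀ (x : ℝ) (ψ : ℂ → ℂ), ContinuousOn ψ (contourTrace γ) →
      IntervalIntegrable (fun s => Complex.exp (γ s * x) * ψ (γ s) * deriv γ s) volume 0 1 :=
    fun x ψ hψ => h.intervalIntegrable (f := fun w => Complex.exp (w * x) * ψ w)
      (ContinuousOn.mul (by fun_prop) hψ)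
  refine (intervalIntegral.hasDerivAt_integral_of_dominated_loc_of_deriv_le
    (bound := fun s => M * ‖deriv γ s‖) (s := Metric.ball t 1)
    (F := fun (x : ℝ) s => Complex.exp (γ s * x) * φ (γ s) * deriv γ s)
    (F' := fun (x : ℝ) s => Complex.exp (γ s * x) * (γ s * φ (γ s)) * deriv γ s)
    (Metric.ball_mem_nhds t one_pos) ?_ (hII t φ hφ) ?_ ?_ ?_ ?_).2
  · refine Filter.Eventually.of_forall fun x => ?_
    rw [Set.uIoc_of_le zero_le_one]
    exact (hII x φ hφ).aestronglyMeasurable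
  · rw [Set.uIoc_of_le zero_le_one]
    exact (hII t _ (continuousOn_id.mul hφ)).aestronglyMeasurable
  · refine Filter.Eventually.of_forall fun s hs x hx => ?_
    rw [norm_mul]
    gcongr
    exact hM (x, γ s) ⟨Metric.ball_subset_closedBall hx, mem_contourTrace (hsub hs)⟩
  · exact h.integrable_deriv.norm.const_mul M
  · refine Filter.Eventually.of_forall fun s hs x hx => ?_
    have h1 : HasDerivAt (fun x : ℝ => γ s * (x : ℂ)) (γ s * 1) x :=
      (Complex.ofRealCLM.hasDerivAt (x := x)).const_mul (γ s)
    refine ((h1.cexp.mul_const (φ (γ s))).mul_const (deriv γ s)).congr_deriv ?_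
    ring

end Fubini

/-! ### Circles about the origin -/

section BigCircle

/-- The circle of radius `R` about the origin, parametrized by `[0, 1]`. -/
noncomputable def originCircle (R : ℝ) (t : ℝ) : ℂ := circleMap 0 R (2 * Real.pi * t)

variable {R : ℝ}

theorem hasDerivAt_originCircle (R t : ℝ) :
    HasDerivAt (originCircle R) (2 * Real.pi * (originCircle R t * Complex.I)) t := by
  have h1 : HasDerivAt (fun t : ℝ => 2 * Real.pi * t) (2 * Real.pi) t := by
    simpa using (hasDerivAt_id t).const_mul (2 * Real.pi)
  have := (hasDerivAt_circleMap 0 R (2 * Real.pi * t)).scomp t h1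
  refine this.congr_deriv ?_
  simp [originCircle, Complex.real_smul]

theorem deriv_originCircle (R t : ℝ) :
    deriv (originCircle R) t = 2 * Real.pi * (originCircle R t * Complex.I) :=
  (hasDerivAt_originCircle R t).deriv

theorem continuous_originCircle (R : ℝ) : Continuous (originCircle R) :=
  (continuous_circleMap 0 R).comp (by fun_prop)

theorem norm_originCircle (R t : ℝ) : ‖originCircle R t‖ = |R| := by
  simp [originCircle]

theorem isClosedPath_originCircle (R : ℝ) : IsClosedPath (originCircle R) where
  continuousOn := (continuous_originCircle R).continuousOn
  differentiableAt := ⟨∅, Set.countable_empty, fun t _ =>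
    (hasDerivAt_originCircle R t).differentiableAt⟩
  integrable_deriv := by
    rw [show deriv (originCircle R) = fun t => 2 * Real.pi * (originCircle R t * Complex.I) from
      funext (deriv_originCircle R)]
    have := continuous_originCircle R
    exact Continuous.intervalIntegrable (by fun_prop) 0 1
  closed := by
    have := (periodic_circleMap 0 R) 0
    simp only [originCircle, mul_zero, mul_one]
    rw [← this, zero_add]

theorem norm_eq_of_mem_contourTrace_originCircle (hR : 0 < R) {z : ℂ}
    (hz : z ∈ contourTrace (originCircle R)) : ‖z‖ = R := by
  obtain ⟨t, -, rfl⟩ := hz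
  rw [norm_originCircle, abs_of_pos hR]

theorem contourIntegral_originCircle (R : ℝ) (f : ℂ → ℂ) :
    contourIntegral (originCircle R) f = ∮ z in C(0, R), f z := by
  rw [contourIntegral, circleIntegral]
  have := intervalIntegral.smul_integral_comp_mul_left (a := 0) (b := 1)
    (fun θ => deriv (circleMap 0 R) θ • f (circleMap 0 R θ)) (2 * Real.pi)
  rw [mul_zero, mul_one] at this
  rw [← this, ← intervalIntegral.integral_smul]
  refine intervalIntegral.integral_congr fun t _ => ?_
  simp only [deriv_originCircle, deriv_circleMap, smul_eq_mul, Complex.real_smul]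
  simp only [originCircle]
  push_cast
  ring

theorem windsOnce_originCircle {a : ℂ} (ha : ‖a‖ < R) : WindsOnce (originCircle R) a := by
  have hR : 0 < R := (norm_nonneg a).trans_lt ha
  refine ⟨fun h => ?_, ?_⟩
  · rw [norm_eq_of_mem_contourTrace_originCircle hR h] at ha
    exact lt_irrefl _ ha
  · rw [contourIntegral_originCircle]
    exact circleIntegral.integral_sub_inv_of_mem_ball (by simpa using ha)

theorem originCircle_add_half (R s : ℝ) : originCircle R (s + 1 / 2) = -originCircle R s := by
  simp only [originCircle, circleMap, zero_add]
  rw [← mul_neg]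
  congr 1
  push_cast
  rw [show 2 * (Real.pi : ℂ) * (s + 1 / 2) * Complex.I =
    2 * Real.pi * s * Complex.I + Real.pi * Complex.I by ring, Complex.exp_add,
    Complex.exp_pi_mul_I]
  ring

/-- The substitution `w ↦ -w`. -/
theorem contourIntegral_originCircle_comp_neg (R : ℝ) (f : ℂ → ℂ) :
    contourIntegral (originCircle R) (fun z => f (-z)) = -contourIntegral (originCircle R) f := by
  have h1 := originCircle_add_half R
  set F : ℝ → ℂ := fun t => f (originCircle R t) * deriv (originCircle R) t with hF
  have hper : Function.Periodic F 1 := fun t => by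
    have h2 : originCircle R (t + 1) = originCircle R t := by
      rw [show t + 1 = t + 1 / 2 + 1 / 2 by ring, h1, h1, neg_neg]
    simp only [hF, deriv_originCircle, h2]
  have h3 : ∫ t in (0 : ℝ)..1, F t = ∫ t in (0 : ℝ)..1, F (t + 1 / 2) := by
    rw [intervalIntegral.integral_comp_add_right]
    have := hper.intervalIntegral_add_eq 0 (1 / 2)
    rw [zero_add, add_comm] at this
    rw [this]; norm_num
  simp only [contourIntegral]
  change _ = -∫ t in (0 : ℝ)..1, F t
  rw [h3, ← intervalIntegral.integral_neg]
  refine intervalIntegral.integral_congr fun t _ => ?_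
  simp only [hF, deriv_originCircle, h1]
  ring

end BigCircle

/-! ### The derivative of a determinant -/

section DetDeriv

/-- A determinant is differentiated column by column. -/
theorem hasDerivAt_det {n : Type*} [Fintype n] [DecidableEq n] {A : ℝ → Matrix n n ℂ}
    {A' : Matrix n n ℂ} {s : ℝ} (h : ∀ i j, HasDerivAt (fun s => A s i j) (A' i j) s) :
    HasDerivAt (fun s => (A s).det) (∑ j, ((A s).updateCol j fun i => A' i j).det) s := by
  let D : ContinuousMultilinearMap ℂ (fun _ : n => n → ℂ) ℂ :=
    { (Matrix.detRowAlternating (R := ℂ) (n := n)).toMultilinearMap with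
      cont := Continuous.matrix_det continuous_id }
  have hA : HasDerivAt (F := n → n → ℂ) (fun s j i => A s i j) (fun j i => A' i j) s :=
    hasDerivAt_pi.2 fun j => hasDerivAt_pi.2 fun i => h i j
  have h1 := ((D.hasFDerivAt fun j i => A s i j).restrictScalars ℝ).comp_hasDerivAt s hA
  have h2 : (fun s => (A s).det) = fun s => D (A s).transpose :=
    funext fun s => (Matrix.det_transpose (A s)).symm
  rw [h2]
  refine h1.congr_deriv ?_
  rw [ContinuousLinearMap.coe_restrictScalars', ContinuousMultilinearMap.linearDeriv_apply]
  refine Finset.sum_congr rfl fun j _ => ?_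
  rw [← Matrix.det_transpose]
  change Matrix.det (Function.update (fun j i => A s i j) j fun i => A' i j : n → n → ℂ) = _
  congr 1
  ext p q
  by_cases hp : p = j
  · subst hp
    simp
  · simp [hp]

end DetDeriv

/-! ### The entries of the determinantal formula -/

section Transition

/-- The function `(2πi)⁻¹ ∮ e^{wt} ∏_{m<k} (w - aₘ) / (∏_{m≤l} (w - aₘ) ∏_{j<c} (w + bⱼ)) dw`, the
integral being over a circle of radius `R` that encloses all the poles. -/
noncomputable def pathEntry (R : ℝ) (a b : ℕ → ℝ) (l k c : ℕ) (t : ℝ) : ℂ :=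
  (2 * Real.pi * Complex.I)⁻¹ * contourIntegral (originCircle R) fun w => Complex.exp (w * t) *
    ((∏ m ∈ Finset.range k, (w - a m)) * (∏ m ∈ Finset.range (l + 1), (w - a m))⁻¹ *
      (∏ j ∈ Finset.range c, (w + b j))⁻¹)

variable {R : ℝ} {a b : ℕ → ℝ} {l k c : ℕ}

theorem ofReal_notMem_originCircle {x : ℝ} (hx : |x| < R) :
    (x : ℂ) ∉ contourTrace (originCircle R) :=
  (windsOnce_originCircle (a := (x : ℂ)) (by simpa using hx)).1

theorem continuousOn_prod_sub_inv (s : Finset ℕ) (ha : ∀ m ∈ s, |a m| < R) :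
    ContinuousOn (fun w : ℂ => (∏ m ∈ s, (w - a m))⁻¹) (contourTrace (originCircle R)) :=
  continuousOn_prod_inv s (fun m => (a m : ℂ)) fun m hm => ofReal_notMem_originCircle (ha m hm)

theorem continuousOn_prod_add_inv (s : Finset ℕ) (hb : ∀ j ∈ s, |b j| < R) :
    ContinuousOn (fun w : ℂ => (∏ j ∈ s, (w + b j))⁻¹) (contourTrace (originCircle R)) := by
  have := continuousOn_prod_sub_inv (a := fun j => -b j) s (fun j hj => by simpa using hb j hj)
  simpa [sub_neg_eq_add] using this

/-- Up to conjugation by `e^{-a_k t}`, differentiation raises the index `k`. -/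
theorem hasDerivAt_pathEntry (ha : ∀ m ≤ l, |a m| < R) (hb : ∀ j < c, |b j| < R) (t : ℝ) :
    HasDerivAt (pathEntry R a b l k c)
      ((a k : ℂ) * pathEntry R a b l k c t + pathEntry R a b l (k + 1) c t) t := by
  have hcont : ∀ k, ContinuousOn (fun w : ℂ => (∏ m ∈ Finset.range k, (w - a m)) *
      (∏ m ∈ Finset.range (l + 1), (w - a m))⁻¹ * (∏ j ∈ Finset.range c, (w + b j))⁻¹)
      (contourTrace (originCircle R)) := fun k =>
    (ContinuousOn.mul (by fun_prop) (continuousOn_prod_sub_inv _ fun m hm =>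
      ha m (by have := Finset.mem_range.1 hm; omega))).mul
      (continuousOn_prod_add_inv _ fun j hj => hb j (Finset.mem_range.1 hj))
  have h := (hasDerivAt_contourIntegral_exp (isClosedPath_originCircle R) (hcont k) t).const_mul
    (2 * Real.pi * Complex.I : ℂ)⁻¹
  refine h.congr_deriv ?_
  have hexp : Continuous fun w : ℂ => Complex.exp (w * t) := by fun_prop
  rw [pathEntry, pathEntry, mul_left_comm (a k : ℂ), ← mul_add]
  congr 1
  rw [← contourIntegral_const_mul, ← contourIntegral_add (isClosedPath_originCircle R)
      ((hexp.continuousOn.fun_mul (hcont k)).const_mul _)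
      (hexp.continuousOn.fun_mul (hcont (k + 1)))]
  refine contourIntegral_congr fun w _ => ?_
  rw [Finset.prod_range_succ (fun m => w - (a m : ℂ)) k]
  ring

/-- Up to conjugation by `e^{b_c t}`, differentiation removes the last of the factors `w + bⱼ`. -/
theorem hasDerivAt_pathEntry_succ (ha : ∀ m ≤ l, |a m| < R) (hb : ∀ j ≤ c, |b j| < R) (t : ℝ) :
    HasDerivAt (pathEntry R a b l k (c + 1))
      (-(b c : ℂ) * pathEntry R a b l k (c + 1) t + pathEntry R a b l k c t) t := by
  have hcont : ∀ c', c' ≤ c + 1 → ContinuousOn (fun w : ℂ => (∏ m ∈ Finset.range k, (w - a m)) *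
      (∏ m ∈ Finset.range (l + 1), (w - a m))⁻¹ * (∏ j ∈ Finset.range c', (w + b j))⁻¹)
      (contourTrace (originCircle R)) := fun c' hc' =>
    (ContinuousOn.mul (by fun_prop) (continuousOn_prod_sub_inv _ fun m hm =>
      ha m (by have := Finset.mem_range.1 hm; omega))).mul
      (continuousOn_prod_add_inv _ fun j hj => hb j (by have := Finset.mem_range.1 hj; omega))
  have h := (hasDerivAt_contourIntegral_exp (isClosedPath_originCircle R)
    (hcont (c + 1) le_rfl) t).const_mul (2 * Real.pi * Complex.I : ℂ)⁻¹
  refine h.congr_deriv ?_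
  have hexp : Continuous fun w : ℂ => Complex.exp (w * t) := by fun_prop
  rw [pathEntry, pathEntry, mul_left_comm (-(b c : ℂ)), ← mul_add]
  congr 1
  rw [← contourIntegral_const_mul, ← contourIntegral_add (isClosedPath_originCircle R)
      ((hexp.continuousOn.fun_mul (hcont (c + 1) le_rfl)).const_mul _)
      (hexp.continuousOn.fun_mul (hcont c (by omega)))]
  refine contourIntegral_congr fun w hw => ?_
  have hne : w + b c ≠ 0 := by
    intro h0
    refine ofReal_notMem_originCircle (x := -b c) (by simpa using hb c le_rfl) ?_
    rw [Complex.ofReal_neg, ← eq_neg_of_add_eq_zero_left h0]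
    exact hw
  rw [Finset.prod_range_succ (fun j => w + (b j : ℂ)), mul_inv]
  field_simp
  ring

/-- At `t = 0` and `k = 0` the integrand is the inverse of a polynomial of degree at least two. -/
theorem pathEntry_zero_zero (ha : ∀ m ≤ l, |a m| < R) (hb : ∀ j < c, |b j| < R) (hc : 1 ≤ c) :
    pathEntry R a b l 0 c 0 = 0 := by
  have h := contourIntegral_prod_inv (isClosedPath_originCircle R)
    ((Finset.range (l + 1)).disjSum (Finset.range c))
    (Sum.elim (fun m => (a m : ℂ)) fun j => -(b j : ℂ)) ?_ ⟨Sum.inl 0, by simp⟩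
  · rw [if_neg (by rw [Finset.card_disjSum]; simp; omega)] at h
    simp only [Finset.prod_disjSum, Sum.elim_inl, Sum.elim_inr, sub_neg_eq_add, mul_inv] at h
    rw [pathEntry]
    simp only [Complex.ofReal_zero, mul_zero, Complex.exp_zero, Finset.range_zero,
      Finset.prod_empty, one_mul]
    rw [h, mul_zero]
  · rintro (m | j) hi <;> refine windsOnce_originCircle ?_
    · simpa using ha m (by simpa [Nat.lt_succ_iff] using hi)
    · simpa using hb j (by simpa using hi)

theorem pathEntry_of_lt (ha : ∀ m ≤ l, |a m| < R) (hlk : l < k) (t : ℝ) :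
    pathEntry R a b l k 0 t = 0 := by
  rw [pathEntry, contourIntegral_congr (g := fun w => Complex.exp (w * t) *
    ∏ m ∈ Finset.Ico (l + 1) k, (w - a m)), contourIntegral_eq_zero_of_differentiable
      (isClosedPath_originCircle R) (by fun_prop), mul_zero]
  intro w hw
  have hne : ∏ m ∈ Finset.range (l + 1), (w - (a m : ℂ)) ≠ 0 :=
    Finset.prod_ne_zero_iff.2 fun m hm => sub_ne_zero.2 fun he =>
      ofReal_notMem_originCircle (ha m (by have := Finset.mem_range.1 hm; omega)) (he ▸ hw)
  rw [← Finset.prod_range_mul_prod_Ico _ (Nat.succ_le_of_lt hlk)]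
  simp only [Finset.range_zero, Finset.prod_empty, inv_one, mul_one]
  field_simp

theorem pathEntry_self (ha : ∀ m ≤ k, |a m| < R) (t : ℝ) :
    pathEntry R a b k k 0 t = Complex.exp (a k * t) := by
  have hk := ha k le_rfl
  rw [pathEntry, contourIntegral_congr (g := fun w => (fun w => Complex.exp (w * t)) w *
    (∏ i ∈ insert k ∅, (w - (a i : ℂ)))⁻¹), contourIntegral_mul_prod_inv_insert
    (isClosedPath_originCircle R) isOpen_univ (Set.subset_univ _) (by fun_prop) (by simp)
    (fun i => (a i : ℂ)) (by simpa using windsOnce_originCircle (by simpa using hk))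
    (Set.mem_univ _)]
  · have h1 : Differentiable ℂ (dslope (fun w => Complex.exp (w * t)) (a k : ℂ)) := by
      rw [← differentiableOn_univ]
      exact (Complex.differentiableOn_dslope Filter.univ_mem).2 (by fun_prop)
    rw [contourIntegral_prod_inv (isClosedPath_originCircle R) _ _
      (by simpa using windsOnce_originCircle (by simpa using hk)) (by simp)]
    simp only [Finset.prod_empty, inv_one, mul_one]
    rw [contourIntegral_eq_zero_of_differentiable (isClosedPath_originCircle R) h1]
    have := Complex.two_pi_I_ne_zero
    simp only [insert_empty_eq, Finset.card_singleton, if_true, add_zero]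
    field_simp
  · intro w hw
    have hne : ∏ m ∈ Finset.range k, (w - (a m : ℂ)) ≠ 0 :=
      Finset.prod_ne_zero_iff.2 fun m hm => sub_ne_zero.2 fun he =>
        ofReal_notMem_originCircle (ha m (by have := Finset.mem_range.1 hm; omega)) (he ▸ hw)
    rw [Finset.prod_range_succ]
    simp only [Finset.range_zero, Finset.prod_empty, inv_one, mul_one, insert_empty_eq,
      Finset.prod_singleton, mul_inv]
    field_simp

end Transition

/-! ### The determinant and its evolution -/

section PathDet

variable {N : ℕ} {R : ℝ} {a b : ℕ → ℝ}

/-- The determinantal formula for the probability that the last passage times at the ends of the rows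
`k` of lengths `c k` are at most `t k`. The weight in row `k` and column `j` (both counted from `0`) has
rate `a k + b j`. -/
noncomputable def pathDet (R : ℝ) (a b : ℕ → ℝ) (c : Fin N → ℕ) (t : Fin N → ℝ) : ℂ :=
  (∏ k : Fin N, ∏ j ∈ Finset.range (c k), ((a k : ℂ) + b j)) *
    (Matrix.of fun l k : Fin N =>
      Complex.exp (-a k * t k) * pathEntry R a b l k (c k) (t k)).det

/-- The levels `t`, with those before `i` truncated at `s` and the `i`-th one replaced by `s`. If a box
is added at the end of row `i` and its weight is `t i - s`, then the last passage times of the new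
diagram are at most `t` exactly if those of the old diagram are at most `truncateLevels i t s`. -/
def truncateLevels (i : Fin N) (t : Fin N → ℝ) (s : ℝ) (k : Fin N) : ℝ :=
  if k < i then min (t k) s else if k = i then s else t k

theorem continuous_truncateLevels (i : Fin N) (t : Fin N → ℝ) (k : Fin N) :
    Continuous fun s => truncateLevels i t s k := by
  unfold truncateLevels
  split_ifs <;> fun_prop

theorem hasDerivAt_exp_ofReal_mul (x t : ℝ) :
    HasDerivAt (fun t : ℝ => Complex.exp (x * t)) (x * Complex.exp (x * t)) t := by
  have h1 : HasDerivAt (fun t : ℝ => (x : ℂ) * (t : ℂ)) ((x : ℂ) * 1) t :=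
    (Complex.ofRealCLM.hasDerivAt (x := t)).const_mul (x : ℂ)
  refine h1.cexp.congr_deriv ?_
  ring

theorem hasDerivAt_exp_mul_pathEntry {l k c : ℕ} (ha : ∀ m ≤ l, |a m| < R) (hb : ∀ j < c, |b j| < R)
    (t : ℝ) : HasDerivAt (fun t : ℝ => Complex.exp (-a k * t) * pathEntry R a b l k c t)
      (Complex.exp (-a k * t) * pathEntry R a b l (k + 1) c t) t := by
  have h := (hasDerivAt_exp_ofReal_mul (-a k) t).mul (hasDerivAt_pathEntry (k := k) ha hb t)
  simp only [Complex.ofReal_neg] at h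
  refine h.congr_deriv ?_
  ring

theorem continuous_exp_mul_pathEntry {l k c : ℕ} (ha : ∀ m ≤ l, |a m| < R) (hb : ∀ j < c, |b j| < R) :
    Continuous fun t : ℝ => Complex.exp (-a k * t) * pathEntry R a b l k c t :=
  continuous_iff_continuousAt.2 fun t => (hasDerivAt_exp_mul_pathEntry ha hb t).continuousAt

theorem hasDerivAt_exp_mul_pathEntry_succ {l k c : ℕ} (ha : ∀ m ≤ l, |a m| < R)
    (hb : ∀ j ≤ c, |b j| < R) (t : ℝ) :
    HasDerivAt (fun t : ℝ => Complex.exp (b c * t) * pathEntry R a b l k (c + 1) t)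
      (Complex.exp (b c * t) * pathEntry R a b l k c t) t := by
  refine ((hasDerivAt_exp_ofReal_mul (b c) t).mul
    (hasDerivAt_pathEntry_succ (k := k) ha hb t)).congr_deriv ?_
  ring

theorem continuous_pathDet_truncateLevels (ha : ∀ m < N, |a m| < R) (hb : ∀ j, |b j| < R)
    (c : Fin N → ℕ) (i : Fin N) (t : Fin N → ℝ) :
    Continuous fun s => pathDet R a b c (truncateLevels i t s) := by
  unfold pathDet
  refine continuous_const.mul (Continuous.matrix_det ?_)
  refine continuous_pi fun l => continuous_pi fun k => ?_
  exact (continuous_exp_mul_pathEntry (fun m hm => ha m (hm.trans_lt l.2)) fun j _ => hb j).comp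
    (continuous_truncateLevels i t k)

/-- With no boxes the determinant is that of a unitriangular matrix. -/
theorem pathDet_zero (ha : ∀ m < N, |a m| < R) (t : Fin N → ℝ) :
    pathDet R a b (fun _ : Fin N => 0) t = 1 := by
  rw [pathDet, Matrix.det_of_isLowerTriangular]
  · simp only [Matrix.of_apply, Finset.range_zero, Finset.prod_empty, Finset.prod_const_one, one_mul]
    refine Finset.prod_eq_one fun k _ => ?_
    rw [pathEntry_self (fun m hm => ha m (hm.trans_lt k.2)), ← Complex.exp_add]
    simp
  · intro l k hlk
    rw [Matrix.of_apply, pathEntry_of_lt (fun m hm => ha m (hm.trans_lt l.2))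
      (by simpa using hlk), mul_zero]

/-- Adding the box at the end of row `i` to the diagram. The derivative in `s` of a truncated column
is a multiple of the next column, so that only column `i` contributes to the derivative of the
determinant; at `s = 0` the determinant vanishes along with its first column. -/
theorem pathDet_update_succ (ha : ∀ m < N, |a m| < R) (hb : ∀ j, |b j| < R) (c : Fin N → ℕ)
    (i : Fin N) (hc : ∀ k < i, c k = c i + 1) {t : Fin N → ℝ} (ht : Monotone t) (ht0 : ∀ k, 0 ≤ t k) :
    Complex.exp ((a i + b (c i)) * t i) * pathDet R a b (Function.update c i (c i + 1)) t =
      ∫ s in (0 : ℝ)..t i, (a i + b (c i)) * Complex.exp ((a i + b (c i)) * s) *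
        pathDet R a b c (truncateLevels i t s) := by
  have ha' : ∀ l : Fin N, ∀ m ≤ (l : ℕ), |a m| < R := fun l m hm => ha m (hm.trans_lt l.2)
  set κ : ℂ := ∏ k : Fin N, ∏ j ∈ Finset.range (c k), ((a k : ℂ) + b j) with hκ
  have hκ' : (∏ k : Fin N, ∏ j ∈ Finset.range (Function.update c i (c i + 1) k),
      ((a k : ℂ) + b j)) = (a i + b (c i)) * κ := by
    rw [hκ, ← Finset.mul_prod_erase Finset.univ _ (Finset.mem_univ i),
      ← Finset.mul_prod_erase (a := i) Finset.univ (fun k : Fin N => ∏ j ∈ Finset.range (c k),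
        ((a k : ℂ) + b j)) (Finset.mem_univ i), ← mul_assoc]
    congr 1
    · rw [Function.update_self, Finset.prod_range_succ, mul_comm]
    · refine Finset.prod_congr rfl fun k hk => ?_
      rw [Function.update_of_ne (Finset.ne_of_mem_erase hk)]
  -- The new determinant along the truncated levels, times `exp ((a i + b (c i)) * s)`, which is
  -- put into column `i`.
  let A : ℝ → Matrix (Fin N) (Fin N) ℂ := fun s => Matrix.of fun l k =>
    if k = i then Complex.exp (b (c i) * s) * pathEntry R a b l i (c i + 1) s
    else Complex.exp (-a k * truncateLevels i t s k) *
      pathEntry R a b l k (c k) (truncateLevels i t s k)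
  have hA : ∀ s : ℝ, Complex.exp ((a i + b (c i)) * s) *
      pathDet R a b (Function.update c i (c i + 1)) (truncateLevels i t s) =
      (a i + b (c i)) * κ * (A s).det := by
    intro s
    rw [pathDet, hκ', mul_left_comm]
    congr 1
    have hcol : A s = (Matrix.of fun l k : Fin N =>
        Complex.exp (-a k * truncateLevels i t s k) * pathEntry R a b l k
          (Function.update c i (c i + 1) k) (truncateLevels i t s k)).updateCol i
          (Complex.exp ((a i + b (c i)) * s) • fun l : Fin N =>
            Complex.exp (-a i * truncateLevels i t s i) * pathEntry R a b l i
              (Function.update c i (c i + 1) i) (truncateLevels i t s i)) := by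
      ext l k
      by_cases hk : k = i
      · subst hk
        simp only [A, Matrix.of_apply, if_true, Matrix.updateCol_self, Pi.smul_apply, smul_eq_mul,
          Function.update_self, truncateLevels, lt_irrefl, if_false]
        rw [← mul_assoc, ← Complex.exp_add]
        congr 2; ring
      · simp [A, hk]
    rw [hcol, Matrix.det_updateCol_smul]
    congr 2
    ext l k
    by_cases hk : k = i
    · subst hk; simp
    · simp [hk]
  have hAcont : Continuous fun s => (A s).det := by
    refine Continuous.matrix_det (continuous_pi fun l => continuous_pi fun k => ?_)
    by_cases hk : k = i
    · simp only [A, Matrix.of_apply, if_pos hk]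
      exact continuous_iff_continuousAt.2 fun s =>
        (hasDerivAt_exp_mul_pathEntry_succ (ha' l) (fun j _ => hb j) s).continuousAt
    · simp only [A, Matrix.of_apply, if_neg hk]
      exact (continuous_exp_mul_pathEntry (ha' l) fun j _ => hb j).comp
        (continuous_truncateLevels i t k)
  have hderiv : ∀ s ∈ Set.Ioo 0 (t i) \ Set.range t,
      HasDerivAt (fun s => (a i + b (c i)) * κ * (A s).det)
        ((a i + b (c i)) * Complex.exp ((a i + b (c i)) * s) *
          pathDet R a b c (truncateLevels i t s)) s := by
    rintro s ⟨⟨hs0, hsi⟩, hst⟩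
    let A' : Matrix (Fin N) (Fin N) ℂ := Matrix.of fun l k =>
      if k = i then Complex.exp (b (c i) * s) * pathEntry R a b l i (c i) s
      else if k < i ∧ s < t k then Complex.exp (-a k * s) * pathEntry R a b l (k + 1) (c k) s
      else 0
    have hent : ∀ l k, HasDerivAt (fun s => A s l k) (A' l k) s := by
      intro l k
      by_cases hk : k = i
      · simp only [A, A', Matrix.of_apply, if_pos hk]
        exact hasDerivAt_exp_mul_pathEntry_succ (ha' l) (fun j _ => hb j) s
      by_cases hki : k < i ∧ s < t k
      · simp only [A, A', Matrix.of_apply, if_neg hk, if_pos hki]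
        refine (hasDerivAt_exp_mul_pathEntry (ha' l) (fun j _ => hb j) s).congr_of_eventuallyEq ?_
        filter_upwards [Iio_mem_nhds hki.2] with x hx
        simp only [truncateLevels, if_pos hki.1, min_eq_right (Set.mem_Iio.1 hx).le]
      · simp only [A, A', Matrix.of_apply, if_neg hk, if_neg hki]
        refine (hasDerivAt_const s (Complex.exp (-a k * truncateLevels i t s k) *
          pathEntry R a b l k (c k) (truncateLevels i t s k))).congr_of_eventuallyEq ?_
        by_cases hlt : k < i
        · have hts : t k < s := lt_of_le_of_ne (not_lt.1 fun h => hki ⟨hlt, h⟩)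
            fun he => hst ⟨k, he⟩
          filter_upwards [Ioi_mem_nhds hts] with x hx
          simp only [truncateLevels, if_pos hlt, min_eq_left (Set.mem_Ioi.1 hx).le,
            min_eq_left hts.le]
        · filter_upwards with x
          simp only [truncateLevels, if_neg hlt, if_neg hk]
    refine ((hasDerivAt_det hent).const_mul ((a i + b (c i)) * κ)).congr_deriv ?_
    rw [Finset.sum_eq_single i]
    · have hcol : (A s).updateCol i (fun l => A' l i) = (Matrix.of fun l k : Fin N =>
          Complex.exp (-a k * truncateLevels i t s k) * pathEntry R a b l k
            (c k) (truncateLevels i t s k)).updateCol i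
            (Complex.exp ((a i + b (c i)) * s) • fun l : Fin N =>
              Complex.exp (-a i * truncateLevels i t s i) * pathEntry R a b l i
                (c i) (truncateLevels i t s i)) := by
        ext l k
        by_cases hk : k = i
        · subst hk
          simp only [A', Matrix.of_apply, if_true, Matrix.updateCol_self, Pi.smul_apply, smul_eq_mul,
            truncateLevels, lt_irrefl, if_false]
          rw [← mul_assoc, ← Complex.exp_add]
          congr 2; ring
        · simp [A, hk]
      rw [hcol, Matrix.det_updateCol_smul, pathDet, ← hκ]
      have hself : (Matrix.of fun l k : Fin N =>
          Complex.exp (-a k * truncateLevels i t s k) * pathEntry R a b l k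
            (c k) (truncateLevels i t s k)).updateCol i (fun l : Fin N =>
              Complex.exp (-a i * truncateLevels i t s i) * pathEntry R a b l i
                (c i) (truncateLevels i t s i)) = Matrix.of fun l k : Fin N =>
          Complex.exp (-a k * truncateLevels i t s k) * pathEntry R a b l k
            (c k) (truncateLevels i t s k) := by
        ext l k
        by_cases hk : k = i
        · subst hk; simp
        · simp [hk]
      rw [hself]
      ring
    · intro k _ hk
      by_cases hki : k < i ∧ s < t k
      · -- The derivative of column `k` is a multiple of column `k + 1`.
        have hk1 : (k : ℕ) + 1 < N := by have := Fin.lt_def.1 hki.1; have := i.2; omega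
        let k' : Fin N := ⟨k + 1, hk1⟩
        have hkk' : k ≠ k' := by simp [Fin.ext_iff, k']
        have hk'i : k' ≤ i := Fin.le_def.2 (Fin.lt_def.1 hki.1)
        obtain ⟨x, hx⟩ : ∃ x : ℂ, (fun l => A' l k) = x • fun l => A s l k' := by
          rcases hk'i.eq_or_lt with he | hlt
          · refine ⟨Complex.exp (-a k * s) * Complex.exp (-(b (c i) * s)), funext fun l => ?_⟩
            simp only [A, A', Matrix.of_apply, if_neg hk, if_pos hki, if_pos he, Pi.smul_apply,
              smul_eq_mul, hc k hki.1]
            rw [show (i : ℕ) = k + 1 from (congrArg Fin.val he).symm, ← mul_assoc, mul_assoc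
              (Complex.exp (-a k * s)), ← Complex.exp_add, neg_add_cancel, Complex.exp_zero,
              mul_one]
          · refine ⟨Complex.exp (-a k * s) * Complex.exp (a k' * s), funext fun l => ?_⟩
            have htr : truncateLevels i t s k' = s := by
              rw [truncateLevels, if_pos hlt, min_eq_right]
              exact hki.2.le.trans (ht (Fin.le_def.2 (by simp [k'])))
            simp only [A, A', Matrix.of_apply, if_neg hk, if_pos hki, if_neg hlt.ne, Pi.smul_apply,
              smul_eq_mul, hc k hki.1, hc k' hlt, htr]
            rw [← mul_assoc, mul_assoc (Complex.exp (-a k * s)), ← Complex.exp_add,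
              neg_mul (a k' : ℂ), add_neg_cancel, Complex.exp_zero, mul_one]
        rw [hx, Matrix.det_updateCol_smul, Matrix.det_zero_of_column_eq hkk', mul_zero]
        intro l
        simp [hkk'.symm]
      · refine Matrix.det_eq_zero_of_column_eq_zero k fun l => ?_
        simp [A', hk, hki]
    · simp
  have hzero : (A 0).det = 0 := by
    let z : Fin N := ⟨0, (Nat.zero_le _).trans_lt i.2⟩
    refine Matrix.det_eq_zero_of_column_eq_zero z fun l => ?_
    by_cases hz : z = i
    · simp only [A, Matrix.of_apply, if_pos hz]
      rw [← hz, show ((z : Fin N) : ℕ) = 0 from rfl,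
        pathEntry_zero_zero (ha' l) (fun j _ => hb j) (by omega), mul_zero]
    · have hlt : z < i := lt_of_le_of_ne (Fin.le_def.2 (Nat.zero_le _)) hz
      simp only [A, Matrix.of_apply, if_neg hz, truncateLevels, if_pos hlt, min_eq_right (ht0 z)]
      rw [show ((z : Fin N) : ℕ) = 0 from rfl,
        pathEntry_zero_zero (ha' l) (fun j _ => hb j) (by rw [hc z hlt]; omega), mul_zero]
  have htop : truncateLevels i t (t i) = t := by
    funext k
    unfold truncateLevels
    split_ifs with h1 h2
    · exact min_eq_left (ht h1.le)
    · rw [h2]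
    · rfl
  have hftc := integral_eq_of_hasDerivAt_off_countable_of_le _ _ (ht0 i)
    (Set.countable_range t) (continuous_const.fun_mul hAcont).continuousOn hderiv
    (((by fun_prop : Continuous fun s : ℝ => (a i + b (c i) : ℂ) *
      Complex.exp ((a i + b (c i)) * s)).fun_mul
        (continuous_pathDet_truncateLevels ha hb c i t)).intervalIntegrable 0 (t i))
  rw [hftc, hzero, mul_zero, sub_zero, ← hA, htop]

end PathDet

/-! ### Last passage times and their recursion -/

section LastPassage

/-- The last passage time from `(1, 1)` to `(i, j)`, by its recursion; it is `0` on the axes. -/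
def boxTime (w : ℕ × ℕ → ℝ) : ℕ → ℕ → ℝ
  | 0, _ => 0
  | _ + 1, 0 => 0
  | i + 1, j + 1 => w (i + 1, j + 1) + max (boxTime w i (j + 1)) (boxTime w (i + 1) j)

@[simp] theorem boxTime_zero_left (w : ℕ × ℕ → ℝ) (j : ℕ) : boxTime w 0 j = 0 := by
  simp [boxTime]

@[simp] theorem boxTime_zero_right (w : ℕ × ℕ → ℝ) (i : ℕ) : boxTime w i 0 = 0 := by
  cases i <;> simp [boxTime]

theorem boxTime_succ_succ (w : ℕ × ℕ → ℝ) (i j : ℕ) : boxTime w (i + 1) (j + 1) =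
    w (i + 1, j + 1) + max (boxTime w i (j + 1)) (boxTime w (i + 1) j) := by
  rw [boxTime]

theorem boxTime_congr {w w' : ℕ × ℕ → ℝ} {i j : ℕ}
    (h : ∀ p : ℕ × ℕ, 1 ≤ p.1 → 1 ≤ p.2 → p.1 ≤ i → p.2 ≤ j → w p = w' p) :
    boxTime w i j = boxTime w' i j := by
  induction i generalizing j with
  | zero => simp
  | succ i ih =>
    induction j with
    | zero => simp
    | succ j ihj =>
      rw [boxTime_succ_succ, boxTime_succ_succ, h _ (by simp) (by simp) le_rfl le_rfl,
        ih fun p h1 h2 h3 h4 => h p h1 h2 (h3.trans i.le_succ) h4,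
        ihj fun p h1 h2 h3 h4 => h p h1 h2 h3 (h4.trans j.le_succ)]

theorem boxTime_nonneg {w : ℕ × ℕ → ℝ} {i j : ℕ}
    (h : ∀ p : ℕ × ℕ, 1 ≤ p.1 → 1 ≤ p.2 → p.1 ≤ i → p.2 ≤ j → 0 ≤ w p) : 0 ≤ boxTime w i j := by
  induction i with
  | zero => simp
  | succ i ih =>
    cases j with
    | zero => simp
    | succ j =>
      rw [boxTime_succ_succ]
      have := ih fun p h1 h2 h3 h4 => h p h1 h2 (h3.trans i.le_succ) h4
      exact add_nonneg (h _ (by simp) (by simp) le_rfl le_rfl) (this.trans (le_max_left _ _))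

theorem boxTime_le_succ {w : ℕ × ℕ → ℝ} {i j : ℕ} (hj : 1 ≤ j) (h : 0 ≤ w (i + 1, j)) :
    boxTime w i j ≤ boxTime w (i + 1) j := by
  obtain ⟨j, rfl⟩ := Nat.exists_eq_succ_of_ne_zero (by omega : j ≠ 0)
  rw [Nat.succ_eq_add_one, boxTime_succ_succ]
  exact (le_max_left _ _).trans (le_add_of_nonneg_left h)

theorem measurable_boxTime (i j : ℕ) : Measurable fun w : ℕ × ℕ → ℝ => boxTime w i j := by
  induction i generalizing j with
  | zero => simp
  | succ i ih =>
    induction j with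
    | zero => simp
    | succ j ihj =>
      simp only [boxTime_succ_succ]
      exact (measurable_pi_apply _).add ((ih _).max ihj)

/-- A directed path from `(1, 1)` that attains the last passage time. -/
theorem exists_path_boxTime {w : ℕ × ℕ → ℝ} {i j : ℕ}
    (h : ∀ p : ℕ × ℕ, 1 ≤ p.1 → 1 ≤ p.2 → p.1 ≤ i + 1 → p.2 ≤ j + 1 → 0 ≤ w p) :
    ∃ π : ℕ → ℕ × ℕ, π 0 = (1, 1) ∧ π (i + j) = (i + 1, j + 1) ∧
      (∀ n < i + j, π (n + 1) = ((π n).1 + 1, (π n).2) ∨ π (n + 1) = ((π n).1, (π n).2 + 1)) ∧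
      ∑ n ∈ Finset.range (i + j + 1), w (π n) = boxTime w (i + 1) (j + 1) := by
  -- A path that ends at a neighbour of `(i + 1, j + 1)` is prolonged by one step.
  have hext : ∀ i j i' j' : ℕ, i + j = i' + j' + 1 →
      ((i + 1, j + 1) = (i' + 1 + 1, j' + 1) ∨ (i + 1, j + 1) = (i' + 1, j' + 1 + 1)) →
      boxTime w (i + 1) (j + 1) = w (i + 1, j + 1) + boxTime w (i' + 1) (j' + 1) →
      (∃ π : ℕ → ℕ × ℕ, π 0 = (1, 1) ∧ π (i' + j') = (i' + 1, j' + 1) ∧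
      (∀ n < i' + j', π (n + 1) = ((π n).1 + 1, (π n).2) ∨ π (n + 1) = ((π n).1, (π n).2 + 1)) ∧
      ∑ n ∈ Finset.range (i' + j' + 1), w (π n) = boxTime w (i' + 1) (j' + 1)) →
      ∃ π : ℕ → ℕ × ℕ, π 0 = (1, 1) ∧ π (i + j) = (i + 1, j + 1) ∧
      (∀ n < i + j, π (n + 1) = ((π n).1 + 1, (π n).2) ∨ π (n + 1) = ((π n).1, (π n).2 + 1)) ∧
      ∑ n ∈ Finset.range (i + j + 1), w (π n) = boxTime w (i + 1) (j + 1) := by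
    rintro i j i' j' hij hstep hG ⟨π, h0, h1, h2, h3⟩
    have hup : ∀ n < i + j, Function.update π (i + j) (i + 1, j + 1) n = π n :=
      fun n hn => Function.update_of_ne hn.ne _ _
    refine ⟨Function.update π (i + j) (i + 1, j + 1), ?_, Function.update_self _ _ _, ?_, ?_⟩
    · rw [hup 0 (by omega), h0]
    · intro n hn
      rw [hup n hn]
      rcases Nat.lt_or_ge (n + 1) (i + j) with hlt | hge
      · rw [hup _ hlt]
        exact h2 n (by omega)
      · obtain rfl : n = i' + j' := by omega
        rw [show i' + j' + 1 = i + j by omega, Function.update_self, h1]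
        exact hstep
    · rw [Finset.sum_range_succ, Function.update_self, hG, add_comm, ← h3, hij]
      congr 1
      refine Finset.sum_congr rfl fun n hn => ?_
      rw [← hij, hup n (by rw [hij]; exact Finset.mem_range.1 hn)]
  induction i generalizing j with
  | zero =>
    induction j with
    | zero => exact ⟨fun _ => (1, 1), rfl, rfl, by omega, by simp [boxTime]⟩
    | succ j ihj =>
      refine hext 0 (j + 1) 0 j (by omega) (Or.inr rfl) ?_
        (ihj fun p h1 h2 h3 h4 => h p h1 h2 h3 (by omega))
      rw [boxTime_succ_succ, max_eq_right]
      rw [boxTime_zero_left]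
      exact boxTime_nonneg fun p h1 h2 h3 h4 => h p h1 h2 h3 (by omega)
  | succ i ih =>
    have hi : ∀ j', j' ≤ j → _ := fun j' hj' =>
      ih (j := j') fun p h1 h2 h3 h4 => h p h1 h2 (by omega) (by omega)
    induction j with
    | zero =>
      refine hext (i + 1) 0 i 0 (by omega) (Or.inl rfl) ?_ (hi 0 le_rfl)
      rw [boxTime_succ_succ, max_eq_left]
      rw [boxTime_zero_right]
      exact boxTime_nonneg fun p h1 h2 h3 h4 => h p h1 h2 (by omega) (by omega)
    | succ j ihj =>
      rcases le_total (boxTime w (i + 1 + 1) (j + 1)) (boxTime w (i + 1) (j + 1 + 1)) with hle | hle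
      · refine hext (i + 1) (j + 1) i (j + 1) (by omega) (Or.inl rfl) ?_ (hi (j + 1) le_rfl)
        rw [boxTime_succ_succ, max_eq_left hle]
      · refine hext (i + 1) (j + 1) (i + 1) j (by omega) (Or.inr rfl) ?_
          (ihj (fun p h1 h2 h3 h4 => h p h1 h2 h3 (by omega)) fun j' hj' => hi j' (by omega))
        rw [boxTime_succ_succ, max_eq_right hle]

/-- The weight collected along an initial segment of a path is at most the last passage time to its
end point. -/
theorem sum_le_boxTime_of_mem_halfLinePaths {L : ℕ} {w : ℕ × ℕ → ℝ} {π : Fin L → ℕ × ℕ}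
    (hπ : π ∈ halfLinePaths L) (n : ℕ) (hn : n < L) :
    1 ≤ (π ⟨n, hn⟩).1 ∧ 1 ≤ (π ⟨n, hn⟩).2 ∧
      ∑ m : Fin (n + 1), w (π ⟨m, by omega⟩) ≤ boxTime w (π ⟨n, hn⟩).1 (π ⟨n, hn⟩).2 := by
  obtain ⟨h0, hs, -⟩ := hπ
  induction n with
  | zero => simp [h0 ⟨0, hn⟩ rfl, boxTime]
  | succ n ih =>
    obtain ⟨h1, h2, h3⟩ := ih (by omega)
    rw [Fin.sum_univ_castSucc]
    simp only [Fin.val_castSucc, Fin.val_last]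
    obtain ⟨i, hi⟩ := Nat.exists_eq_succ_of_ne_zero (by omega : (π ⟨n, Nat.lt_of_succ_lt hn⟩).1 ≠ 0)
    obtain ⟨j, hj⟩ := Nat.exists_eq_succ_of_ne_zero (by omega : (π ⟨n, Nat.lt_of_succ_lt hn⟩).2 ≠ 0)
    rw [hi, hj] at h3
    rcases hs ⟨n, by omega⟩ ⟨n + 1, hn⟩ rfl with h | h
    · rw [h]
      refine ⟨by simp, h2, ?_⟩
      simp only [hi, hj, Nat.succ_eq_add_one] at h3 ⊢
      rw [boxTime_succ_succ w (i + 1) j]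
      have := le_max_left (boxTime w (i + 1) (j + 1)) (boxTime w (i + 1 + 1) j)
      linarith
    · rw [h]
      refine ⟨h1, by simp, ?_⟩
      simp only [hi, hj, Nat.succ_eq_add_one] at h3 ⊢
      rw [boxTime_succ_succ w i (j + 1)]
      have := le_max_right (boxTime w i (j + 1 + 1)) (boxTime w (i + 1) (j + 1))
      linarith

/-- The end points of the half-line paths are the points `(k + 1, 2N - k)` with `k < N`. -/
theorem lastPassageTime_le_iff {N : ℕ} {w : ℕ × ℕ → ℝ} (hw : ∀ p ∈ trapezoid N, 0 ≤ w p) (u : ℝ)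
    (hN : 1 ≤ N) :
    lastPassageTime (2 * N) w ≤ u ↔ ∀ k < N, boxTime w (k + 1) (2 * N - k) ≤ u := by
  rw [isLUB_le_iff (lastPassageTime_isGreatest (2 * N) w).isLUB]
  constructor
  · intro hub k hk
    obtain ⟨j, hj⟩ : ∃ j, 2 * N - k = j + 1 := ⟨2 * N - k - 1, by omega⟩
    obtain ⟨π, h0, h1, h2, h3⟩ := exists_path_boxTime (w := w) (i := k) (j := j)
      fun p h1 h2 h3 h4 => hw p ⟨h1, h2, by omega, by omega⟩
    rw [hj, ← h3]
    have hL : k + j + 1 = 2 * N := by omega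
    rw [hL, ← Fin.sum_univ_eq_sum_range]
    refine hub ⟨fun m => π m, ⟨?_, ?_, ?_⟩, rfl⟩
    · intro m hm; simp [hm, h0]
    · intro m l hl
      have := h2 m (by have := l.2; omega)
      rwa [← hl] at this
    · intro m hm
      have : (m : ℕ) = k + j := by omega
      simp only [this, h1]
      omega
  · rintro hG _ ⟨π, hπ, rfl⟩
    have hlast : 2 * N - 1 < 2 * N := by omega
    obtain ⟨h1, h2, h3⟩ := sum_le_boxTime_of_mem_halfLinePaths (w := w) hπ (2 * N - 1) hlast
    obtain ⟨h4, h5⟩ := hπ.2.2 ⟨2 * N - 1, hlast⟩ (by simp; omega)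
    set p := π ⟨2 * N - 1, hlast⟩ with hp
    have h6 := hG (p.1 - 1) (by omega)
    rw [show p.1 - 1 + 1 = p.1 by omega, show 2 * N - (p.1 - 1) = p.2 by omega] at h6
    refine le_trans (le_of_eq ?_) (h3.trans h6)
    refine (Fintype.sum_equiv (finCongr (by omega : 2 * N - 1 + 1 = 2 * N)) _ _ fun m => ?_).symm
    rfl

end LastPassage

/-! ### Joint distributions of last passage times -/

section Probability

variable {Ω : Type*} [MeasurableSpace Ω] {P : Measure Ω}

theorem ae_nonneg_of_map_eq_expMeasure {X : Ω → ℝ} (hX : Measurable X) {r : ℝ}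
    (h : P.map X = expMeasure r) : ∀ᵐ ω ∂P, 0 ≤ X ω := by
  have h1 : expMeasure r (Set.Iio 0) = 0 := by
    rw [expMeasure, gammaMeasure, withDensity_apply _ measurableSet_Iio,
      setLIntegral_congr_fun measurableSet_Iio
        (fun x (hx : x < 0) => gammaPDF_of_neg (a := 1) (r := r) hx)]
    simp
  rw [← h, Measure.map_apply hX measurableSet_Iio] at h1
  have h2 : ∀ᵐ ω ∂P, ω ∉ X ⁻¹' Set.Iio 0 := measure_eq_zero_iff_ae_notMem.1 h1
  filter_upwards [h2] with ω hω
  simpa using hω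

/-- The integral against the exponential law of a function that vanishes beyond `T`. -/
theorem integral_expMeasure_eq {r T : ℝ} (hr : 0 < r) (hT : 0 ≤ T) {g : ℝ → ℝ}
    (hg : ∀ x, T < x → g x = 0) :
    ∫ x, g x ∂expMeasure r = ∫ x in (0 : ℝ)..T, r * Real.exp (-(r * x)) * g x := by
  change ∫ x, g x ∂(volume.withDensity fun x => ENNReal.ofReal (gammaPDFReal 1 r x)) = _
  rw [integral_withDensity_eq_integral_toReal_smul
    (measurable_gammaPDFReal 1 r).ennreal_ofReal
    (Filter.Eventually.of_forall fun x => ENNReal.ofReal_lt_top),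
    intervalIntegral.integral_of_le hT, ← integral_indicator measurableSet_Ioc]
  refine integral_congr_ae ?_
  have h0 : ∀ᵐ x : ℝ, x ≠ 0 := by simp [ae_iff]
  filter_upwards [h0] with x hx
  change (exponentialPDF r x).toReal • g x = _
  rw [exponentialPDF_eq]
  rcases lt_or_gt_of_ne hx with h | h
  · rw [if_neg (not_le.2 h), Set.indicator_of_notMem fun hm : x ∈ Set.Ioc 0 T =>
      absurd hm.1 (not_lt.2 h.le)]
    simp
  · rw [if_pos h.le, ENNReal.toReal_ofReal (by positivity)]
    rcases le_or_gt x T with h' | h'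
    · rw [Set.indicator_of_mem (show x ∈ Set.Ioc 0 T from ⟨h, h'⟩), smul_eq_mul]
    · rw [Set.indicator_of_notMem fun hm : x ∈ Set.Ioc 0 T =>
        absurd hm.2 (not_le.2 h'), hg x h', smul_zero]

/-- Independence of one of the weights from all the others. -/
theorem indepFun_erase {ι : Type*} [DecidableEq ι] {X : ι → Ω → ℝ} (hX : ∀ p, Measurable (X p))
    {T : Finset ι} (hindep : iIndepFun (fun p : T => X p) P) {p₀ : ι} (hp₀ : p₀ ∈ T) :
    IndepFun (X p₀) (fun ω p => if p ∈ T.erase p₀ then X p ω else 0) P := by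
  have h := hindep.indepFun_finset {⟨p₀, hp₀⟩} (Finset.univ.erase ⟨p₀, hp₀⟩)
    (by simp) fun p => hX p
  let φ : (({⟨p₀, hp₀⟩} : Finset T) → ℝ) → ℝ := fun v => v ⟨⟨p₀, hp₀⟩, by simp⟩
  let ψ : ((Finset.univ.erase (⟨p₀, hp₀⟩ : T) : Finset T) → ℝ) → ι → ℝ := fun v p =>
    if hp : p ∈ T.erase p₀ then
      v ⟨⟨p, Finset.mem_of_mem_erase hp⟩, by simpa using Finset.ne_of_mem_erase hp⟩ else 0
  have hφ : Measurable φ := measurable_pi_apply _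
  have hψ : Measurable ψ := measurable_pi_iff.2 fun p => by
    by_cases hp : p ∈ T.erase p₀
    · simp only [ψ, dif_pos hp]
      exact measurable_pi_apply _
    · simp only [ψ, dif_neg hp]
      exact measurable_const
  exact h.comp hφ hψ

variable [IsProbabilityMeasure P] {N : ℕ} {a b : ℕ → ℝ} {X : ℕ × ℕ → Ω → ℝ} {T : Finset (ℕ × ℕ)}

/-- The event that the last passage time to the end of each row `k` of length `c k` is at most
`t k`. -/
def rowEvent (X : ℕ × ℕ → Ω → ℝ) (c : Fin N → ℕ) (t : Fin N → ℝ) : Set Ω :=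
  {ω | ∀ k : Fin N, boxTime (fun p => X p ω) (k + 1) (c k) ≤ t k}

/-- Conditioning on the weight `t i - s` of a box that is added at the end of row `i`. The rows above
`i` already reach into the column of the new box, so that their last passage times are dominated by the
one at the box above the new box. -/
theorem measureReal_rowEvent_update_succ (hX : ∀ p, Measurable (X p))
    (hindep : iIndepFun (fun p : T => X p) P)
    (hlaw : ∀ i j : ℕ, (i + 1, j + 1) ∈ T → P.map (X (i + 1, j + 1)) = expMeasure (a i + b j))
    (hpos : ∀ i j : ℕ, (i + 1, j + 1) ∈ T → 0 < a i + b j) (c : Fin N → ℕ) (i : Fin N)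
    (hanti : Antitone c) (hc : ∀ k < i, c k = c i + 1)
    (hT : ∀ k : Fin N, ∀ j < Function.update c i (c i + 1) k, ((k : ℕ) + 1, j + 1) ∈ T)
    {t : Fin N → ℝ} (ht0 : ∀ k, 0 ≤ t k) :
    P.real (rowEvent X (Function.update c i (c i + 1)) t) =
      ∫ s in (0 : ℝ)..t i, (a i + b (c i)) * Real.exp (-((a i + b (c i)) * (t i - s))) *
        P.real (rowEvent X c (truncateLevels i t s)) := by
  set r := a i + b (c i) with hr
  set p₀ : ℕ × ℕ := ((i : ℕ) + 1, c i + 1) with hp₀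
  have hp₀T : p₀ ∈ T := hT i (c i) (by simp)
  have hanti' : ∀ k k' : Fin N, k' ≤ k →
      Function.update c i (c i + 1) k ≤ Function.update c i (c i + 1) k' := by
    intro k k' hk
    have h1 := hanti hk
    by_cases hki : k = i <;> by_cases hk'i : k' = i
    · rw [hki, hk'i]
    · subst hki
      rw [Function.update_self, Function.update_of_ne hk'i, hc k' (lt_of_le_of_ne hk hk'i)]
    · subst hk'i
      rw [Function.update_self, Function.update_of_ne hki]
      omega
    · rwa [Function.update_of_ne hki, Function.update_of_ne hk'i]
  let Z : Ω → ℕ × ℕ → ℝ := fun ω p => if p ∈ T.erase p₀ then X p ω else 0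
  have hZm : Measurable Z := measurable_pi_iff.2 fun p => by
    by_cases hp : p ∈ T.erase p₀
    · simp only [Z, if_pos hp]; exact hX p
    · simp only [Z, if_neg hp]; exact measurable_const
  have hXZ : IndepFun (X p₀) Z P := indepFun_erase hX hindep hp₀T
  have hmemT : ∀ (k : Fin N) (p : ℕ × ℕ), 1 ≤ p.1 → 1 ≤ p.2 → p.1 ≤ k + 1 →
      p.2 ≤ Function.update c i (c i + 1) k → p ∈ T := by
    intro k p h1 h2 h3 h4
    have := hT ⟨p.1 - 1, by have := k.2; omega⟩ (p.2 - 1) (by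
      have := hanti' k ⟨p.1 - 1, by have := k.2; omega⟩ (Fin.le_def.2 (by simp; omega))
      omega)
    simp only [Nat.sub_add_cancel h1, Nat.sub_add_cancel h2] at this
    exact this
  -- The rows of the old diagram do not see the box `p₀`.
  have hZ : ∀ ω (m n : ℕ), (∀ p : ℕ × ℕ, 1 ≤ p.1 → 1 ≤ p.2 → p.1 ≤ m → p.2 ≤ n →
      p ∈ T ∧ p ≠ p₀) → boxTime (Z ω) m n = boxTime (fun p => X p ω) m n := by
    intro ω m n h
    refine boxTime_congr fun p h1 h2 h3 h4 => ?_
    obtain ⟨h5, h6⟩ := h p h1 h2 h3 h4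
    simp only [Z, if_pos (Finset.mem_erase.2 ⟨h6, h5⟩)]
  have hle : ∀ k, c k ≤ Function.update c i (c i + 1) k := fun k => by
    by_cases hk : k = i
    · subst hk; simp
    · rw [Function.update_of_ne hk]
  have hrow : ∀ (k : Fin N) (p : ℕ × ℕ), 1 ≤ p.1 → 1 ≤ p.2 → p.1 ≤ k + 1 → p.2 ≤ c k →
      p ∈ T ∧ p ≠ p₀ := by
    intro k p h1 h2 h3 h4
    refine ⟨hmemT k p h1 h2 h3 (h4.trans (hle k)), fun he => ?_⟩
    rw [he, hp₀] at h3 h4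
    simp only at h3 h4
    have := hanti (Fin.le_def.2 (by omega) : i ≤ k)
    omega
  have habove : ∀ p : ℕ × ℕ, 1 ≤ p.1 → 1 ≤ p.2 → p.1 ≤ (i : ℕ) → p.2 ≤ c i + 1 →
      p ∈ T ∧ p ≠ p₀ := by
    intro p h1 h2 h3 h4
    refine ⟨hmemT i p h1 h2 (by omega) (by simpa using h4), fun he => ?_⟩
    rw [he, hp₀] at h3
    simp at h3
  let S : Set (ℝ × (ℕ × ℕ → ℝ)) := {q | (∀ k : Fin N, k ≠ i → boxTime q.2 (k + 1) (c k) ≤ t k) ∧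
    q.1 + max (boxTime q.2 i (c i + 1)) (boxTime q.2 (i + 1) (c i)) ≤ t i}
  have hSm : MeasurableSet S := by
    refine MeasurableSet.inter (s₁ := {q : ℝ × (ℕ × ℕ → ℝ) | ∀ k : Fin N, k ≠ i →
      boxTime q.2 (k + 1) (c k) ≤ t k}) ?_ ?_
    · rw [show {q : ℝ × (ℕ × ℕ → ℝ) | ∀ k : Fin N, k ≠ i → boxTime q.2 (k + 1) (c k) ≤ t k} =
        ⋂ k : Fin N, ⋂ _ : k ≠ i, {q | boxTime q.2 (k + 1) (c k) ≤ t k} by ext; simp]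
      exact MeasurableSet.iInter fun k => MeasurableSet.iInter fun _ => measurableSet_le
        ((measurable_boxTime _ _).comp measurable_snd) measurable_const
    · exact measurableSet_le (measurable_fst.add (((measurable_boxTime _ _).comp
        measurable_snd).max ((measurable_boxTime _ _).comp measurable_snd))) measurable_const
  have hnew : rowEvent X (Function.update c i (c i + 1)) t = (fun ω => (X p₀ ω, Z ω)) ⁻¹' S := by
    ext ω
    simp only [rowEvent, Set.mem_ofPred_eq, Set.mem_preimage, S]
    rw [hZ ω _ _ habove, hZ ω _ _ (hrow i),
      ← (boxTime_succ_succ (fun p => X p ω) i (c i) : _ = X p₀ ω + _)]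
    constructor
    · refine fun h => ⟨fun k hk => ?_, by simpa using h i⟩
      have := h k
      rwa [Function.update_of_ne hk, ← hZ ω _ _ (hrow k)] at this
    · rintro ⟨h1, h2⟩ k
      by_cases hk : k = i
      · subst hk; simpa using h2
      · rw [Function.update_of_ne hk, ← hZ ω _ _ (hrow k)]
        exact h1 k hk
  have hnonneg : ∀ᵐ ω ∂P, ∀ p ∈ T, 1 ≤ p.1 → 1 ≤ p.2 → 0 ≤ X p ω := by
    rw [Finset.eventually_all]
    rintro ⟨m, n⟩ hp
    by_cases h1 : 1 ≤ m ∧ 1 ≤ n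
    · obtain ⟨m, rfl⟩ := Nat.exists_eq_succ_of_ne_zero (by omega : m ≠ 0)
      obtain ⟨n, rfl⟩ := Nat.exists_eq_succ_of_ne_zero (by omega : n ≠ 0)
      filter_upwards [ae_nonneg_of_map_eq_expMeasure (hX _) (hlaw m n hp)] with ω hω _ _
      exact hω
    · exact Filter.Eventually.of_forall fun ω h2 h3 => absurd ⟨h2, h3⟩ h1
  have hsec : ∀ ω, (∀ p ∈ T, 1 ≤ p.1 → 1 ≤ p.2 → 0 ≤ X p ω) → ∀ x : ℝ,
      (x, Z ω) ∈ S ↔ x ≤ t i ∧ ω ∈ rowEvent X c (truncateLevels i t (t i - x)) := by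
    intro ω hω x
    simp only [rowEvent, Set.mem_ofPred_eq, S]
    rw [hZ ω _ _ habove, hZ ω _ _ (hrow i)]
    have hub : 0 ≤ boxTime (fun p => X p ω) i (c i + 1) :=
      boxTime_nonneg fun p h1 h2 h3 h4 => hω p (habove p h1 h2 h3 h4).1 h1 h2
    constructor
    · rintro ⟨h1, h2⟩
      have h3 := le_max_left (boxTime (fun p => X p ω) i (c i + 1))
        (boxTime (fun p => X p ω) (i + 1) (c i))
      have h4 := le_max_right (boxTime (fun p => X p ω) i (c i + 1))
        (boxTime (fun p => X p ω) (i + 1) (c i))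
      refine ⟨by linarith, fun k => ?_⟩
      unfold truncateLevels
      split_ifs with hk hk'
      · refine le_min ?_ ?_
        · rw [← hZ ω _ _ (hrow k)]; exact h1 k hk.ne
        · -- Last passage times increase along the column, up to row `i`.
          have hmono : ∀ m, (k : ℕ) + 1 + m ≤ i → boxTime (fun p => X p ω) (k + 1) (c i + 1) ≤
              boxTime (fun p => X p ω) (k + 1 + m) (c i + 1) := by
            intro m
            induction m with
            | zero => exact fun _ => le_rfl
            | succ m ih =>
              intro hm
              refine (ih (by omega)).trans (boxTime_le_succ (by omega) ?_)
              exact hω _ (habove (k + 1 + m + 1, c i + 1) (by simp) (by simp) hm le_rfl).1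
                (by simp) (by simp)
          have h5 := hmono (i - (k + 1)) (by have := Fin.lt_def.1 hk; omega)
          rw [show (k : ℕ) + 1 + (i - (k + 1)) = i by have := Fin.lt_def.1 hk; omega] at h5
          rw [hc k hk]
          linarith
      · subst hk'; linarith
      · rw [← hZ ω _ _ (hrow k)]; exact h1 k hk'
    · rintro ⟨hx, h⟩
      refine ⟨fun k hk => ?_, ?_⟩
      · rw [hZ ω _ _ (hrow k)]
        refine (h k).trans ?_
        unfold truncateLevels
        split_ifs
        · exact min_le_left _ _
        · exact le_rfl
      · have hi := h i
        simp only [truncateLevels, lt_irrefl, if_false, if_true] at hi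
        have hab : boxTime (fun p => X p ω) i (c i + 1) ≤ t i - x := by
          rcases Nat.eq_zero_or_pos (i : ℕ) with h0 | h0
          · rw [h0, boxTime_zero_left]; linarith
          · have hki : (⟨i - 1, by omega⟩ : Fin N) < i := Fin.lt_def.2 (by simp; omega)
            have := h ⟨i - 1, by omega⟩
            rw [truncateLevels, if_pos hki, hc _ hki] at this
            simp only [Nat.sub_add_cancel h0] at this
            exact this.trans (min_le_right _ _)
        have := max_le hab hi
        linarith
  have hSx : ∀ x, (P.map Z) (Prod.mk x ⁻¹' S) = P {ω | (x, Z ω) ∈ S} := fun x => by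
    rw [Measure.map_apply hZm (measurable_prodMk_left hSm)]; rfl
  have hprob : IsProbabilityMeasure (P.map Z) := Measure.isProbabilityMeasure_map hZm.aemeasurable
  rw [hnew, measureReal_def, ← Measure.map_apply ((hX p₀).prodMk hZm) hSm,
    hXZ.map_prod_eq_prod_map_map (hX p₀).aemeasurable hZm.aemeasurable, Measure.prod_apply hSm,
    ← integral_toReal (measurable_measure_prodMk_left hSm).aemeasurable
      (Filter.Eventually.of_forall fun x => measure_lt_top _ _),
    hlaw i (c i) hp₀T, integral_expMeasure_eq (hpos i (c i) hp₀T) (ht0 i)]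
  · have := intervalIntegral.integral_comp_sub_left (a := 0) (b := t i)
      (fun s => r * Real.exp (-(r * (t i - s))) * P.real (rowEvent X c (truncateLevels i t s))) (t i)
    rw [sub_self, sub_zero] at this
    rw [← this]
    refine intervalIntegral.integral_congr fun x hx => ?_
    rw [Set.uIcc_of_le (ht0 i)] at hx
    simp only [sub_sub_cancel]
    congr 1
    rw [hSx, measureReal_def]
    congr 1
    refine measure_congr ?_
    filter_upwards [hnonneg] with ω hω
    exact propext ((hsec ω hω x).trans ⟨fun h => h.2, fun h => ⟨hx.2, h⟩⟩)
  · intro x hx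
    rw [hSx, ENNReal.toReal_eq_zero_iff]
    left
    rw [measure_eq_zero_iff_ae_notMem]
    filter_upwards [hnonneg] with ω hω hmem
    exact absurd ((hsec ω hω x).1 hmem).1 (not_le.2 hx)

theorem monotone_truncateLevels (i : Fin N) {t : Fin N → ℝ} (ht : Monotone t) {s : ℝ}
    (hs : s ≤ t i) : Monotone (truncateLevels i t s) := by
  intro k k' hk
  have h1 := ht hk
  unfold truncateLevels
  split_ifs with h2 h3 h4 h5 h6
  · exact min_le_min_right _ h1
  · exact min_le_right _ _
  · exact (min_le_right _ _).trans (hs.trans (ht (not_lt.1 h3)))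
  · exact absurd (h5 ▸ hk) (not_le.2 ‹k' < i›)
  · exact le_rfl
  · exact hs.trans (h5 ▸ h1)
  · exact absurd (hk.trans_lt ‹k' < i›) h2
  · exact absurd (lt_of_le_of_ne (‹k' = i› ▸ hk) h5) h2
  · exact h1

theorem truncateLevels_nonneg (i : Fin N) {t : Fin N → ℝ} (ht0 : ∀ k, 0 ≤ t k) {s : ℝ}
    (hs : 0 ≤ s) (k : Fin N) : 0 ≤ truncateLevels i t s k := by
  unfold truncateLevels
  split_ifs
  · exact le_min (ht0 k) hs
  · exact hs
  · exact ht0 k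

/-- If the determinantal formula holds for a diagram, it holds for the diagram with one more box. -/
theorem measureReal_rowEvent_eq_pathDet_of_update (hX : ∀ p, Measurable (X p))
    (hindep : iIndepFun (fun p : T => X p) P)
    (hlaw : ∀ i j : ℕ, (i + 1, j + 1) ∈ T → P.map (X (i + 1, j + 1)) = expMeasure (a i + b j))
    (hpos : ∀ i j : ℕ, (i + 1, j + 1) ∈ T → 0 < a i + b j) (c : Fin N → ℕ) (i : Fin N)
    (hanti : Antitone c) (hc : ∀ k < i, c k = c i + 1)
    (hT : ∀ k : Fin N, ∀ j < Function.update c i (c i + 1) k, ((k : ℕ) + 1, j + 1) ∈ T)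
    {R : ℝ} (ha : ∀ m < N, |a m| < R) (hb : ∀ j, |b j| < R)
    (hold : ∀ t : Fin N → ℝ, Monotone t → (∀ k, 0 ≤ t k) →
      (P.real (rowEvent X c t) : ℂ) = pathDet R a b c t)
    (t : Fin N → ℝ) (ht : Monotone t) (ht0 : ∀ k, 0 ≤ t k) :
    (P.real (rowEvent X (Function.update c i (c i + 1)) t) : ℂ) =
      pathDet R a b (Function.update c i (c i + 1)) t := by
  have hne := Complex.exp_ne_zero ((a i + b (c i)) * t i)
  refine mul_left_cancel₀ hne ?_
  rw [pathDet_update_succ ha hb c i hc ht ht0,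
    measureReal_rowEvent_update_succ hX hindep hlaw hpos c i hanti hc hT ht0,
    ← intervalIntegral.integral_ofReal, ← intervalIntegral.integral_const_mul]
  refine intervalIntegral.integral_congr fun s hs => ?_
  rw [Set.uIcc_of_le (ht0 i)] at hs
  rw [← hold _ (monotone_truncateLevels i ht hs.2) (truncateLevels_nonneg i ht0 hs.1)]
  push_cast
  rw [show ((a i : ℂ) + b (c i)) * s = (a i + b (c i)) * t i + -((a i + b (c i)) * (t i - s)) by ring,
    Complex.exp_add]
  ring

/-- The diagram with `2N - k` boxes in row `k`, cut after the first `j` columns and the first `i` boxes of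
the next column. -/
def columnShape (N i j : ℕ) (k : Fin N) : ℕ := min (2 * N - k) (if (k : ℕ) < i then j + 1 else j)

/-- The joint distribution function of the last passage times at the ends of the rows of the
diagram that has `2N - k` boxes in row `k`. -/
theorem measureReal_rowEvent_eq_pathDet (hX : ∀ p, Measurable (X p))
    (hindep : iIndepFun (fun p : T => X p) P)
    (hlaw : ∀ i j : ℕ, (i + 1, j + 1) ∈ T → P.map (X (i + 1, j + 1)) = expMeasure (a i + b j))
    (hpos : ∀ i j : ℕ, (i + 1, j + 1) ∈ T → 0 < a i + b j)
    (hT : ∀ k < N, ∀ j < 2 * N - k, (k + 1, j + 1) ∈ T)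
    {R : ℝ} (ha : ∀ m < N, |a m| < R) (hb : ∀ j, |b j| < R)
    {t : Fin N → ℝ} (ht : Monotone t) (ht0 : ∀ k, 0 ≤ t k) :
    (P.real (rowEvent X (fun k : Fin N => 2 * N - k) t) : ℂ) =
      pathDet R a b (fun k : Fin N => 2 * N - k) t := by
  -- The boxes are added column by column, from the top to the bottom of each column.
  have hstep : ∀ j i : ℕ, i + 1 ≤ N →
      (∀ t : Fin N → ℝ, Monotone t → (∀ k, 0 ≤ t k) →
        (P.real (rowEvent X (columnShape N i j) t) : ℂ) = pathDet R a b (columnShape N i j) t) →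
      ∀ t : Fin N → ℝ, Monotone t → (∀ k, 0 ≤ t k) →
        (P.real (rowEvent X (columnShape N (i + 1) j) t) : ℂ) =
          pathDet R a b (columnShape N (i + 1) j) t := by
    intro j i hi ih
    rcases Nat.lt_or_ge j (2 * N - i) with hj | hj
    · have hcol : columnShape N i j ⟨i, hi⟩ = j := by
        simp only [columnShape, lt_irrefl, if_false]
        omega
      have hupd : columnShape N (i + 1) j =
          Function.update (columnShape N i j) ⟨i, hi⟩ (columnShape N i j ⟨i, hi⟩ + 1) := by
        funext k
        by_cases hk : k = ⟨i, hi⟩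
        · subst hk
          rw [Function.update_self, hcol]
          simp only [columnShape, Nat.lt_succ_self, if_true]
          omega
        · have hk' : (k : ℕ) ≠ i := fun h => hk (Fin.ext h)
          rw [Function.update_of_ne hk]
          simp only [columnShape, show (k : ℕ) < i + 1 ↔ (k : ℕ) < i by omega]
      rw [hupd]
      refine measureReal_rowEvent_eq_pathDet_of_update hX hindep hlaw hpos _ _ ?_ ?_ ?_ ha hb ih
      · intro k k' hk
        have := Fin.le_def.1 hk
        simp only [columnShape]
        split_ifs <;> omega
      · intro k hk
        have := Fin.lt_def.1 hk
        rw [hcol]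
        simp only [columnShape]
        simp only at this
        rw [if_pos this]
        omega
      · rw [← hupd]
        intro k j' hj'
        exact hT k k.2 j' (hj'.trans_le (min_le_left _ _))
    · have hsame : columnShape N (i + 1) j = columnShape N i j := by
        funext k
        simp only [columnShape]
        have := k.2
        split_ifs <;> omega
      rwa [hsame]
  have key : ∀ j i : ℕ, i ≤ N → ∀ t : Fin N → ℝ, Monotone t → (∀ k, 0 ≤ t k) →
      (P.real (rowEvent X (columnShape N i j) t) : ℂ) = pathDet R a b (columnShape N i j) t := by
    intro j
    induction j with
    | zero =>
      intro i
      induction i with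
      | zero =>
        intro _ t _ ht0
        have hzero : columnShape N 0 0 = fun _ => 0 := funext fun k => by simp [columnShape]
        have huniv : rowEvent X (fun _ : Fin N => 0) t = Set.univ :=
          Set.eq_univ_of_forall fun ω k => by simpa using ht0 k
        rw [hzero, pathDet_zero ha, huniv]
        simp
      | succ i ih => exact fun hi => hstep 0 i hi (ih (by omega))
    | succ j ihj =>
      intro i
      induction i with
      | zero =>
        have hnext : columnShape N 0 (j + 1) = columnShape N N j := funext fun k => by
          simp [columnShape]
        intro _
        rw [hnext]
        exact ihj N le_rfl
      | succ i ih => exact fun hi => hstep (j + 1) i hi (ih (by omega))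
  have hfin : (fun k : Fin N => 2 * N - k) = columnShape N 0 (2 * N) := funext fun k => by
    simp [columnShape]
  rw [hfin]
  exact key (2 * N) 0 (Nat.zero_le _) t ht ht0

end Probability

/-! ### The distribution function of the point-to-half-line time -/

section HalfLine

/-- The contribution of column `j + 1` of the trapezoid to the rates of its weights. It is used for
`j < 2N` only, where `2N - 1 - j` does not truncate. -/
def columnRate (N : ℕ) (a b : ℕ → ℝ) (j : ℕ) : ℝ := if j < N then b j else a (2 * N - 1 - j)

theorem weightRate_succ_succ {N : ℕ} (α β : ℕ → ℝ) (i : ℕ) {j : ℕ} (hj : j < 2 * N) :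
    weightRate N α β (i + 1, j + 1) =
      α (i + 1) + columnRate N (fun m => α (m + 1)) (fun m => β (m + 1)) j := by
  unfold weightRate columnRate
  simp only
  by_cases h : j < N
  · rw [if_pos h, if_pos (by omega)]
  · rw [if_neg h, if_neg (by omega), show 2 * N - (j + 1) + 1 = 2 * N - 1 - j + 1 by omega]

theorem finite_trapezoid (N : ℕ) : (trapezoid N).Finite :=
  (Set.finite_Icc ((0, 0) : ℕ × ℕ) (2 * N + 1, 2 * N + 1)).subset fun p hp => by
    obtain ⟨h1, h2, h3, h4⟩ := hp
    exact ⟨⟨Nat.zero_le _, Nat.zero_le _⟩, ⟨by simp only; omega, by simp only; omega⟩⟩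

/-- The distribution function of the last passage time as the determinant `pathDet`, with row `k` of
length `2N - k` and all levels equal to `u`. -/
theorem measureReal_lastPassageTime_le {Ω : Type*} [MeasurableSpace Ω] (P : Measure Ω)
    [IsProbabilityMeasure P] {N : ℕ} (hN : 1 ≤ N) {α β : ℕ → ℝ}
    (hα : ∀ m ∈ Finset.Icc 1 N, 0 < α m) (hβ : ∀ m ∈ Finset.Icc 1 N, 0 < β m)
    (W : ℕ × ℕ → Ω → ℝ) (hIndep : iIndepFun (fun p : trapezoid N => W p) P)
    (hLaw : ∀ p ∈ trapezoid N, HasLaw (W p) (expMeasure (weightRate N α β p)) P)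
    {u : ℝ} (hu : 0 < u) {R : ℝ} (hαR : ∀ m < N, |α (m + 1)| < R) (hβR : ∀ m < N, |β (m + 1)| < R) :
    (P.real {ω | lastPassageTime (2 * N) (fun p => W p ω) ≤ u} : ℂ) =
      pathDet R (fun m => α (m + 1)) (columnRate N (fun m => α (m + 1)) fun m => β (m + 1))
        (fun k : Fin N => 2 * N - k) fun _ => u := by
  classical
  set a : ℕ → ℝ := fun m => α (m + 1) with ha
  set b := columnRate N a fun m => β (m + 1) with hb
  have ha0 : ∀ m < N, 0 < a m := fun m hm => hα _ (Finset.mem_Icc.2 ⟨by omega, by omega⟩)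
  have hb0 : ∀ j, 0 < b j := fun j => by
    simp only [hb, columnRate]
    split_ifs with h
    · exact hβ _ (Finset.mem_Icc.2 ⟨by omega, by omega⟩)
    · exact ha0 _ (by omega)
  have hbR : ∀ j, |b j| < R := fun j => by
    simp only [hb, columnRate]
    split_ifs with h
    · exact hβR j h
    · exact hαR _ (by omega)
  let T := (finite_trapezoid N).toFinset
  have hmemT : ∀ p, p ∈ T ↔ p ∈ trapezoid N := fun p => (finite_trapezoid N).mem_toFinset
  -- Measurable versions of the weights.
  let X : ℕ × ℕ → Ω → ℝ := fun p =>
    if h : p ∈ trapezoid N then (hLaw p h).aemeasurable.mk (W p) else 0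
  have hX : ∀ p, Measurable (X p) := fun p => by
    by_cases h : p ∈ trapezoid N
    · simp only [X, dif_pos h]; exact (hLaw p h).aemeasurable.measurable_mk
    · simp only [X, dif_neg h]; exact measurable_const
  have hXW : ∀ p ∈ trapezoid N, W p =ᵐ[P] X p := fun p h => by
    simp only [X, dif_pos h]; exact (hLaw p h).aemeasurable.ae_eq_mk
  have hindep : iIndepFun (fun p : T => X p) P := by
    have h1 : iIndepFun (fun p : trapezoid N => X p) P := hIndep.congr fun p => hXW p p.2
    exact h1.precomp (g := fun p : T => (⟨p, (hmemT p).1 p.2⟩ : trapezoid N))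
      fun p q hpq => Subtype.ext (congrArg (fun x : trapezoid N => (x : ℕ × ℕ)) hpq)
  have hrate : ∀ i j : ℕ, (i + 1, j + 1) ∈ T → weightRate N α β (i + 1, j + 1) = a i + b j := by
    intro i j h
    obtain ⟨-, -, h3, -⟩ := (hmemT _).1 h
    exact weightRate_succ_succ α β i (by simp only at h3; omega)
  have hlaw : ∀ i j : ℕ, (i + 1, j + 1) ∈ T → P.map (X (i + 1, j + 1)) = expMeasure (a i + b j) := by
    intro i j h
    rw [← hrate i j h, ← (hLaw _ ((hmemT _).1 h)).map_eq]
    exact Measure.map_congr (hXW _ ((hmemT _).1 h)).symm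
  have hpos : ∀ i j : ℕ, (i + 1, j + 1) ∈ T → 0 < a i + b j := by
    intro i j h
    obtain ⟨-, -, -, h4⟩ := (hmemT _).1 h
    exact add_pos (ha0 i (by simp only at h4; omega)) (hb0 j)
  have hT : ∀ k < N, ∀ j < 2 * N - k, (k + 1, j + 1) ∈ T := fun k hk j hj =>
    (hmemT _).2 ⟨by simp, by simp, by simp only; omega, by simp only; omega⟩
  rw [← measureReal_rowEvent_eq_pathDet hX hindep hlaw hpos hT hαR hbR (t := fun _ => u)
    (fun _ _ _ => le_rfl) fun _ => hu.le]
  congr 1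
  refine measureReal_congr ?_
  have h1 : ∀ᵐ ω ∂P, ∀ p ∈ T, W p ω = X p ω ∧ 0 ≤ X p ω := by
    rw [Finset.eventually_all]
    rintro ⟨m, n⟩ hp
    obtain ⟨hm, hn, -, -⟩ := (hmemT _).1 hp
    obtain ⟨m, rfl⟩ := Nat.exists_eq_succ_of_ne_zero (by simp only at hm; omega : m ≠ 0)
    obtain ⟨n, rfl⟩ := Nat.exists_eq_succ_of_ne_zero (by simp only at hn; omega : n ≠ 0)
    exact (hXW _ ((hmemT _).1 hp)).and (ae_nonneg_of_map_eq_expMeasure (hX _) (hlaw m n hp))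
  filter_upwards [h1] with ω hω
  refine propext ?_
  change lastPassageTime (2 * N) (fun p => W p ω) ≤ u ↔
    ∀ k : Fin N, boxTime (fun p => X p ω) (k + 1) (2 * N - k) ≤ u
  rw [lastPassageTime_le_iff (fun p hp => by
    have := hω p ((hmemT p).2 hp)
    rw [this.1]; exact this.2) u hN, Fin.forall_iff]
  refine forall₂_congr fun k hk => ?_
  rw [boxTime_congr fun p h1 h2 h3 h4 => (hω p ((hmemT p).2 ⟨h1, h2, by omega, by omega⟩)).1]

end HalfLine

/-! ### Residues of the kernel -/

section ContourAlgebra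

variable {γ γ₁ γ₂ : ℝ → ℂ} {f : ℂ → ℂ}

/-- Cauchy's integral formula in the right half-plane. -/
theorem contourIntegral_mul_inv_sub (h : IsClosedPath γ) (htr : contourTrace γ ⊆ rightHalfPlane)
    (hf : DifferentiableOn ℂ f rightHalfPlane) {p : ℂ} (hp : WindsOnce γ p)
    (hpr : p ∈ rightHalfPlane) :
    contourIntegral γ (fun z => f z * (z - p)⁻¹) = 2 * Real.pi * Complex.I * f p := by
  have h1 := contourIntegral_mul_prod_inv_insert (ι := Unit) (s := ∅) (i := ()) h
    isOpen_rightHalfPlane htr hf (by simp) (fun _ => p) (fun _ _ => hp) hpr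
  have h2 : DifferentiableOn ℂ (dslope f p) rightHalfPlane :=
    (Complex.differentiableOn_dslope (isOpen_rightHalfPlane.mem_nhds hpr)).2 hf
  simp only [insert_empty_eq, Finset.prod_singleton, Finset.prod_empty, inv_one, mul_one] at h1
  rw [h1, contourIntegral_eq_zero_of_differentiableOn h htr h2, hp.2]
  ring

/-- A rational function that decays at infinity at least like `z⁻²` has zero integral around all its
poles. -/
theorem contourIntegral_prod_mul_prod_inv_eq_zero {ι κ : Type*} (h : IsClosedPath γ)
    (t : Finset κ) (c : κ → ℂ) (s : Finset ι) (a : ι → ℂ) (hs : ∀ i ∈ s, WindsOnce γ (a i))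
    (hts : t.card + 2 ≤ s.card) :
    contourIntegral γ (fun z => (∏ j ∈ t, (z - c j)) * (∏ i ∈ s, (z - a i))⁻¹) = 0 := by
  classical
  induction t using Finset.induction_on generalizing s with
  | empty =>
    simp only [Finset.prod_empty, one_mul]
    rw [contourIntegral_prod_inv h s a hs (Finset.card_pos.1 (by omega)), if_neg]
    have : (∅ : Finset κ).card = 0 := rfl
    omega
  | insert j t hj ih =>
    rw [Finset.card_insert_of_notMem hj] at hts
    obtain ⟨i, hi⟩ := Finset.card_pos.1 (by omega : 0 < s.card)
    have hs' : ∀ k ∈ s.erase i, WindsOnce γ (a k) := fun k hk => hs k (Finset.mem_of_mem_erase hk)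
    have hcard := Finset.card_erase_of_mem hi
    have key : ∀ z ∈ contourTrace γ, (∏ k ∈ insert j t, (z - c k)) * (∏ k ∈ s, (z - a k))⁻¹ =
        (∏ k ∈ t, (z - c k)) * (∏ k ∈ s.erase i, (z - a k))⁻¹ +
          (a i - c j) * ((∏ k ∈ t, (z - c k)) * (∏ k ∈ s, (z - a k))⁻¹) := by
      intro z hz
      have hne : z - a i ≠ 0 := sub_ne_zero.2 fun he => (hs i hi).1 (he ▸ hz)
      rw [Finset.prod_insert hj, ← Finset.mul_prod_erase s _ hi, mul_inv]
      field_simp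
      ring
    have hcont : ∀ s' : Finset ι, (∀ k ∈ s', WindsOnce γ (a k)) →
        ContinuousOn (fun z => (∏ k ∈ t, (z - c k)) * (∏ k ∈ s', (z - a k))⁻¹) (contourTrace γ) :=
      fun s' h' => ContinuousOn.mul (by fun_prop) (continuousOn_prod_inv s' a fun k hk => (h' k hk).1)
    rw [contourIntegral_congr key, contourIntegral_add h (hcont _ hs') ((hcont _ hs).const_mul _),
      contourIntegral_const_mul, ih s hs (by omega), ih _ hs' (by omega)]
    ring

/-- The function `∏_{m<N} (z + bₘ) / ∏_{k≤m<N} (z - aₘ)`; for `k = 0` it is the factor of the kernel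
that depends on `z`. -/
noncomputable def zFactor (N : ℕ) (a b : ℕ → ℝ) (k : ℕ) (z : ℂ) : ℂ :=
  (∏ m ∈ Finset.range N, (z + b m)) * (∏ m ∈ Finset.Ico k N, (z - a m))⁻¹

/-- The function `∏_{l≤m<N} (w + aₘ) / ∏_{m<N} (w - bₘ)`; for `l = 0` it is the factor of the kernel
that depends on `w`. -/
noncomputable def wFactor (N : ℕ) (a b : ℕ → ℝ) (l : ℕ) (w : ℂ) : ℂ :=
  (∏ m ∈ Finset.Ico l N, (w + a m)) * (∏ m ∈ Finset.range N, (w - b m))⁻¹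

/-- The function `∏_{l≤m<N} (w - aₘ) / ∏_{m<N} (w + bₘ)`, which is `wFactor` at `-w` up to sign. -/
noncomputable def reflectedFactor (N : ℕ) (a b : ℕ → ℝ) (l : ℕ) (w : ℂ) : ℂ :=
  (∏ m ∈ Finset.Ico l N, (w - a m)) * (∏ m ∈ Finset.range N, (w + b m))⁻¹

theorem wFactor_neg {N : ℕ} (a b : ℕ → ℝ) {l : ℕ} (hl : l ≤ N) (w : ℂ) :
    wFactor N a b l (-w) = (-1) ^ l * reflectedFactor N a b l w := by
  unfold wFactor reflectedFactor
  have h1 : ∏ m ∈ Finset.Ico l N, (-w + (a m : ℂ)) =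
      (-1) ^ (N - l) * ∏ m ∈ Finset.Ico l N, (w - a m) := by
    rw [← Nat.card_Ico, ← Finset.prod_const, ← Finset.prod_mul_distrib]
    exact Finset.prod_congr rfl fun m _ => by ring
  have h2 : ∏ m ∈ Finset.range N, (-w - (b m : ℂ)) =
      (-1) ^ N * ∏ m ∈ Finset.range N, (w + b m) := by
    conv_rhs => rw [← Finset.card_range N, ← Finset.prod_const, Finset.card_range,
      ← Finset.prod_mul_distrib]
    exact Finset.prod_congr rfl fun m _ => by ring
  rw [h1, h2, mul_inv]
  have h3 : ((-1 : ℂ) ^ N)⁻¹ = (-1) ^ N := by rw [← inv_pow]; norm_num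
  have h4 : (-1 : ℂ) ^ (N - l) * (-1) ^ N = (-1) ^ l := by
    rw [← pow_add, show N - l + N = l + 2 * (N - l) by omega, pow_add, pow_mul]
    norm_num
  rw [h3, ← h4]
  ring

theorem reflectedFactor_neg {N : ℕ} (a b : ℕ → ℝ) {l : ℕ} (hl : l ≤ N) (w : ℂ) :
    reflectedFactor N a b l (-w) = (-1) ^ l * wFactor N a b l w := by
  have := wFactor_neg a b hl (-w)
  rw [neg_neg] at this
  rw [this, ← mul_assoc, ← mul_pow]
  norm_num

variable {N : ℕ} {a b : ℕ → ℝ}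

theorem continuousOn_wFactor (hb : ∀ m < N, WindsOnce γ (b m)) (l : ℕ) :
    ContinuousOn (wFactor N a b l) (contourTrace γ) :=
  ContinuousOn.mul (by fun_prop) (continuousOn_prod_inv _ (fun m => (b m : ℂ)) fun m hm =>
    (hb m (Finset.mem_range.1 hm)).1)

theorem continuousOn_zFactor (ha : ∀ m < N, WindsOnce γ (a m)) (k : ℕ) :
    ContinuousOn (zFactor N a b k) (contourTrace γ) :=
  ContinuousOn.mul (by fun_prop) (continuousOn_prod_inv _ (fun m => (a m : ℂ)) fun m hm =>
    (ha m (Finset.mem_Ico.1 hm).2).1)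

/-- Off the diagonal `w = z`, the function `Hhat` coincides with a function of `w` that is
holomorphic in the right half-plane. -/
theorem Hhat_eq_dslope {u : ℝ} {z w : ℂ} (hne : w ≠ z) :
    Hhat u z w = Complex.exp (-u * (z + w)) / (z + w) -
      Complex.exp (-u * z) * dslope (fun v => Complex.exp (-u * v)) z w := by
  have h1 := sub_ne_zero.2 hne
  have h2 := sub_ne_zero.2 hne.symm
  rw [dslope_of_ne _ hne, slope_def_field, Hhat]
  rw [show -2 * (u : ℂ) * z = -u * z + -u * z by ring,
    show -(u : ℂ) * (z + w) = -u * z + -u * w by ring, Complex.exp_add, Complex.exp_add]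
  rw [show z - w = -(w - z) by ring, div_neg]
  ring

theorem continuousOn_Hhat (u : ℝ) {K L : Set ℂ} (hK : K ⊆ rightHalfPlane)
    (hL : L ⊆ rightHalfPlane) (hKL : ∀ z ∈ K, z ∉ L) :
    ContinuousOn (fun p : ℂ × ℂ => Hhat u p.1 p.2) (K ×ˢ L) := by
  have hne : ∀ p ∈ K ×ˢ L, p.1 - p.2 ≠ 0 := fun p hp =>
    sub_ne_zero.2 fun he => hKL p.1 hp.1 (he ▸ hp.2)
  have hadd : ∀ p ∈ K ×ˢ L, p.1 + p.2 ≠ 0 := fun p hp h0 => by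
    have h1 : 0 < p.1.re := hK hp.1
    have h2 : 0 < p.2.re := hL hp.2
    have := congrArg Complex.re h0
    simp only [Complex.add_re, Complex.zero_re] at this
    linarith
  unfold Hhat
  refine ((ContinuousOn.div (by fun_prop) (by fun_prop) hadd).add
    (ContinuousOn.div (by fun_prop) (by fun_prop) hne)).add
    (ContinuousOn.div (by fun_prop) (by fun_prop) fun p hp => ?_)
  rw [← neg_sub]
  exact neg_ne_zero.2 (hne p hp)

theorem add_ne_zero_of_mem_rightHalfPlane {z w : ℂ} (hz : z ∈ rightHalfPlane)
    (hw : w ∈ rightHalfPlane) : w + z ≠ 0 := fun h0 => by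
  have h1 : 0 < z.re := hz
  have h2 : 0 < w.re := hw
  have := congrArg Complex.re h0
  simp only [Complex.add_re, Complex.zero_re] at this
  linarith

/-- Moving the big circle to `γ₂` picks up the residue at the pole `w = -z` of `Hhat`. -/
theorem contourIntegral_originCircle_wFactor_mul_Hhat {R : ℝ} (hN : 1 ≤ N)
    (h₂ : IsClosedPath γ₂) (htr₂ : contourTrace γ₂ ⊆ rightHalfPlane)
    (hb : ∀ m < N, WindsOnce γ₂ (b m)) (hb0 : ∀ m < N, 0 < b m) (hbR : ∀ m < N, |b m| < R) (u : ℝ)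
    {z : ℂ} (hz : z ∈ rightHalfPlane) (hz₂ : z ∉ contourTrace γ₂) (hzR : ‖z‖ < R) (l : ℕ) :
    contourIntegral (originCircle R) (fun w => wFactor N a b l w * Hhat u z w) =
      contourIntegral γ₂ (fun w => wFactor N a b l w * Hhat u z w) +
        2 * Real.pi * Complex.I * wFactor N a b l (-z) := by
  have hC := isClosedPath_originCircle R
  have hbC : ∀ m < N, WindsOnce (originCircle R) (b m) := fun m hm =>
    windsOnce_originCircle (by simpa using hbR m hm)
  have hzC : z ∉ contourTrace (originCircle R) := (windsOnce_originCircle hzR).1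
  have hnzC : WindsOnce (originCircle R) (-z) := windsOnce_originCircle (by rwa [norm_neg])
  have hnz₂ : -z ∉ contourTrace γ₂ := fun hm =>
    add_ne_zero_of_mem_rightHalfPlane hz (htr₂ hm) (neg_add_cancel z)
  -- `F` is the numerator at the pole `-z`, and `G` is the part of `Hhat` without this pole.
  let F : ℂ → ℂ := fun w => Complex.exp (-u * (z + w)) * ∏ m ∈ Finset.Ico l N, (w + a m)
  let G : ℂ → ℂ := fun w => dslope F (-z) w - (∏ m ∈ Finset.Ico l N, (w + a m)) *
    (Complex.exp (-u * z) * dslope (fun v => Complex.exp (-u * v)) z w)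
  have hF : Differentiable ℂ F := by fun_prop
  have hdF : ∀ (φ : ℂ → ℂ) (p : ℂ), Differentiable ℂ φ → Differentiable ℂ (dslope φ p) :=
    fun φ p hφ => by
      rw [← differentiableOn_univ]
      exact (Complex.differentiableOn_dslope Filter.univ_mem).2 hφ.differentiableOn
  have hG : Differentiable ℂ G := by
    refine (hdF F _ hF).fun_sub (Differentiable.fun_mul (by fun_prop) ?_)
    exact (hdF (fun v => Complex.exp (-u * v)) z (by fun_prop)).const_mul _
  have hsplit : ∀ w, w ≠ z → w ≠ -z → wFactor N a b l w * Hhat u z w =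
      F (-z) * ((w - -z)⁻¹ * (∏ m ∈ Finset.range N, (w - b m))⁻¹) +
        G w * (∏ m ∈ Finset.range N, (w - b m))⁻¹ := by
    intro w hwz hwz'
    rw [Hhat_eq_dslope hwz]
    have h1 := eq_add_mul_dslope F (-z) w
    have h2 : w - -z ≠ 0 := sub_ne_zero.2 hwz'
    have h3 : z + w = w - -z := by ring
    have h4 : Complex.exp (-u * (z + w)) / (z + w) * ∏ m ∈ Finset.Ico l N, (w + (a m : ℂ)) =
        F (-z) * (w - -z)⁻¹ + dslope F (-z) w := by
      have h5 : Complex.exp (-u * (z + w)) * ∏ m ∈ Finset.Ico l N, (w + (a m : ℂ)) =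
        F (-z) + (w - -z) * dslope F (-z) w := h1
      rw [div_mul_eq_mul_div, h5, h3, div_eq_mul_inv, add_mul, mul_comm (w - -z), mul_assoc _ (w - -z),
        mul_inv_cancel₀ h2, mul_one]
    simp only [G, wFactor]
    linear_combination (∏ m ∈ Finset.range N, (w - (b m : ℂ)))⁻¹ * h4
  have hcont : ∀ γ : ℝ → ℂ, (∀ m < N, WindsOnce γ (b m)) →
      ContinuousOn (fun w => (∏ m ∈ Finset.range N, (w - (b m : ℂ)))⁻¹) (contourTrace γ) :=
    fun γ hγ => continuousOn_prod_inv _ (fun m => (b m : ℂ)) fun m hm =>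
      (hγ m (Finset.mem_range.1 hm)).1
  have hcontz : ∀ γ : ℝ → ℂ, -z ∉ contourTrace γ →
      ContinuousOn (fun w => (w - -z)⁻¹) (contourTrace γ) := fun γ hγ =>
    ContinuousOn.inv₀ (by fun_prop) fun w hw => sub_ne_zero.2 fun he => hγ (he ▸ hw)
  have heval : ∀ γ : ℝ → ℂ, IsClosedPath γ → (∀ m < N, WindsOnce γ (b m)) → z ∉ contourTrace γ →
      -z ∉ contourTrace γ → contourIntegral γ (fun w => wFactor N a b l w * Hhat u z w) =
      F (-z) * contourIntegral γ (fun w => (w - -z)⁻¹ * (∏ m ∈ Finset.range N, (w - (b m : ℂ)))⁻¹) +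
        contourIntegral γ (fun w => G w * (∏ m ∈ Finset.range N, (w - (b m : ℂ)))⁻¹) := by
    intro γ hγ hbγ h1 h2
    rw [contourIntegral_congr fun w hw => hsplit w (fun he => h1 (he ▸ hw)) fun he => h2 (he ▸ hw),
      contourIntegral_add hγ (((hcontz γ h2).fun_mul (hcont γ hbγ)).const_mul _)
        (hG.continuous.continuousOn.fun_mul (hcont γ hbγ)), contourIntegral_const_mul]
  have hbig : contourIntegral (originCircle R)
      (fun w => (w - -z)⁻¹ * (∏ m ∈ Finset.range N, (w - (b m : ℂ)))⁻¹) = 0 := by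
    have := contourIntegral_prod_inv hC (Finset.range (N + 1))
      (fun m => if m < N then (b m : ℂ) else -z) (fun m hm => by
        by_cases h : m < N
        · simp only [if_pos h]; exact hbC m h
        · simp only [if_neg h]; exact hnzC) ⟨0, by simp⟩
    rw [if_neg (by rw [Finset.card_range]; omega)] at this
    rw [← this]
    refine contourIntegral_congr fun w _ => ?_
    rw [Finset.prod_range_succ, if_neg (lt_irrefl N), mul_inv, mul_comm]
    congr 2
    refine Finset.prod_congr rfl fun m hm => ?_
    rw [if_pos (Finset.mem_range.1 hm)]
  have hsmall : contourIntegral γ₂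
      (fun w => (w - -z)⁻¹ * (∏ m ∈ Finset.range N, (w - (b m : ℂ)))⁻¹) =
      -(2 * Real.pi * Complex.I) * (∏ m ∈ Finset.range N, (-z - (b m : ℂ)))⁻¹ := by
    refine contourIntegral_inv_sub_mul_prod_inv h₂ hnz₂ ?_ _ _
      (fun m hm => hb m (Finset.mem_range.1 hm)) (fun m hm he => ?_) ⟨0, by simp; omega⟩
    · refine contourIntegral_eq_zero_of_differentiableOn h₂ htr₂ ?_
      refine DifferentiableOn.inv (by fun_prop) fun w hw => ?_
      rw [sub_neg_eq_add]
      exact add_ne_zero_of_mem_rightHalfPlane hz hw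
    · have hbm : (b m : ℂ) ∈ rightHalfPlane := by
        simpa [rightHalfPlane] using hb0 m (Finset.mem_range.1 hm)
      exact add_ne_zero_of_mem_rightHalfPlane hz hbm (by rw [he]; ring)
  rw [heval _ hC hbC hzC hnzC.1, heval _ h₂ hb hz₂ hnz₂, hbig, hsmall,
    contourIntegral_mul_prod_inv_eq hC h₂ hG _ _ (fun m hm => hbC m (Finset.mem_range.1 hm))
      fun m hm => hb m (Finset.mem_range.1 hm)]
  simp only [F, wFactor, add_neg_cancel, mul_zero, Complex.exp_zero, one_mul]
  ring

/-- The integral over the big circle that comes from the last passage side, in terms of the integral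
over `γ₂` in the kernel. The substitution `w ↦ -w` turns `2z / (w² - z²)` into the first two terms
of `Hhat`. -/
theorem contourIntegral_originCircle_reflectedFactor {R : ℝ}
    (h₂ : IsClosedPath γ₂) (htr₂ : contourTrace γ₂ ⊆ rightHalfPlane)
    (hb : ∀ m < N, WindsOnce γ₂ (b m)) (hb0 : ∀ m < N, 0 < b m) (hbR : ∀ m < N, |b m| < R) (u : ℝ)
    {z : ℂ} (hz : z ∈ rightHalfPlane) (hz₂ : z ∉ contourTrace γ₂) (hzR : ‖z‖ < R) {l : ℕ}
    (hl : l < N) :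
    contourIntegral (originCircle R) (fun w => Complex.exp (w * u) *
        reflectedFactor N a b (l + 1) w * (2 * z * (w ^ 2 - z ^ 2)⁻¹)) =
      Complex.exp (u * z) * (2 * Real.pi * Complex.I * reflectedFactor N a b (l + 1) z -
        (-1) ^ l * contourIntegral γ₂ (fun w => wFactor N a b (l + 1) w * Hhat u z w)) := by
  have hC := isClosedPath_originCircle R
  have hbC : ∀ m < N, WindsOnce (originCircle R) (b m) := fun m hm =>
    windsOnce_originCircle (by simpa using hbR m hm)
  have hzC := windsOnce_originCircle hzR
  have hnzC : WindsOnce (originCircle R) (-z) := windsOnce_originCircle (by rwa [norm_neg])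
  have hz1 : ∀ w ∈ contourTrace (originCircle R), w - z ≠ 0 := fun w hw =>
    sub_ne_zero.2 fun he => hzC.1 (he ▸ hw)
  have hz2 : ∀ w ∈ contourTrace (originCircle R), w + z ≠ 0 := fun w hw h0 =>
    hnzC.1 (eq_neg_of_add_eq_zero_left h0 ▸ hw)
  have hwc := continuousOn_wFactor (a := a) hbC (l + 1)
  have hHc : ContinuousOn (fun w => Hhat u z w) (contourTrace (originCircle R)) := by
    unfold Hhat
    refine ((ContinuousOn.div (by fun_prop) (by fun_prop) fun w hw => ?_).add
      (ContinuousOn.div (by fun_prop) (by fun_prop) fun w hw => ?_)).add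
      (ContinuousOn.div (by fun_prop) (by fun_prop) hz1)
    · rw [add_comm]; exact hz2 w hw
    · rw [← neg_sub]; exact neg_ne_zero.2 (hz1 w hw)
  -- The term that completes the reflected integrand to `Hhat` decays at least like `w⁻²`.
  have hzero : contourIntegral (originCircle R)
      (fun w => wFactor N a b (l + 1) w * (w - z)⁻¹) = 0 := by
    have := contourIntegral_prod_mul_prod_inv_eq_zero hC (Finset.Ico (l + 1) N)
      (fun m => -(a m : ℂ)) (Finset.range (N + 1)) (fun m => if m < N then (b m : ℂ) else z)
      (fun m hm => by
        by_cases h : m < N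
        · simp only [if_pos h]; exact hbC m h
        · simp only [if_neg h]; exact hzC)
      (by rw [Nat.card_Ico, Finset.card_range]; omega)
    rw [← this]
    refine contourIntegral_congr fun w _ => ?_
    rw [Finset.prod_range_succ, if_neg (lt_irrefl N), mul_inv, wFactor, mul_assoc]
    simp only [sub_neg_eq_add]
    congr 3
    refine Finset.prod_congr rfl fun m hm => ?_
    rw [if_pos (Finset.mem_range.1 hm)]
  have hrefl := contourIntegral_originCircle_comp_neg R (fun w => Complex.exp (w * u) *
    reflectedFactor N a b (l + 1) w * (2 * z * (w ^ 2 - z ^ 2)⁻¹))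
  rw [← neg_eq_iff_eq_neg] at hrefl
  have hint : ∀ w ∈ contourTrace (originCircle R), Complex.exp (-w * u) *
      reflectedFactor N a b (l + 1) (-w) * (2 * z * ((-w) ^ 2 - z ^ 2)⁻¹) =
      (-1) ^ l * Complex.exp (u * z) * (wFactor N a b (l + 1) w * Hhat u z w) +
        -((-1) ^ l * Complex.exp (-u * z)) * (wFactor N a b (l + 1) w * (w - z)⁻¹) := by
    intro w hw
    have h1 := hz1 w hw
    have h2 := hz2 w hw
    have h3 : z - w ≠ 0 := by rw [← neg_sub]; exact neg_ne_zero.2 h1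
    have h4 : z + w ≠ 0 := by rwa [add_comm]
    have hH : Complex.exp (u * z) * Hhat u z w =
        Complex.exp (-w * u) * ((z + w)⁻¹ + (z - w)⁻¹) + Complex.exp (-u * z) * (w - z)⁻¹ := by
      rw [Hhat, mul_add, mul_add, mul_div_assoc', mul_div_assoc', mul_div_assoc', ← Complex.exp_add,
        ← Complex.exp_add, show (u : ℂ) * z + -u * (z + w) = -w * u by ring,
        show (u : ℂ) * z + -2 * u * z = -u * z by ring]
      simp only [div_eq_mul_inv]
      ring
    have hq : 2 * z * ((-w) ^ 2 - z ^ 2)⁻¹ = -((z + w)⁻¹ + (z - w)⁻¹) := by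
      rw [show (-w) ^ 2 - z ^ 2 = -((z - w) * (z + w)) by ring]
      field_simp
      ring
    rw [reflectedFactor_neg a b hl, hq, pow_succ]
    linear_combination (-1 : ℂ) * (-1) ^ l * wFactor N a b (l + 1) w * hH
  have hzc : ContinuousOn (fun w => (w - z)⁻¹) (contourTrace (originCircle R)) :=
    ContinuousOn.inv₀ (by fun_prop) hz1
  rw [← hrefl, contourIntegral_congr hint, contourIntegral_add hC ((hwc.fun_mul hHc).const_mul _)
    ((hwc.fun_mul hzc).const_mul _), contourIntegral_const_mul,
    contourIntegral_const_mul, hzero, contourIntegral_originCircle_wFactor_mul_Hhat (by omega) h₂ htr₂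
      hb hb0 hbR u hz hz₂ hzR, wFactor_neg a b hl]
  have h6 : (-1 : ℂ) ^ l * (-1) ^ l = 1 := by rw [← mul_pow]; norm_num
  rw [pow_succ]
  linear_combination (2 * Real.pi * Complex.I * Complex.exp (u * z) *
    reflectedFactor N a b (l + 1) z) * h6

end ContourAlgebra

/-! ### From the last passage determinant to the kernel -/

section BoundaryMatrix

variable {γ₁ γ₂ : ℝ → ℂ} {N : ℕ} {a b : ℕ → ℝ} {R u : ℝ}

/-- The columns of row `k` carry the parameters `b₀, …, b_{N-1}` and then `a_{N-1}, …, a_k`. -/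
theorem prod_range_columnRate (f : ℝ → ℂ) {k : ℕ} (hk : k ≤ N) :
    ∏ j ∈ Finset.range (2 * N - k), f (columnRate N a b j) =
      (∏ m ∈ Finset.range N, f (b m)) * ∏ m ∈ Finset.Ico k N, f (a m) := by
  rw [← Finset.prod_range_mul_prod_Ico _ (by omega : N ≤ 2 * N - k)]
  congr 1
  · refine Finset.prod_congr rfl fun j hj => ?_
    rw [columnRate, if_pos (Finset.mem_range.1 hj)]
  · refine Finset.prod_nbij' (fun j => 2 * N - 1 - j) (fun m => 2 * N - 1 - m) ?_ ?_ ?_ ?_ ?_ <;>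
      intro j hj <;> rw [Finset.mem_Ico] at hj
    · rw [Finset.mem_Ico]; omega
    · rw [Finset.mem_Ico]; omega
    · omega
    · omega
    · rw [columnRate, if_neg (by omega)]

/-- The telescoping identity for products that mix two points. -/
theorem sum_prod_range_mul_prod_Ico (N : ℕ) (c : ℕ → ℂ) (x y : ℂ) :
    (∑ j ∈ Finset.range N,
      (∏ m ∈ Finset.range j, (x - c m)) * ∏ m ∈ Finset.Ico (j + 1) N, (y - c m)) * (x - y) =
      ∏ m ∈ Finset.range N, (x - c m) - ∏ m ∈ Finset.range N, (y - c m) := by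
  induction N with
  | zero => simp
  | succ N ih =>
    rw [Finset.sum_range_succ, Finset.prod_range_succ, Finset.prod_range_succ]
    have h1 : ∑ j ∈ Finset.range N, (∏ m ∈ Finset.range j, (x - c m)) *
        ∏ m ∈ Finset.Ico (j + 1) (N + 1), (y - c m) = (∑ j ∈ Finset.range N,
        (∏ m ∈ Finset.range j, (x - c m)) * ∏ m ∈ Finset.Ico (j + 1) N, (y - c m)) * (y - c N) := by
      rw [Finset.sum_mul]
      refine Finset.sum_congr rfl fun j hj => ?_
      rw [Finset.prod_Ico_succ_top (Nat.succ_le_of_lt (Finset.mem_range.1 hj)), mul_assoc]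
    rw [h1, Finset.Ico_self, Finset.prod_empty]
    linear_combination (y - c N) * ih

/-- The factor of the entries of the determinant for `τ_{2N}` that depends on the row only. -/
noncomputable def rowFactor (N : ℕ) (a b : ℕ → ℝ) (u : ℝ) (l : ℕ) (w : ℂ) : ℂ :=
  Complex.exp (w * u) * ((∏ m ∈ Finset.range (l + 1), (w - a m))⁻¹ *
    (∏ m ∈ Finset.range N, (w + b m))⁻¹ * (∏ m ∈ Finset.range N, (w + a m))⁻¹)

theorem sub_ne_zero_of_mem_originCircle {x : ℝ} (hx : |x| < R) {w : ℂ}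
    (hw : w ∈ contourTrace (originCircle R)) : w - x ≠ 0 :=
  sub_ne_zero.2 fun he => ofReal_notMem_originCircle hx (he ▸ hw)

theorem add_ne_zero_of_mem_originCircle {x : ℝ} (hx : |x| < R) {w : ℂ}
    (hw : w ∈ contourTrace (originCircle R)) : w + x ≠ 0 := by
  have := sub_ne_zero_of_mem_originCircle (x := -x) (by rwa [abs_neg]) hw
  rwa [Complex.ofReal_neg, sub_neg_eq_add] at this

theorem continuousOn_rowFactor (haR : ∀ m < N, |a m| < R) (hbR : ∀ m < N, |b m| < R) {l : ℕ}
    (hl : l < N) : ContinuousOn (rowFactor N a b u l) (contourTrace (originCircle R)) :=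
  ContinuousOn.mul (by fun_prop) (((continuousOn_prod_sub_inv _ fun m hm =>
    haR m (by have := Finset.mem_range.1 hm; omega)).mul
    (continuousOn_prod_add_inv _ fun m hm => hbR m (Finset.mem_range.1 hm))).mul
    (continuousOn_prod_add_inv _ fun m hm => haR m (Finset.mem_range.1 hm)))

theorem pathEntry_columnRate (haR : ∀ m < N, |a m| < R) {l k : ℕ} (hk : k ≤ N) :
    pathEntry R a (columnRate N a b) l k (2 * N - k) u = (2 * Real.pi * Complex.I)⁻¹ *
      contourIntegral (originCircle R) fun w => rowFactor N a b u l w *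
        ∏ m ∈ Finset.range k, (w ^ 2 - (a m : ℂ) ^ 2) := by
  rw [pathEntry]
  congr 1
  refine contourIntegral_congr fun w hw => ?_
  have h1 := prod_range_columnRate (a := a) (b := b) (fun x : ℝ => w + (x : ℂ)) hk
  have h2 : ∏ m ∈ Finset.range k, (w + (a m : ℂ)) ≠ 0 :=
    Finset.prod_ne_zero_iff.2 fun m hm => add_ne_zero_of_mem_originCircle
      (haR m (by have := Finset.mem_range.1 hm; omega)) hw
  have h3 : ∏ m ∈ Finset.range k, (w ^ 2 - (a m : ℂ) ^ 2) =
      (∏ m ∈ Finset.range k, (w - a m)) * ∏ m ∈ Finset.range k, (w + (a m : ℂ)) := by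
    rw [← Finset.prod_mul_distrib]
    exact Finset.prod_congr rfl fun m _ => by ring
  rw [h1, h3, rowFactor, ← Finset.prod_range_mul_prod_Ico (fun m => w + (a m : ℂ)) hk, mul_inv,
    mul_inv]
  generalize (∏ m ∈ Finset.range k, (w + (a m : ℂ))) = p at *
  field_simp

theorem rowFactor_mul_prod (haR : ∀ m < N, |a m| < R) {l : ℕ} (hl : l < N) {w : ℂ}
    (hw : w ∈ contourTrace (originCircle R)) :
    rowFactor N a b u l w * ∏ m ∈ Finset.range N, (w ^ 2 - (a m : ℂ) ^ 2) =
      Complex.exp (w * u) * reflectedFactor N a b (l + 1) w := by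
  have h2 : ∏ m ∈ Finset.range N, (w + (a m : ℂ)) ≠ 0 :=
    Finset.prod_ne_zero_iff.2 fun m hm => add_ne_zero_of_mem_originCircle
      (haR m (Finset.mem_range.1 hm)) hw
  have h4 : ∏ m ∈ Finset.range (l + 1), (w - (a m : ℂ)) ≠ 0 :=
    Finset.prod_ne_zero_iff.2 fun m hm => sub_ne_zero_of_mem_originCircle
      (haR m (by have := Finset.mem_range.1 hm; omega)) hw
  have h3 : ∏ m ∈ Finset.range N, (w ^ 2 - (a m : ℂ) ^ 2) =
      (∏ m ∈ Finset.range N, (w - a m)) * ∏ m ∈ Finset.range N, (w + (a m : ℂ)) := by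
    rw [← Finset.prod_mul_distrib]
    exact Finset.prod_congr rfl fun m _ => by ring
  rw [h3, ← Finset.prod_range_mul_prod_Ico (fun m => w - (a m : ℂ)) (Nat.succ_le_of_lt hl),
    rowFactor, reflectedFactor]
  generalize (∏ m ∈ Finset.range N, (w + (a m : ℂ))) = p at *
  generalize (∏ m ∈ Finset.range (l + 1), (w - (a m : ℂ))) = q at *
  field_simp

/-- The entries `(2πi)⁻¹ ∮ (∏_{m<N} (z + bₘ) / ∏_{k≤m<N} (z - aₘ)) 2z e^{-uz}
∏_{j<m<N} (z² - aₘ²) dz` of a lower triangular matrix whose determinant is the product of all rates and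
of the factors `e^{-a_k u}` in `pathDet`. -/
noncomputable def gaugeEntry (γ : ℝ → ℂ) (N : ℕ) (a b : ℕ → ℝ) (u : ℝ) (j k : ℕ) : ℂ :=
  (2 * Real.pi * Complex.I)⁻¹ * contourIntegral γ fun z => zFactor N a b k z *
    (2 * z * Complex.exp (-u * z)) * ∏ m ∈ Finset.Ico (j + 1) N, (z ^ 2 - (a m : ℂ) ^ 2)

theorem prod_sq_sub_sq (s : Finset ℕ) (z : ℂ) : ∏ m ∈ s, (z ^ 2 - (a m : ℂ) ^ 2) =
    (∏ m ∈ s, (z - a m)) * ∏ m ∈ s, (z + (a m : ℂ)) := by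
  rw [← Finset.prod_mul_distrib]
  exact Finset.prod_congr rfl fun m _ => by ring

theorem gaugeEntry_of_lt (h₁ : IsClosedPath γ₁) (ha : ∀ m < N, WindsOnce γ₁ (a m)) {j k : ℕ}
    (hjk : j < k) (hk : k < N) : gaugeEntry γ₁ N a b u j k = 0 := by
  rw [gaugeEntry, contourIntegral_congr (g := fun z => (∏ m ∈ Finset.range N, (z + (b m : ℂ))) *
    (2 * z * Complex.exp (-u * z)) * ((∏ m ∈ Finset.Ico (j + 1) k, (z - (a m : ℂ))) *
      ∏ m ∈ Finset.Ico (j + 1) N, (z + (a m : ℂ)))), contourIntegral_eq_zero_of_differentiable h₁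
      (by fun_prop), mul_zero]
  intro z hz
  have h4 : ∏ m ∈ Finset.Ico k N, (z - (a m : ℂ)) ≠ 0 :=
    Finset.prod_ne_zero_iff.2 fun m hm => sub_ne_zero.2 fun he =>
      (ha m (Finset.mem_Ico.1 hm).2).1 (he ▸ hz)
  rw [prod_sq_sub_sq, ← Finset.prod_Ico_consecutive (fun m => z - (a m : ℂ))
    (Nat.succ_le_of_lt hjk) hk.le, zFactor]
  generalize (∏ m ∈ Finset.Ico k N, (z - (a m : ℂ))) = q at *
  field_simp

theorem gaugeEntry_self (h₁ : IsClosedPath γ₁) (htr₁ : contourTrace γ₁ ⊆ rightHalfPlane)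
    (ha : ∀ m < N, WindsOnce γ₁ (a m)) (ha0 : ∀ m < N, 0 < a m) {k : ℕ} (hk : k < N) :
    gaugeEntry γ₁ N a b u k k = (∏ m ∈ Finset.range N, ((a k : ℂ) + b m)) *
      (∏ m ∈ Finset.Ico k N, ((a k : ℂ) + a m)) * Complex.exp (-a k * u) := by
  rw [gaugeEntry, contourIntegral_congr (g := fun z => ((∏ m ∈ Finset.range N, (z + (b m : ℂ))) *
    (2 * z * Complex.exp (-u * z)) * ∏ m ∈ Finset.Ico (k + 1) N, (z + (a m : ℂ))) *
      (z - a k)⁻¹), contourIntegral_mul_inv_sub h₁ htr₁ (by fun_prop) (ha k hk)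
      (by simpa [rightHalfPlane] using ha0 k hk), Finset.prod_eq_prod_Ico_succ_bot hk]
  · have := Complex.two_pi_I_ne_zero
    rw [show -(u : ℂ) * a k = -a k * u by ring]
    field_simp
    ring
  intro z hz
  have h4 : ∏ m ∈ Finset.Ico (k + 1) N, (z - (a m : ℂ)) ≠ 0 :=
    Finset.prod_ne_zero_iff.2 fun m hm => sub_ne_zero.2 fun he =>
      (ha m (Finset.mem_Ico.1 hm).2).1 (he ▸ hz)
  rw [prod_sq_sub_sq, zFactor, Finset.prod_eq_prod_Ico_succ_bot hk]
  generalize (∏ m ∈ Finset.Ico (k + 1) N, (z - (a m : ℂ))) = q at *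
  field_simp

/-- The pairing of the `l`-th left with the `k`-th right factor of the kernel, evaluated as a double
contour integral. -/
noncomputable def kernelEntry (γ₁ γ₂ : ℝ → ℂ) (N : ℕ) (a b : ℕ → ℝ) (u : ℝ) (l k : ℕ) : ℂ :=
  (-1) ^ l * ((2 * Real.pi * Complex.I)⁻¹ ^ 2 * contourIntegral γ₁ fun z => zFactor N a b k z *
    contourIntegral γ₂ fun w => wFactor N a b (l + 1) w * Hhat u z w)

theorem contourIntegral_zFactor_mul_reflectedFactor (h₁ : IsClosedPath γ₁)
    (htr₁ : contourTrace γ₁ ⊆ rightHalfPlane) (ha : ∀ m < N, WindsOnce γ₁ (a m))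
    (hb0 : ∀ m < N, 0 < b m) {l k : ℕ} (hl : l < N) (hk : k < N) :
    contourIntegral γ₁ (fun z => zFactor N a b k z * reflectedFactor N a b (l + 1) z) =
      if l = k then 2 * Real.pi * Complex.I else 0 := by
  have hb : ∀ z ∈ contourTrace γ₁, ∏ m ∈ Finset.range N, (z + (b m : ℂ)) ≠ 0 := fun z hz =>
    Finset.prod_ne_zero_iff.2 fun m hm => add_ne_zero_of_mem_rightHalfPlane
      (by simpa [rightHalfPlane] using hb0 m (Finset.mem_range.1 hm)) (htr₁ hz)
  have ha' : ∀ (s : Finset ℕ), (∀ m ∈ s, m < N) → ∀ z ∈ contourTrace γ₁,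
      ∏ m ∈ s, (z - (a m : ℂ)) ≠ 0 := fun s hs z hz =>
    Finset.prod_ne_zero_iff.2 fun m hm => sub_ne_zero.2 fun he => (ha m (hs m hm)).1 (he ▸ hz)
  have hsimp : ∀ z ∈ contourTrace γ₁, zFactor N a b k z * reflectedFactor N a b (l + 1) z =
      (∏ m ∈ Finset.Ico (l + 1) N, (z - a m)) * (∏ m ∈ Finset.Ico k N, (z - (a m : ℂ)))⁻¹ := by
    intro z hz
    have := hb z hz
    rw [zFactor, reflectedFactor]
    generalize (∏ m ∈ Finset.range N, (z + (b m : ℂ))) = q at *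
    field_simp
  rw [contourIntegral_congr hsimp]
  rcases lt_or_ge l k with hlk | hlk
  · rw [if_neg hlk.ne, contourIntegral_congr
      (g := fun z => ∏ m ∈ Finset.Ico (l + 1) k, (z - (a m : ℂ)))]
    · exact contourIntegral_eq_zero_of_differentiable h₁ (by fun_prop)
    intro z hz
    have h4 := ha' (Finset.Ico k N) (fun m hm => (Finset.mem_Ico.1 hm).2) z hz
    rw [← Finset.prod_Ico_consecutive (fun m => z - (a m : ℂ)) (Nat.succ_le_of_lt hlk) hk.le]
    field_simp
  · rw [contourIntegral_congr (g := fun z => (∏ m ∈ Finset.Ico k (l + 1), (z - (a m : ℂ)))⁻¹),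
      contourIntegral_prod_inv h₁ (Finset.Ico k (l + 1)) (fun m => (a m : ℂ))
        (fun m hm => ha m (by have := Finset.mem_Ico.1 hm; omega)) ⟨l, by simp [hlk]⟩]
    · refine if_congr ?_ rfl rfl
      rw [Nat.card_Ico]; omega
    intro z hz
    have h4 := ha' (Finset.Ico (l + 1) N) (fun m hm => (Finset.mem_Ico.1 hm).2) z hz
    rw [← Finset.prod_Ico_consecutive (fun m => z - (a m : ℂ)) (by omega : k ≤ l + 1)
      (Nat.succ_le_of_lt hl), mul_inv]
    field_simp

/-- The product of the last passage matrix with the triangular matrix `gaugeEntry` is the identity minus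
the matrix of the kernel. The sum over `j` telescopes to
`(∏ (w² - aₘ²) - ∏ (z² - aₘ²)) / (w² - z²)`, of which the second part is holomorphic in `z`. -/
theorem sum_pathEntry_mul_gaugeEntry
    (h₁ : IsClosedPath γ₁) (htr₁ : contourTrace γ₁ ⊆ rightHalfPlane)
    (h₂ : IsClosedPath γ₂) (htr₂ : contourTrace γ₂ ⊆ rightHalfPlane)
    (hdisj : ∀ z ∈ contourTrace γ₁, z ∉ contourTrace γ₂)
    (ha : ∀ m < N, WindsOnce γ₁ (a m)) (hb : ∀ m < N, WindsOnce γ₂ (b m))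
    (hb0 : ∀ m < N, 0 < b m)
    (haR : ∀ m < N, |a m| < R) (hbR : ∀ m < N, |b m| < R) (hzR : ∀ z ∈ contourTrace γ₁, ‖z‖ < R)
    {l k : ℕ} (hl : l < N) (hk : k < N) :
    ∑ j ∈ Finset.range N, pathEntry R a (columnRate N a b) l j (2 * N - j) u *
      gaugeEntry γ₁ N a b u j k = (if l = k then 1 else 0) - kernelEntry γ₁ γ₂ N a b u l k := by
  have hC := isClosedPath_originCircle R
  have hpi := Complex.two_pi_I_ne_zero
  have hrow := continuousOn_rowFactor (u := u) haR hbR hl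
  have hZ : ContinuousOn (zFactor N a b k) (contourTrace γ₁) := continuousOn_zFactor ha k
  have hne : ∀ w ∈ contourTrace (originCircle R), ∀ z ∈ contourTrace γ₁, w ^ 2 - z ^ 2 ≠ 0 := by
    intro w hw z hz
    have h3 := (windsOnce_originCircle (hzR z hz)).1
    have h4 := (windsOnce_originCircle (a := -z) (by rw [norm_neg]; exact hzR z hz)).1
    rw [show w ^ 2 - z ^ 2 = (w - z) * (w - -z) by ring]
    exact mul_ne_zero (sub_ne_zero.2 fun he => h3 (he ▸ hw)) (sub_ne_zero.2 fun he => h4 (he ▸ hw))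
  have h1 : ∑ j ∈ Finset.range N, pathEntry R a (columnRate N a b) l j (2 * N - j) u *
      gaugeEntry γ₁ N a b u j k = (2 * Real.pi * Complex.I)⁻¹ ^ 2 *
        contourIntegral (originCircle R) fun w => contourIntegral γ₁ fun z =>
          ∑ j ∈ Finset.range N, rowFactor N a b u l w * zFactor N a b k z *
            (2 * z * Complex.exp (-u * z)) * ((∏ m ∈ Finset.range j, (w ^ 2 - (a m : ℂ) ^ 2)) *
              ∏ m ∈ Finset.Ico (j + 1) N, (z ^ 2 - (a m : ℂ) ^ 2)) := by
    have hg : ∀ (w : ℂ) (j : ℕ), ContinuousOn (fun z => rowFactor N a b u l w * zFactor N a b k z *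
            (2 * z * Complex.exp (-u * z)) * ((∏ m ∈ Finset.range j, (w ^ 2 - (a m : ℂ) ^ 2)) *
              ∏ m ∈ Finset.Ico (j + 1) N, (z ^ 2 - (a m : ℂ) ^ 2))) (contourTrace γ₁) := fun w j =>
      ((hZ.const_mul _).fun_mul (by fun_prop)).fun_mul (by fun_prop)
    have hw : ∀ w ∈ contourTrace (originCircle R), (contourIntegral γ₁ fun z =>
          ∑ j ∈ Finset.range N, rowFactor N a b u l w * zFactor N a b k z *
            (2 * z * Complex.exp (-u * z)) * ((∏ m ∈ Finset.range j, (w ^ 2 - (a m : ℂ) ^ 2)) *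
              ∏ m ∈ Finset.Ico (j + 1) N, (z ^ 2 - (a m : ℂ) ^ 2))) =
        ∑ j ∈ Finset.range N, (rowFactor N a b u l w * ∏ m ∈ Finset.range j, (w ^ 2 - (a m : ℂ) ^ 2)) *
          (2 * Real.pi * Complex.I * gaugeEntry γ₁ N a b u j k) := by
      intro w _
      rw [contourIntegral_finsetSum h₁ _ _ fun j _ => hg w j]
      refine Finset.sum_congr rfl fun j _ => ?_
      rw [gaugeEntry, mul_inv_cancel_left₀ hpi, ← contourIntegral_const_mul]
      exact contourIntegral_congr fun z _ => by ring
    rw [contourIntegral_congr hw, contourIntegral_finsetSum hC, Finset.mul_sum]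
    · refine Finset.sum_congr rfl fun j hj => ?_
      rw [contourIntegral_mul_const, pathEntry_columnRate haR (Finset.mem_range.1 hj).le]
      field_simp
    · exact fun j _ => (hrow.fun_mul (by fun_prop)).mul_const _
  have hinner : ∀ w ∈ contourTrace (originCircle R), (contourIntegral γ₁ fun z =>
          ∑ j ∈ Finset.range N, rowFactor N a b u l w * zFactor N a b k z *
            (2 * z * Complex.exp (-u * z)) * ((∏ m ∈ Finset.range j, (w ^ 2 - (a m : ℂ) ^ 2)) *
              ∏ m ∈ Finset.Ico (j + 1) N, (z ^ 2 - (a m : ℂ) ^ 2))) =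
      contourIntegral γ₁ fun z => zFactor N a b k z * Complex.exp (-u * z) *
        (Complex.exp (w * u) * reflectedFactor N a b (l + 1) w *
          (2 * z * (w ^ 2 - z ^ 2)⁻¹)) := by
    intro w hw
    have hinv : ContinuousOn (fun z => (w ^ 2 - z ^ 2)⁻¹) (contourTrace γ₁) :=
      ContinuousOn.inv₀ (by fun_prop) fun z hz => hne w hw z hz
    have hhol : contourIntegral γ₁ (fun z => zFactor N a b k z * Complex.exp (-u * z) *
        (2 * z * (w ^ 2 - z ^ 2)⁻¹) * ∏ m ∈ Finset.range N, (z ^ 2 - (a m : ℂ) ^ 2)) = 0 := by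
      rw [contourIntegral_congr (g := fun z => (∏ m ∈ Finset.range N, (z + (b m : ℂ))) *
        Complex.exp (-u * z) * (2 * z * (w ^ 2 - z ^ 2)⁻¹) *
          ((∏ m ∈ Finset.range k, (z - (a m : ℂ))) * ∏ m ∈ Finset.range N, (z + (a m : ℂ))))]
      · refine contourIntegral_eq_zero_of_differentiableOn_ball (c := 0) (r := R) h₁
          (fun z hz => by simpa using hzR z hz) ?_
        have hd : DifferentiableOn ℂ (fun z => (w ^ 2 - z ^ 2)⁻¹) (Metric.ball 0 R) := by
          refine DifferentiableOn.fun_inv (by fun_prop) fun z hz => ?_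
          have hz' : ‖z‖ < R := by simpa using hz
          have h3 := (windsOnce_originCircle hz').1
          have h4 := (windsOnce_originCircle (a := -z) (by rwa [norm_neg])).1
          rw [show w ^ 2 - z ^ 2 = (w - z) * (w - -z) by ring]
          exact mul_ne_zero (sub_ne_zero.2 fun he => h3 (he ▸ hw))
            (sub_ne_zero.2 fun he => h4 (he ▸ hw))
        fun_prop
      intro z hz
      have h4 : ∏ m ∈ Finset.Ico k N, (z - (a m : ℂ)) ≠ 0 :=
        Finset.prod_ne_zero_iff.2 fun m hm => sub_ne_zero.2 fun he =>
          (ha m (Finset.mem_Ico.1 hm).2).1 (he ▸ hz)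
      rw [prod_sq_sub_sq, zFactor, ← Finset.prod_range_mul_prod_Ico (fun m => z - (a m : ℂ)) hk.le]
      generalize (∏ m ∈ Finset.Ico k N, (z - (a m : ℂ))) = q at *
      field_simp
    rw [contourIntegral_congr (g := fun z => zFactor N a b k z * Complex.exp (-u * z) *
        (Complex.exp (w * u) * reflectedFactor N a b (l + 1) w * (2 * z * (w ^ 2 - z ^ 2)⁻¹)) -
        rowFactor N a b u l w * (zFactor N a b k z * Complex.exp (-u * z) *
        (2 * z * (w ^ 2 - z ^ 2)⁻¹) * ∏ m ∈ Finset.range N, (z ^ 2 - (a m : ℂ) ^ 2))),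
      contourIntegral_sub h₁, contourIntegral_const_mul, hhol, mul_zero, sub_zero]
    · exact (hZ.fun_mul (by fun_prop)).fun_mul
        (ContinuousOn.fun_mul (by fun_prop) (ContinuousOn.fun_mul (by fun_prop) hinv))
    · exact (((hZ.fun_mul (by fun_prop)).fun_mul
        (ContinuousOn.fun_mul (by fun_prop) hinv)).fun_mul (by fun_prop)).const_mul _
    intro z hz
    have hwz := hne w hw z hz
    have htel := sum_prod_range_mul_prod_Ico N (fun m => (a m : ℂ) ^ 2) (w ^ 2) (z ^ 2)
    rw [← eq_mul_inv_iff_mul_eq₀ hwz] at htel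
    rw [← Finset.mul_sum, htel, ← rowFactor_mul_prod haR hl hw]
    ring
  have hrefl : ContinuousOn (fun w => Complex.exp (w * u) * reflectedFactor N a b (l + 1) w)
      (contourTrace (originCircle R)) := ContinuousOn.fun_mul (by fun_prop)
    (ContinuousOn.mul (by fun_prop)
      (continuousOn_prod_add_inv _ fun m hm => hbR m (Finset.mem_range.1 hm)))
  rw [h1, contourIntegral_congr hinner, contourIntegral_comm hC h₁]
  swap
  · refine ContinuousOn.fun_mul (ContinuousOn.fun_mul (hZ.comp continuousOn_snd fun p hp => hp.2)
      (by fun_prop)) (ContinuousOn.fun_mul (hrefl.comp continuousOn_fst fun p hp => hp.1)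
        (ContinuousOn.fun_mul (by fun_prop) (ContinuousOn.inv₀ (by fun_prop) fun p hp =>
          hne p.1 hp.1 p.2 hp.2)))
  have hlast : ∀ z ∈ contourTrace γ₁, (contourIntegral (originCircle R) fun w =>
      zFactor N a b k z * Complex.exp (-u * z) * (Complex.exp (w * u) *
        reflectedFactor N a b (l + 1) w * (2 * z * (w ^ 2 - z ^ 2)⁻¹))) =
      2 * Real.pi * Complex.I * (zFactor N a b k z * reflectedFactor N a b (l + 1) z) -
        (-1) ^ l * (zFactor N a b k z *
          contourIntegral γ₂ fun w => wFactor N a b (l + 1) w * Hhat u z w) := by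
    intro z hz
    rw [contourIntegral_const_mul, contourIntegral_originCircle_reflectedFactor h₂ htr₂ hb hb0 hbR u
      (htr₁ hz) (hdisj z hz) (hzR z hz) hl]
    have he : Complex.exp (-u * z) * Complex.exp (u * z) = 1 := by
      rw [← Complex.exp_add, neg_mul, neg_add_cancel, Complex.exp_zero]
    linear_combination zFactor N a b k z * (2 * Real.pi * Complex.I * reflectedFactor N a b (l + 1) z -
        (-1) ^ l * contourIntegral γ₂ fun w => wFactor N a b (l + 1) w * Hhat u z w) * he
  have hc1 : ContinuousOn (fun z => zFactor N a b k z * reflectedFactor N a b (l + 1) z)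
      (contourTrace γ₁) := by
    refine hZ.fun_mul (ContinuousOn.mul (by fun_prop) (ContinuousOn.inv₀ (by fun_prop) ?_))
    exact fun z hz => Finset.prod_ne_zero_iff.2 fun m hm => add_ne_zero_of_mem_rightHalfPlane
      (by simpa [rightHalfPlane] using hb0 m (Finset.mem_range.1 hm)) (htr₁ hz)
  have hc2 : ContinuousOn (fun z => zFactor N a b k z *
      contourIntegral γ₂ fun w => wFactor N a b (l + 1) w * Hhat u z w) (contourTrace γ₁) := by
    refine hZ.fun_mul (continuousOn_contourIntegral h₂ (isCompact_contourTrace h₁) ?_)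
    exact ContinuousOn.fun_mul ((continuousOn_wFactor hb (l + 1)).comp continuousOn_snd
      fun p hp => hp.2) (continuousOn_Hhat u htr₁ htr₂ hdisj)
  rw [contourIntegral_congr hlast, contourIntegral_sub h₁ (hc1.const_mul _) (hc2.const_mul _),
    contourIntegral_const_mul, contourIntegral_const_mul,
    contourIntegral_zFactor_mul_reflectedFactor h₁ htr₁ ha hb0 hl hk, kernelEntry]
  split_ifs
  · field_simp
  · ring

/-- The distribution function of the last passage time as a determinant of contour integrals of the
kernel. -/
theorem pathDet_columnRate_eq_det
    (h₁ : IsClosedPath γ₁) (htr₁ : contourTrace γ₁ ⊆ rightHalfPlane)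
    (h₂ : IsClosedPath γ₂) (htr₂ : contourTrace γ₂ ⊆ rightHalfPlane)
    (hdisj : ∀ z ∈ contourTrace γ₁, z ∉ contourTrace γ₂)
    (ha : ∀ m < N, WindsOnce γ₁ (a m)) (hb : ∀ m < N, WindsOnce γ₂ (b m))
    (ha0 : ∀ m < N, 0 < a m) (hb0 : ∀ m < N, 0 < b m)
    (haR : ∀ m < N, |a m| < R) (hbR : ∀ m < N, |b m| < R) (hzR : ∀ z ∈ contourTrace γ₁, ‖z‖ < R) :
    pathDet R a (columnRate N a b) (fun k : Fin N => 2 * N - k) (fun _ => u) =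
      (1 - Matrix.of fun l k : Fin N => kernelEntry γ₁ γ₂ N a b u l k).det := by
  let Γ : Matrix (Fin N) (Fin N) ℂ := Matrix.of fun j k => gaugeEntry γ₁ N a b u j k
  let M : Matrix (Fin N) (Fin N) ℂ :=
    Matrix.of fun l k => pathEntry R a (columnRate N a b) l k (2 * N - k) u
  have hΓ : Γ.det = ∏ k : Fin N, (∏ j ∈ Finset.range (2 * N - k),
      ((a k : ℂ) + columnRate N a b j)) * Complex.exp (-a k * u) := by
    rw [Matrix.det_of_isLowerTriangular Γ fun j k hjk =>
      gaugeEntry_of_lt h₁ ha hjk k.2]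
    refine Finset.prod_congr rfl fun k _ => ?_
    rw [prod_range_columnRate (fun x : ℝ => (a k : ℂ) + x) k.2.le]
    exact gaugeEntry_self h₁ htr₁ ha ha0 k.2
  have hM : (Matrix.of fun l k : Fin N => Complex.exp (-a k * u) *
      pathEntry R a (columnRate N a b) l k (2 * N - k) u).det =
      (∏ k : Fin N, Complex.exp (-a k * u)) * M.det :=
    Matrix.det_mul_row (fun k : Fin N => Complex.exp (-a k * u)) M
  have hprod : M * Γ = 1 - Matrix.of fun l k : Fin N => kernelEntry γ₁ γ₂ N a b u l k := by
    ext l k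
    rw [Matrix.mul_apply, Matrix.sub_apply, Matrix.one_apply, Matrix.of_apply]
    simp only [Fin.ext_iff]
    rw [← sum_pathEntry_mul_gaugeEntry h₁ htr₁ h₂ htr₂ hdisj ha hb hb0 haR hbR hzR l.2 k.2,
      Finset.sum_range]
    rfl
  rw [pathDet, hM, ← hprod, Matrix.det_mul, hΓ, Finset.prod_mul_distrib]
  ring

end BoundaryMatrix

/-! ### Fredholm determinants of finite rank kernels -/

section FiniteRank

/-- The minors of a finite rank kernel, expanded into products of functions of one variable each. -/
theorem kernelMinor_eq_sum {ι X : Type*} [Fintype ι] {f g : ι → X → ℂ} {K : X → X → ℂ}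
    (hK : ∀ x y, K x y = ∑ k, f k x * g k y) (n : ℕ) (x : Fin n → X) :
    kernelMinor K n x = ∑ σ : Fin n → ι, ∑ τ : Equiv.Perm (Fin n),
      ((Equiv.Perm.sign τ : ℤ) : ℂ) * ∏ i, f (σ i) (x i) * g (σ (τ i)) (x i) := by
  have h1 : (Matrix.of fun i j => K (x i) (x j)).det =
      ∑ σ : Fin n → ι, (Matrix.of fun i j => f (σ i) (x i) * g (σ i) (x j)).det := by
    have h := (Matrix.detRowAlternating (n := Fin n) (R := ℂ)).toMultilinearMap.map_sum
      (fun i k => fun j => f k (x i) * g k (x j))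
    convert h using 1
    swap
    · rfl
    refine congrArg Matrix.det ?_
    ext i j
    simp only [Matrix.of_apply, hK, Finset.sum_apply]
  rw [kernelMinor, h1]
  refine Finset.sum_congr rfl fun σ _ => ?_
  rw [Matrix.det_apply']
  refine Finset.sum_congr rfl fun τ _ => ?_
  congr 1
  simp only [Matrix.of_apply]
  rw [Finset.prod_mul_distrib, Finset.prod_mul_distrib,
    Equiv.prod_comp τ fun i => f (σ i) (x i)]

variable {ι : Type*} [Fintype ι] {X : Type*} [MeasurableSpace X] {μ : Measure X}
  {f g : ι → X → ℂ} {K : X → X → ℂ}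

theorem exists_isIntegralOperator_of_finiteRank (hK : ∀ x y, K x y = ∑ k, f k x * g k y)
    (hf : ∀ k, MemLp (f k) 2 μ) (hg : ∀ k, MemLp (g k) 2 μ) :
    ∃ T : Lp ℂ 2 μ →L[ℂ] Lp ℂ 2 μ, IsIntegralOperator μ K T := by
  have hg' : ∀ k, MemLp (fun x => (starRingEnd ℂ) (g k x)) 2 μ := fun k => (hg k).star
  refine ⟨∑ k, (innerSL ℂ (hg' k).toLp).smulRight (hf k).toLp, fun h => ?_⟩
  have hgh : ∀ k, Integrable (fun y => g k y * h y) μ := fun k => (hg k).integrable_mul (Lp.memLp h)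
  have hinner : ∀ k, inner ℂ (hg' k).toLp h = ∫ y, g k y * h y ∂μ := fun k => by
    rw [L2.inner_def]
    refine integral_congr_ae ?_
    filter_upwards [(hg' k).coeFn_toLp] with y hy
    rw [hy, RCLike.inner_apply, RCLike.conj_conj, mul_comm]
  have hsum : ∀ᵐ x ∂μ, ((∑ k, (innerSL ℂ (hg' k).toLp).smulRight (hf k).toLp :
      Lp ℂ 2 μ →L[ℂ] Lp ℂ 2 μ) h) x = ∑ k, (∫ y, g k y * h y ∂μ) * f k x := by
    have h1 : ((∑ k, (innerSL ℂ (hg' k).toLp).smulRight (hf k).toLp :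
      Lp ℂ 2 μ →L[ℂ] Lp ℂ 2 μ) h) = ∑ k, (∫ y, g k y * h y ∂μ) • (hf k).toLp := by
      simp only [_root_.sum_apply, ContinuousLinearMap.smulRight_apply,
        innerSL_apply_apply, hinner]
    rw [h1]
    have h2 : ∀ᵐ x ∂μ, ∀ k, ((∫ y, g k y * h y ∂μ) • (hf k).toLp : Lp ℂ 2 μ) x =
        (∫ y, g k y * h y ∂μ) * f k x := by
      rw [ae_all_iff]
      intro k
      filter_upwards [Lp.coeFn_smul (∫ y, g k y * h y ∂μ) (hf k).toLp, (hf k).coeFn_toLp]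
        with x hx hx'
      rw [hx, Pi.smul_apply, hx', smul_eq_mul]
    filter_upwards [Lp.coeFn_finsetSum Finset.univ fun k => (∫ y, g k y * h y ∂μ) • (hf k).toLp, h2]
      with x hx hx'
    rw [hx, Finset.sum_apply]
    exact Finset.sum_congr rfl fun k _ => hx' k
  filter_upwards [hsum] with x hx
  have hKx : (fun y => K x y * h y) = fun y => ∑ k, f k x * (g k y * h y) := by
    ext y
    rw [hK, Finset.sum_mul]
    exact Finset.sum_congr rfl fun k _ => by ring
  rw [hKx]
  refine ⟨integrable_finsetSum _ fun k _ => (hgh k).const_mul _, ?_⟩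
  rw [hx, integral_finsetSum _ fun k _ => (hgh k).const_mul _]
  exact Finset.sum_congr rfl fun k _ => by rw [integral_const_mul, mul_comm]

theorem integrable_kernelMinor [SigmaFinite μ] (hK : ∀ x y, K x y = ∑ k, f k x * g k y)
    (hf : ∀ k, MemLp (f k) 2 μ) (hg : ∀ k, MemLp (g k) 2 μ) (n : ℕ) :
    Integrable (kernelMinor K n) (Measure.pi fun _ => μ) := by
  rw [show kernelMinor K n = _ from funext (kernelMinor_eq_sum hK n)]
  exact integrable_finsetSum _ fun σ _ => integrable_finsetSum _ fun τ _ =>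
    (Integrable.fintype_prod fun i => (hf _).integrable_mul (hg _)).const_mul _

variable [DecidableEq ι]

/-- The sum of the minors of `A` over all sequences of `n` indices counts every principal minor of
size `n` exactly `n!` times. -/
theorem sum_det_submatrix {R : Type*} [CommRing R] (A : Matrix ι ι R) (n : ℕ) :
    ∑ σ : Fin n → ι, (A.submatrix σ σ).det = n.factorial *
      ∑ s ∈ Finset.univ.powersetCard n,
        (A.submatrix (Subtype.val : s → ι) (Subtype.val : s → ι)).det := by
  classical
  have h1 : ∑ σ : Fin n → ι, (A.submatrix σ σ).det =
      ∑ σ : Fin n → ι with Function.Injective σ, (A.submatrix σ σ).det := by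
    refine (Finset.sum_filter_of_ne fun σ _ hσ => ?_).symm
    intro i j hij
    by_contra hne
    refine hσ (Matrix.det_zero_of_row_eq hne ?_)
    ext k
    simp only [Matrix.submatrix_apply, hij]
  rw [h1, ← Finset.sum_fiberwise_of_maps_to (t := Finset.univ.powersetCard n)
    (g := fun σ : Fin n → ι => Finset.univ.image σ), Finset.mul_sum]
  · refine Finset.sum_congr rfl fun s hs => ?_
    have hcard : s.card = n := (Finset.mem_powersetCard.1 hs).2
    have h2 : ∑ σ ∈ (Finset.univ.filter fun σ : Fin n → ι => Function.Injective σ) with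
        Finset.univ.image σ = s, (A.submatrix σ σ).det =
        ∑ _e : Fin n ≃ s, (A.submatrix (Subtype.val : s → ι) (Subtype.val : s → ι)).det := by
      symm
      refine Finset.sum_bij (fun e _ => fun i => (e i : ι)) ?_ ?_ ?_ ?_
      · intro e _
        rw [Finset.mem_filter, Finset.mem_filter]
        refine ⟨⟨Finset.mem_univ _, Subtype.val_injective.comp e.injective⟩, ?_⟩
        ext x
        simp only [Finset.mem_image, Finset.mem_univ, true_and]
        exact ⟨fun ⟨i, hi⟩ => hi ▸ (e i).2, fun hx => ⟨e.symm ⟨x, hx⟩, by simp⟩⟩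
      · intro e _ e' _ h
        ext i
        exact congrFun h i
      · intro σ hσ
        rw [Finset.mem_filter, Finset.mem_filter] at hσ
        obtain ⟨⟨-, hinj⟩, him⟩ := hσ
        have hmem : ∀ i, σ i ∈ s := fun i => him ▸ Finset.mem_image_of_mem σ (Finset.mem_univ i)
        refine ⟨Equiv.ofBijective (fun i => (⟨σ i, hmem i⟩ : s)) ⟨?_, ?_⟩, Finset.mem_univ _, rfl⟩
        · intro i j hij
          exact hinj (congrArg Subtype.val hij)
        · rintro ⟨x, hx⟩
          rw [← him, Finset.mem_image] at hx
          obtain ⟨i, -, hi⟩ := hx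
          exact ⟨i, Subtype.ext hi⟩
      · intro e _
        rw [← Matrix.det_submatrix_equiv_self e, Matrix.submatrix_submatrix]
        rfl
    rw [h2, Finset.sum_const, Finset.card_univ, Fintype.card_equiv (s.equivFinOfCardEq hcard).symm,
      Fintype.card_fin, nsmul_eq_mul]
  · intro σ hσ
    rw [Finset.mem_powersetCard, Finset.card_image_of_injective _ (Finset.mem_filter.1 hσ).2]
    exact ⟨Finset.subset_univ _, by simp⟩

theorem det_one_add_eq_sum_minors {R : Type*} [CommRing R] (A : Matrix ι ι R) :
    (1 + A).det = ∑ n ∈ Finset.range (Fintype.card ι + 1), ∑ s ∈ Finset.univ.powersetCard n,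
      (A.submatrix (Subtype.val : s → ι) (Subtype.val : s → ι)).det := by
  set p : Polynomial R := (1 + (Polynomial.X : Polynomial R) • A.map Polynomial.C).det with hp
  have hdeg : p.natDegree < Fintype.card ι + 1 := by
    rw [Nat.lt_succ_iff, Polynomial.natDegree_le_iff_coeff_eq_zero]
    intro n hn
    rw [hp, Matrix.coeff_det_one_add_X_smul_eq_sum_minors, Finset.powersetCard_eq_empty.2
      (by rwa [Finset.card_univ]), Finset.sum_empty]
  have h1 : p.eval 1 = (1 + A).det := by
    rw [hp, ← Polynomial.coe_evalRingHom, RingHom.map_det]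
    congr 1
    ext i j
    by_cases hij : i = j
    · subst hij; simp
    · simp [hij]
  rw [← h1, Polynomial.eval_eq_sum_range' hdeg]
  refine Finset.sum_congr rfl fun n _ => ?_
  rw [one_pow, mul_one, hp, Matrix.coeff_det_one_add_X_smul_eq_sum_minors]

variable [SigmaFinite μ]

/-- The terms of the Fredholm series of a finite rank kernel are sums of principal minors. -/
theorem fredholmTerm_eq_sum_minors (hK : ∀ x y, K x y = ∑ k, f k x * g k y)
    (hf : ∀ k, MemLp (f k) 2 μ) (hg : ∀ k, MemLp (g k) 2 μ) (n : ℕ) :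
    fredholmTerm μ K n = ∑ s ∈ Finset.univ.powersetCard n,
      ((Matrix.of fun l k => ∫ x, f l x * g k x ∂μ).submatrix (Subtype.val : s → ι)
        (Subtype.val : s → ι)).det := by
  set A : Matrix ι ι ℂ := Matrix.of fun l k => ∫ x, f l x * g k x ∂μ with hA
  have hprod : ∀ (σ : Fin n → ι) (τ : Equiv.Perm (Fin n)), Integrable (fun x : Fin n → X =>
      ∏ i, f (σ i) (x i) * g (σ (τ i)) (x i)) (Measure.pi fun _ => μ) := fun σ τ =>
    Integrable.fintype_prod fun i => (hf _).integrable_mul (hg _)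
  have h1 : ∫ x, kernelMinor K n x ∂(Measure.pi fun _ => μ) =
      ∑ σ : Fin n → ι, (A.submatrix σ σ).det := by
    rw [show kernelMinor K n = _ from funext (kernelMinor_eq_sum hK n), integral_finsetSum _
      fun σ _ => integrable_finsetSum _ fun τ _ => (hprod σ τ).const_mul _]
    refine Finset.sum_congr rfl fun σ _ => ?_
    rw [integral_finsetSum _ fun τ _ => (hprod σ τ).const_mul _, ← Matrix.det_transpose,
      Matrix.det_apply']
    refine Finset.sum_congr rfl fun τ _ => ?_
    rw [integral_const_mul,
      integral_fintype_prod_eq_prod fun i x => f (σ i) x * g (σ (τ i)) x]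
    rfl
  rw [fredholmTerm, h1, sum_det_submatrix, inv_mul_cancel_left₀]
  exact_mod_cast n.factorial_ne_zero

theorem fredholmTerm_eq_zero (hK : ∀ x y, K x y = ∑ k, f k x * g k y)
    (hf : ∀ k, MemLp (f k) 2 μ) (hg : ∀ k, MemLp (g k) 2 μ) {n : ℕ} (hn : Fintype.card ι < n) :
    fredholmTerm μ K n = 0 := by
  rw [fredholmTerm_eq_sum_minors hK hf hg, Finset.powersetCard_eq_empty.2
      (by rwa [Finset.card_univ]), Finset.sum_empty]

theorem fredholmConverges_of_finiteRank (hK : ∀ x y, K x y = ∑ k, f k x * g k y)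
    (hf : ∀ k, MemLp (f k) 2 μ) (hg : ∀ k, MemLp (g k) 2 μ) : FredholmConverges μ K :=
  ⟨integrable_kernelMinor hK hf hg, summable_of_ne_finset_zero (s := Finset.range (Fintype.card ι))
    fun n hn => fredholmTerm_eq_zero hK hf hg (by simp at hn; omega)⟩

/-- The Fredholm determinant of a finite rank kernel is a finite determinant. -/
theorem fredholmDet_of_finiteRank (hK : ∀ x y, K x y = ∑ k, f k x * g k y)
    (hf : ∀ k, MemLp (f k) 2 μ) (hg : ∀ k, MemLp (g k) 2 μ) :
    fredholmDet μ K = (1 + Matrix.of fun l k => ∫ x, f l x * g k x ∂μ).det := by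
  rw [fredholmDet, tsum_eq_sum (s := Finset.range (Fintype.card ι))
    fun n hn => fredholmTerm_eq_zero hK hf hg (by simp at hn; omega), det_one_add_eq_sum_minors,
    Finset.sum_range_succ', add_comm]
  congr 1
  · exact Finset.sum_congr rfl fun n _ => fredholmTerm_eq_sum_minors hK hf hg _
  · rw [Finset.powersetCard_zero, Finset.sum_singleton, Matrix.det_isEmpty]

end FiniteRank

/-! ### Superpositions of decaying exponentials -/

section Laplace

variable {γ : ℝ → ℂ} {φ : ℂ → ℂ}

theorem norm_contourIntegral_le (h : IsClosedPath γ) {f : ℂ → ℂ} {M : ℝ}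
    (hM : ∀ z ∈ contourTrace γ, ‖f z‖ ≤ M) :
    ‖contourIntegral γ f‖ ≤ M * ∫ t in (0 : ℝ)..1, ‖deriv γ t‖ := by
  rw [contourIntegral, ← intervalIntegral.integral_const_mul]
  refine intervalIntegral.norm_integral_le_of_norm_le zero_le_one
    (Filter.Eventually.of_forall fun t ht => ?_) (h.integrable_deriv.norm.const_mul M)
  rw [norm_mul]
  exact mul_le_mul_of_nonneg_right (hM _ (mem_contourTrace (Set.Ioc_subset_Icc_self ht)))
    (norm_nonneg _)

/-- A superposition of exponentials `e^{-ξw}` over a contour in the right half-plane decays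
exponentially as `ξ → ∞`. -/
theorem exists_norm_contourIntegral_exp_le (h : IsClosedPath γ)
    (htr : contourTrace γ ⊆ rightHalfPlane) (hφ : ContinuousOn φ (contourTrace γ)) :
    ∃ C δ : ℝ, 0 < δ ∧ ∀ ξ : ℝ, 0 < ξ →
      ‖contourIntegral γ fun w => Complex.exp (-ξ * w) * φ w‖ ≤ C * Real.exp (-δ * ξ) := by
  obtain ⟨w₀, hw₀, hmin⟩ := (isCompact_contourTrace h).exists_isMinOn
    ⟨γ 0, mem_contourTrace (by simp)⟩ Complex.continuous_re.continuousOn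
  obtain ⟨M, hM⟩ := (isCompact_contourTrace h).exists_bound_of_continuousOn hφ
  refine ⟨M * ∫ t in (0 : ℝ)..1, ‖deriv γ t‖, w₀.re, htr hw₀, fun ξ hξ => ?_⟩
  refine (norm_contourIntegral_le h (M := Real.exp (-w₀.re * ξ) * M) fun w hw => ?_).trans_eq
    (by ring)
  rw [norm_mul, Complex.norm_exp]
  have h1 : w₀.re ≤ w.re := hmin hw
  refine mul_le_mul ?_ (hM w hw) (norm_nonneg _) (Real.exp_pos _).le
  rw [Real.exp_le_exp]
  simp only [Complex.mul_re, Complex.neg_re, Complex.ofReal_re, Complex.neg_im, Complex.ofReal_im]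
  nlinarith

theorem continuous_contourIntegral_exp (h : IsClosedPath γ) (hφ : ContinuousOn φ (contourTrace γ)) :
    Continuous fun ξ : ℝ => contourIntegral γ fun w => Complex.exp (-ξ * w) * φ w := by
  have h1 : Continuous fun t : ℝ => contourIntegral γ fun w => Complex.exp (w * t) * φ w :=
    continuous_iff_continuousAt.2 fun t => (hasDerivAt_contourIntegral_exp h hφ t).continuousAt
  refine (h1.comp continuous_neg).congr fun ξ => ?_
  change (contourIntegral γ fun w => Complex.exp (w * ((-ξ : ℝ) : ℂ)) * φ w) = _
  refine contourIntegral_congr fun w _ => ?_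
  rw [Complex.ofReal_neg, mul_comm w]

theorem memLp_contourIntegral_exp (h : IsClosedPath γ)
    (htr : contourTrace γ ⊆ rightHalfPlane) (hφ : ContinuousOn φ (contourTrace γ)) :
    MemLp (fun ξ : ℝ => contourIntegral γ fun w => Complex.exp (-ξ * w) * φ w) 2
      halfLineMeasure := by
  obtain ⟨C, δ, hδ, hC⟩ := exists_norm_contourIntegral_exp_le h htr hφ
  have hexp : MemLp (fun ξ : ℝ => Real.exp (-δ * ξ)) 2 halfLineMeasure := by
    rw [memLp_two_iff_integrable_sq (by fun_prop)]
    have := integrableOn_exp_mul_Ioi (a := -(2 * δ)) (by linarith) 0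
    refine (this : Integrable _ halfLineMeasure).congr (Filter.Eventually.of_forall fun ξ => ?_)
    simp only [← Real.exp_nat_mul]
    congr 1
    push_cast
    ring
  refine (hexp.const_mul C).of_le
    (continuous_contourIntegral_exp h hφ).aestronglyMeasurable ?_
  refine (ae_restrict_iff' measurableSet_Ioi).2 (Filter.Eventually.of_forall fun ξ hξ => ?_)
  exact (hC ξ hξ).trans (le_abs_self _)

end Laplace

/-! ### The finite rank factorization of the kernel -/

section Kernel

variable {γ₁ γ₂ : ℝ → ℂ} {N : ℕ} {a b : ℕ → ℝ} {u : ℝ}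

/-- For fixed `w`, the function `Hhat` coincides off the diagonal with a function of `z` that is
holomorphic in the right half-plane. -/
theorem Hhat_eq_add_dslope {z w : ℂ} (hne : z ≠ w) :
    Hhat u z w = Complex.exp (-u * (z + w)) / (z + w) +
      dslope (fun v => Complex.exp (-u * (v + w)) - Complex.exp (-2 * u * v)) w z := by
  rw [dslope_of_ne _ hne, slope_def_field, Hhat, show w - z = -(z - w) by ring,
    show -(u : ℂ) * (w + w) = -2 * u * w by ring, div_neg]
  ring

/-- The left factors `(2πi)⁻¹ ∮ e^{-λz} / ∏_{m≤k} (z - aₘ) dz` of the kernel. -/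
noncomputable def leftFactor (γ : ℝ → ℂ) (a : ℕ → ℝ) (k : ℕ) (lam : ℝ) : ℂ :=
  (2 * Real.pi * Complex.I)⁻¹ * contourIntegral γ fun z => Complex.exp (-lam * z) *
    (∏ m ∈ Finset.range (k + 1), (z - a m))⁻¹

/-- The right factors
`(2πi)⁻² ∮ e^{-ξw} ∏_{m<N} (w + aₘ) / (w - bₘ) ∮ Ĥ_u(z, w) ∏_{m<N} (z + bₘ) / ∏_{k≤m<N} (z - aₘ) dz dw`
of the kernel. -/
noncomputable def rightFactor (γ₁ γ₂ : ℝ → ℂ) (N : ℕ) (a b : ℕ → ℝ) (u : ℝ) (k : ℕ) (ξ : ℝ) : ℂ :=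
  (2 * Real.pi * Complex.I)⁻¹ ^ 2 * contourIntegral γ₂ fun w => Complex.exp (-ξ * w) *
    (wFactor N a b 0 w * contourIntegral γ₁ fun z => zFactor N a b k z * Hhat u z w)

theorem continuousOn_leftFactor_integrand (ha : ∀ m < N, WindsOnce γ₁ (a m)) {k : ℕ} (hk : k < N) :
    ContinuousOn (fun z => (∏ m ∈ Finset.range (k + 1), (z - (a m : ℂ)))⁻¹) (contourTrace γ₁) :=
  continuousOn_prod_inv _ (fun m => (a m : ℂ)) fun m hm =>
    (ha m (by have := Finset.mem_range.1 hm; omega)).1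

theorem continuousOn_rightFactor_integrand
    (h₁ : IsClosedPath γ₁) (htr₁ : contourTrace γ₁ ⊆ rightHalfPlane)
    (h₂ : IsClosedPath γ₂) (htr₂ : contourTrace γ₂ ⊆ rightHalfPlane)
    (hdisj : ∀ z ∈ contourTrace γ₁, z ∉ contourTrace γ₂)
    (ha : ∀ m < N, WindsOnce γ₁ (a m)) (hb : ∀ m < N, WindsOnce γ₂ (b m)) (k : ℕ) :
    ContinuousOn (fun w => wFactor N a b 0 w *
      contourIntegral γ₁ fun z => zFactor N a b k z * Hhat u z w) (contourTrace γ₂) := by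
  refine (continuousOn_wFactor hb 0).fun_mul
    (continuousOn_contourIntegral h₁ (isCompact_contourTrace h₂) ?_)
  refine ContinuousOn.fun_mul ((continuousOn_zFactor ha k).comp continuousOn_snd fun p hp => hp.2) ?_
  exact (continuousOn_Hhat u htr₁ htr₂ hdisj).comp (f := fun p : ℂ × ℂ => (p.2, p.1))
    (by fun_prop) fun p hp => ⟨hp.2, hp.1⟩

/-- Newton's formula for the nodes `a₀, …, a_{N-1}` separates `λ` from `w` in the inner integral. -/
theorem contourIntegral_exp_mul_Hhat_eq_sum
    (h₁ : IsClosedPath γ₁) (htr₁ : contourTrace γ₁ ⊆ rightHalfPlane)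
    (ha : ∀ m < N, WindsOnce γ₁ (a m)) (ha0 : ∀ m < N, 0 < a m)
    {w : ℂ} (hw : w ∈ rightHalfPlane) (hw₁ : w ∉ contourTrace γ₁) (lam : ℝ) :
    contourIntegral γ₁ (fun z => Complex.exp (-lam * z) * (zFactor N a b 0 z * Hhat u z w)) =
      ∑ k ∈ Finset.range N, leftFactor γ₁ a k lam *
        contourIntegral γ₁ fun z => zFactor N a b k z * Hhat u z w := by
  have hpi := Complex.two_pi_I_ne_zero
  have hne : ∀ z ∈ contourTrace γ₁, z ≠ w := fun z hz he => hw₁ (he ▸ hz)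
  let g : ℂ → ℂ := fun z => (∏ m ∈ Finset.range N, (z + (b m : ℂ))) *
    (Complex.exp (-u * (z + w)) / (z + w) +
      dslope (fun v => Complex.exp (-u * (v + w)) - Complex.exp (-2 * u * v)) w z)
  have hg : DifferentiableOn ℂ g rightHalfPlane := by
    refine DifferentiableOn.fun_mul (by fun_prop) (DifferentiableOn.fun_add
      (DifferentiableOn.fun_div (by fun_prop) (by fun_prop) fun z hz =>
        add_ne_zero_of_mem_rightHalfPlane hw hz) ?_)
    exact (Complex.differentiableOn_dslope (isOpen_rightHalfPlane.mem_nhds hw)).2 (by fun_prop)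
  have h := contourIntegral_mul_eq_sum_range (f := fun z => Complex.exp (-lam * z)) h₁ htr₁
    (by fun_prop) hg N (fun m => (a m : ℂ)) ha fun m hm => by simpa [rightHalfPlane] using ha0 m hm
  have hk : ∀ k, contourIntegral γ₁ (fun z => g z * (∏ m ∈ Finset.Ico k N, (z - (a m : ℂ)))⁻¹) =
      contourIntegral γ₁ fun z => zFactor N a b k z * Hhat u z w := fun k =>
    contourIntegral_congr fun z hz => by
      rw [Hhat_eq_add_dslope (hne z hz)]
      simp only [g, zFactor]
      ring
  simp only [hk] at h
  rw [← mul_right_inj' hpi, Finset.mul_sum]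
  refine Eq.trans ?_ (h.trans ?_)
  · congr 1
    refine contourIntegral_congr fun z hz => ?_
    rw [Hhat_eq_add_dslope (hne z hz), zFactor, ← Finset.range_eq_Ico]
    simp only [g]
    ring
  · refine Finset.sum_congr rfl fun k _ => ?_
    rw [leftFactor]
    field_simp

theorem prod_Icc_eq_zFactor_mul_wFactor (N : ℕ) (α β : ℕ → ℝ) (z w : ℂ) :
    ∏ m ∈ Finset.Icc 1 N, ((z + β m) * (w + α m)) / ((z - α m) * (w - β m)) =
      zFactor N (fun m => α (m + 1)) (fun m => β (m + 1)) 0 z *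
        wFactor N (fun m => α (m + 1)) (fun m => β (m + 1)) 0 w := by
  have h1 : ∏ m ∈ Finset.Icc 1 N, ((z + β m) * (w + α m)) / ((z - α m) * (w - β m)) =
      ∏ m ∈ Finset.range N,
        ((z + β (m + 1)) * (w + α (m + 1))) / ((z - α (m + 1)) * (w - β (m + 1))) := by
    rw [← Finset.Ico_succ_right_eq_Icc, Finset.range_eq_Ico, Finset.prod_Ico_add'
      (fun m => ((z + β m) * (w + α m)) / ((z - α m) * (w - β m)) : ℕ → ℂ) 0 N 1]
    simp
  rw [h1, zFactor, wFactor, ← Finset.range_eq_Ico]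
  simp only [Finset.prod_mul_distrib, div_eq_mul_inv, mul_inv, Finset.prod_inv_distrib]
  ring

/-- The kernel has finite rank. -/
theorem Khat_eq_sum {α β : ℕ → ℝ} (hab : a = fun m => α (m + 1)) (hbb : b = fun m => β (m + 1))
    (h₁ : IsClosedPath γ₁) (htr₁ : contourTrace γ₁ ⊆ rightHalfPlane)
    (h₂ : IsClosedPath γ₂) (htr₂ : contourTrace γ₂ ⊆ rightHalfPlane)
    (hdisj : ∀ z ∈ contourTrace γ₁, z ∉ contourTrace γ₂)
    (ha : ∀ m < N, WindsOnce γ₁ (a m)) (hb : ∀ m < N, WindsOnce γ₂ (b m)) (ha0 : ∀ m < N, 0 < a m)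
    (lam ξ : ℝ) :
    Khat N α β u γ₁ γ₂ lam ξ =
      ∑ k : Fin N, leftFactor γ₁ a k lam * rightFactor γ₁ γ₂ N a b u k ξ := by
  have hH := continuousOn_Hhat u htr₁ htr₂ hdisj
  have h1 : contourIntegral γ₁ (fun z => contourIntegral γ₂ fun w =>
      Complex.exp (-lam * z - ξ * w) * Hhat u z w *
        ∏ m ∈ Finset.Icc 1 N, ((z + β m) * (w + α m)) / ((z - α m) * (w - β m))) =
      contourIntegral γ₁ (fun z => contourIntegral γ₂ fun w => (Complex.exp (-ξ * w) *
        wFactor N a b 0 w) * (Complex.exp (-lam * z) * (zFactor N a b 0 z * Hhat u z w))) := by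
    refine contourIntegral_congr fun z _ => contourIntegral_congr fun w _ => ?_
    rw [prod_Icc_eq_zFactor_mul_wFactor, ← hab, ← hbb, show -(lam : ℂ) * z - ξ * w =
      -lam * z + -ξ * w by ring, Complex.exp_add]
    ring
  have h2 : ∀ w ∈ contourTrace γ₂, (contourIntegral γ₁ fun z => (Complex.exp (-ξ * w) *
        wFactor N a b 0 w) * (Complex.exp (-lam * z) * (zFactor N a b 0 z * Hhat u z w))) =
      ∑ k ∈ Finset.range N, leftFactor γ₁ a k lam * (Complex.exp (-ξ * w) *
        (wFactor N a b 0 w * contourIntegral γ₁ fun z => zFactor N a b k z * Hhat u z w)) := by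
    intro w hw
    rw [contourIntegral_const_mul, contourIntegral_exp_mul_Hhat_eq_sum h₁ htr₁ ha ha0 (htr₂ hw)
      (fun hw₁ => hdisj w hw₁ hw), Finset.mul_sum]
    exact Finset.sum_congr rfl fun k _ => by ring
  rw [Khat, h1, contourIntegral_comm h₁ h₂, contourIntegral_congr h2, contourIntegral_finsetSum h₂,
    Finset.mul_sum, Finset.sum_range]
  · refine Finset.sum_congr rfl fun k _ => ?_
    rw [contourIntegral_const_mul, rightFactor, one_div, inv_pow]
    ring
  · exact fun k _ => (ContinuousOn.fun_mul (by fun_prop)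
      (continuousOn_rightFactor_integrand h₁ htr₁ h₂ htr₂ hdisj ha hb k)).const_mul _
  · refine ContinuousOn.fun_mul (ContinuousOn.fun_mul (by fun_prop)
      ((continuousOn_wFactor hb 0).comp continuousOn_snd fun p hp => hp.2))
      (ContinuousOn.fun_mul (by fun_prop) (ContinuousOn.fun_mul
        ((continuousOn_zFactor ha 0).comp continuousOn_fst fun p hp => hp.1) hH))

theorem integral_leftFactor_mul_exp (h₁ : IsClosedPath γ₁) (htr₁ : contourTrace γ₁ ⊆ rightHalfPlane)
    (ha : ∀ m < N, WindsOnce γ₁ (a m)) (ha0 : ∀ m < N, 0 < a m)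
    {l : ℕ} (hl : l < N) {w : ℂ} (hw : w ∈ rightHalfPlane) :
    ∫ ξ in Set.Ioi (0 : ℝ), leftFactor γ₁ a l ξ * Complex.exp (-ξ * w) =
      (-1) ^ l * (∏ m ∈ Finset.range (l + 1), (w + a m))⁻¹ := by
  have hpi := Complex.two_pi_I_ne_zero
  have hw0 : 0 < w.re := hw
  have h1 := integral_mul_contourIntegral_exp (f := fun ξ => Complex.exp (-ξ * w)) (M := 1) h₁ htr₁
    (continuousOn_leftFactor_integrand ha hl) (by fun_prop) fun ξ hξ => by
      rw [Complex.norm_exp, Real.exp_le_one_iff]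
      simp only [Complex.mul_re, Complex.neg_re, Complex.ofReal_re, Complex.neg_im,
        Complex.ofReal_im]
      nlinarith
  have h2 : ∀ z ∈ contourTrace γ₁, (∏ m ∈ Finset.range (l + 1), (z - (a m : ℂ)))⁻¹ *
      ∫ ξ in Set.Ioi (0 : ℝ), Complex.exp (-ξ * w) * Complex.exp (-ξ * z) =
      (z - -w)⁻¹ * (∏ m ∈ Finset.range (l + 1), (z - (a m : ℂ)))⁻¹ := by
    intro z hz
    have hz0 : 0 < z.re := htr₁ hz
    have h3 := integral_exp_mul_complex_Ioi (a := -(z + w)) (by simp; linarith) 0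
    have h4 : ∫ ξ in Set.Ioi (0 : ℝ), Complex.exp (-ξ * w) * Complex.exp (-ξ * z) =
        ∫ ξ in Set.Ioi (0 : ℝ), Complex.exp (-(z + w) * ξ) := by
      congr 1
      ext ξ
      rw [← Complex.exp_add]
      congr 1
      ring
    rw [h4, h3, Complex.ofReal_zero, mul_zero, Complex.exp_zero, neg_div_neg_eq, one_div,
      sub_neg_eq_add, mul_comm]
  have h5 : -w ∉ contourTrace γ₁ := fun hm =>
    add_ne_zero_of_mem_rightHalfPlane hw (htr₁ hm) (neg_add_cancel w)
  have h6 : contourIntegral γ₁ (fun z => (z - -w)⁻¹) = 0 := by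
    refine contourIntegral_eq_zero_of_differentiableOn h₁ htr₁
      (DifferentiableOn.fun_inv (by fun_prop) fun z hz => ?_)
    rw [sub_neg_eq_add]
    exact add_ne_zero_of_mem_rightHalfPlane hw hz
  have h7 := contourIntegral_inv_sub_mul_prod_inv h₁ h5 h6 (Finset.range (l + 1))
    (fun m => (a m : ℂ)) (fun m hm => ha m (by have := Finset.mem_range.1 hm; omega))
    (fun m hm he => add_ne_zero_of_mem_rightHalfPlane hw (w := (a m : ℂ))
      (by simpa [rightHalfPlane] using ha0 m (by have := Finset.mem_range.1 hm; omega))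
      (by rw [he, neg_add_cancel])) ⟨0, by simp⟩
  have h8 : ∏ m ∈ Finset.range (l + 1), (-w - (a m : ℂ)) =
      (-1) ^ (l + 1) * ∏ m ∈ Finset.range (l + 1), (w + a m) := by
    rw [← Finset.card_range (l + 1), ← Finset.prod_const, Finset.card_range,
      ← Finset.prod_mul_distrib]
    exact Finset.prod_congr rfl fun m _ => by ring
  have h9 : ((-1 : ℂ) ^ (l + 1))⁻¹ = (-1) ^ (l + 1) := by rw [← inv_pow]; norm_num
  rw [contourIntegral_congr h2, h7, h8, mul_inv, h9, pow_succ] at h1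
  have h10 : ∫ ξ in Set.Ioi (0 : ℝ), leftFactor γ₁ a l ξ * Complex.exp (-ξ * w) =
      (2 * Real.pi * Complex.I)⁻¹ * ∫ ξ in Set.Ioi (0 : ℝ), Complex.exp (-ξ * w) *
        contourIntegral γ₁ fun z => Complex.exp (-ξ * z) *
          (∏ m ∈ Finset.range (l + 1), (z - (a m : ℂ)))⁻¹ := by
    rw [← integral_const_mul]
    congr 1
    ext ξ
    rw [leftFactor]
    ring
  rw [h10, h1]
  field_simp

theorem memLp_leftFactor (h₁ : IsClosedPath γ₁) (htr₁ : contourTrace γ₁ ⊆ rightHalfPlane)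
    (ha : ∀ m < N, WindsOnce γ₁ (a m)) {k : ℕ} (hk : k < N) :
    MemLp (leftFactor γ₁ a k) 2 halfLineMeasure :=
  (memLp_contourIntegral_exp h₁ htr₁ (continuousOn_leftFactor_integrand ha hk)).const_mul _

theorem memLp_rightFactor
    (h₁ : IsClosedPath γ₁) (htr₁ : contourTrace γ₁ ⊆ rightHalfPlane)
    (h₂ : IsClosedPath γ₂) (htr₂ : contourTrace γ₂ ⊆ rightHalfPlane)
    (hdisj : ∀ z ∈ contourTrace γ₁, z ∉ contourTrace γ₂)
    (ha : ∀ m < N, WindsOnce γ₁ (a m)) (hb : ∀ m < N, WindsOnce γ₂ (b m)) (k : ℕ) :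
    MemLp (rightFactor γ₁ γ₂ N a b u k) 2 halfLineMeasure :=
  (memLp_contourIntegral_exp h₂ htr₂
    (continuousOn_rightFactor_integrand h₁ htr₁ h₂ htr₂ hdisj ha hb k)).const_mul _

theorem integral_leftFactor_mul_rightFactor
    (h₁ : IsClosedPath γ₁) (htr₁ : contourTrace γ₁ ⊆ rightHalfPlane)
    (h₂ : IsClosedPath γ₂) (htr₂ : contourTrace γ₂ ⊆ rightHalfPlane)
    (hdisj : ∀ z ∈ contourTrace γ₁, z ∉ contourTrace γ₂)
    (ha : ∀ m < N, WindsOnce γ₁ (a m)) (hb : ∀ m < N, WindsOnce γ₂ (b m)) (ha0 : ∀ m < N, 0 < a m)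
    {l : ℕ} (hl : l < N) (k : ℕ) :
    ∫ ξ, leftFactor γ₁ a l ξ * rightFactor γ₁ γ₂ N a b u k ξ ∂halfLineMeasure =
      kernelEntry γ₁ γ₂ N a b u l k := by
  have hφ := continuousOn_rightFactor_integrand (u := u) h₁ htr₁ h₂ htr₂ hdisj ha hb k
  have hl' := continuousOn_leftFactor_integrand ha hl
  obtain ⟨C, δ, hδ, hC⟩ := exists_norm_contourIntegral_exp_le h₁ htr₁ hl'
  have hbound : ∀ ξ : ℝ, 0 < ξ →
      ‖leftFactor γ₁ a l ξ‖ ≤ ‖(2 * Real.pi * Complex.I : ℂ)⁻¹‖ * C := fun ξ hξ => by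
    rw [leftFactor, norm_mul]
    refine mul_le_mul_of_nonneg_left ((hC ξ hξ).trans ?_) (norm_nonneg _)
    have h3 : 0 ≤ C := nonneg_of_mul_nonneg_left ((norm_nonneg _).trans (hC ξ hξ)) (Real.exp_pos _)
    refine mul_le_of_le_one_right h3 (Real.exp_le_one_iff.2 ?_)
    nlinarith
  have h1 := integral_mul_contourIntegral_exp h₂ htr₂ hφ (f := leftFactor γ₁ a l)
    ((continuous_contourIntegral_exp h₁ hl').const_mul _) hbound
  have h2 : ∀ w ∈ contourTrace γ₂, (wFactor N a b 0 w *
      contourIntegral γ₁ fun z => zFactor N a b k z * Hhat u z w) *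
        ∫ ξ in Set.Ioi (0 : ℝ), leftFactor γ₁ a l ξ * Complex.exp (-ξ * w) =
      (-1) ^ l * contourIntegral γ₁ fun z => zFactor N a b k z *
        (wFactor N a b (l + 1) w * Hhat u z w) := by
    intro w hw
    have hne : ∏ m ∈ Finset.range (l + 1), (w + (a m : ℂ)) ≠ 0 :=
      Finset.prod_ne_zero_iff.2 fun m hm => add_ne_zero_of_mem_rightHalfPlane
        (by simpa [rightHalfPlane] using ha0 m (by have := Finset.mem_range.1 hm; omega)) (htr₂ hw)
    have hfac : wFactor N a b 0 w * (∏ m ∈ Finset.range (l + 1), (w + (a m : ℂ)))⁻¹ =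
        wFactor N a b (l + 1) w := by
      rw [wFactor, wFactor, ← Finset.range_eq_Ico,
        ← Finset.prod_range_mul_prod_Ico _ (Nat.succ_le_of_lt hl)]
      generalize (∏ m ∈ Finset.range (l + 1), (w + (a m : ℂ))) = q at *
      field_simp
    have hpull : (contourIntegral γ₁ fun z => zFactor N a b k z *
        (wFactor N a b (l + 1) w * Hhat u z w)) = wFactor N a b (l + 1) w *
          contourIntegral γ₁ fun z => zFactor N a b k z * Hhat u z w := by
      rw [← contourIntegral_const_mul]
      exact contourIntegral_congr fun z _ => by ring
    rw [integral_leftFactor_mul_exp h₁ htr₁ ha ha0 hl (htr₂ hw), hpull, ← hfac]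
    ring
  have h3 : ∫ ξ, leftFactor γ₁ a l ξ * rightFactor γ₁ γ₂ N a b u k ξ ∂halfLineMeasure =
      (2 * Real.pi * Complex.I)⁻¹ ^ 2 * ∫ ξ in Set.Ioi (0 : ℝ), leftFactor γ₁ a l ξ *
        contourIntegral γ₂ fun w => Complex.exp (-ξ * w) *
          (wFactor N a b 0 w * contourIntegral γ₁ fun z => zFactor N a b k z * Hhat u z w) := by
    rw [← integral_const_mul]
    refine integral_congr_ae (Filter.Eventually.of_forall fun ξ => ?_)
    simp only [rightFactor]
    ring
  rw [h3, h1, contourIntegral_congr h2, contourIntegral_const_mul, ← contourIntegral_comm h₁ h₂,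
    kernelEntry]
  · simp only [contourIntegral_const_mul]
    ring
  · exact ContinuousOn.fun_mul ((continuousOn_zFactor ha k).comp continuousOn_fst fun p hp => hp.1)
      (ContinuousOn.fun_mul ((continuousOn_wFactor hb (l + 1)).comp continuousOn_snd fun p hp => hp.2)
        (continuousOn_Hhat u htr₁ htr₂ hdisj))

end Kernel

/-! ### The distribution function as a Fredholm determinant -/

theorem theorem5p2 {Ω : Type*} [MeasurableSpace Ω] (P : Measure Ω) [IsProbabilityMeasure P]
    (N : ℕ) (hN : 1 ≤ N) (α β : ℕ → ℝ)
    (hα : ∀ m ∈ Finset.Icc 1 N, 0 < α m) (hβ : ∀ m ∈ Finset.Icc 1 N, 0 < β m)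
    (W : ℕ × ℕ → Ω → ℝ)
    (hIndep : iIndepFun (fun p : trapezoid N => W p) P)
    (hLaw : ∀ p ∈ trapezoid N, HasLaw (W p) (expMeasure (weightRate N α β p)) P)
    (u : ℝ) (hu : 0 < u)
    (Γ₁ Γ₂ : ℝ → ℂ)
    (hΓ₁ : IsContourInRightHalfPlane Γ₁) (hΓ₂ : IsContourInRightHalfPlane Γ₂)
    (hΓ₁α : ∀ m ∈ Finset.Icc 1 N, Encloses Γ₁ (α m))
    (hΓ₂β : ∀ m ∈ Finset.Icc 1 N, Encloses Γ₂ (β m))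
    (hΓ₂Γ₁ : ∀ z ∈ contourTrace Γ₁, Encloses Γ₂ z) :
    (∃ T : Lp ℂ 2 halfLineMeasure →L[ℂ] Lp ℂ 2 halfLineMeasure,
      IsIntegralOperator halfLineMeasure (Khat N α β u Γ₁ Γ₂) T) ∧
    FredholmConverges halfLineMeasure (fun lam ξ => -Khat N α β u Γ₁ Γ₂ lam ξ) ∧
    ((P.real {ω | lastPassageTime (2 * N) (fun p => W p ω) ≤ u} : ℝ) : ℂ) =
      fredholmDet halfLineMeasure (fun lam ξ => -Khat N α β u Γ₁ Γ₂ lam ξ) := by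
  set a : ℕ → ℝ := fun m => α (m + 1) with ha_def
  set b : ℕ → ℝ := fun m => β (m + 1) with hb_def
  have hmem : ∀ m < N, m + 1 ∈ Finset.Icc 1 N := fun m hm =>
    Finset.mem_Icc.2 ⟨by omega, by omega⟩
  have h₁ := hΓ₁.1.isClosedPath
  have h₂ := hΓ₂.1.isClosedPath
  have htr₁ := hΓ₁.2.2
  have htr₂ := hΓ₂.2.2
  have hdisj : ∀ z ∈ contourTrace Γ₁, z ∉ contourTrace Γ₂ := fun z hz => (hΓ₂Γ₁ z hz).1
  have ha : ∀ m < N, WindsOnce Γ₁ (a m) := fun m hm => hΓ₁.2.1.windsOnce (hΓ₁α _ (hmem m hm))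
  have hb : ∀ m < N, WindsOnce Γ₂ (b m) := fun m hm => hΓ₂.2.1.windsOnce (hΓ₂β _ (hmem m hm))
  have ha0 : ∀ m < N, 0 < a m := fun m hm => hα _ (hmem m hm)
  have hb0 : ∀ m < N, 0 < b m := fun m hm => hβ _ (hmem m hm)
  -- A circle about the origin that encloses `Γ₁` and all the points `±αₘ`, `±βₘ`.
  obtain ⟨R, haR, hbR, hzR⟩ : ∃ R : ℝ, (∀ m < N, |a m| < R) ∧ (∀ m < N, |b m| < R) ∧
      ∀ z ∈ contourTrace Γ₁, ‖z‖ < R := by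
    obtain ⟨C, hC⟩ := (isCompact_contourTrace h₁).isBounded.exists_norm_le
    have hsum : ∀ c : ℕ → ℝ, ∀ m < N, |c m| ≤ ∑ j ∈ Finset.range N, |c j| := fun c m hm =>
      Finset.single_le_sum (f := fun j => |c j|) (fun j _ => abs_nonneg (c j))
        (Finset.mem_range.2 hm)
    have hnn : ∀ c : ℕ → ℝ, 0 ≤ ∑ j ∈ Finset.range N, |c j| := fun c =>
      Finset.sum_nonneg fun j _ => abs_nonneg (c j)
    refine ⟨|C| + ∑ j ∈ Finset.range N, |a j| + ∑ j ∈ Finset.range N, |b j| + 1,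
      fun m hm => ?_, fun m hm => ?_, fun z hz => ?_⟩
    · linarith [hsum a m hm, hnn b, abs_nonneg C]
    · linarith [hsum b m hm, hnn a, abs_nonneg C]
    · linarith [hC z hz, hnn a, hnn b, le_abs_self C]
  have hK : ∀ lam ξ : ℝ, Khat N α β u Γ₁ Γ₂ lam ξ =
      ∑ k : Fin N, leftFactor Γ₁ a k lam * rightFactor Γ₁ Γ₂ N a b u k ξ :=
    Khat_eq_sum ha_def hb_def h₁ htr₁ h₂ htr₂ hdisj ha hb ha0
  have hf : ∀ k : Fin N, MemLp (leftFactor Γ₁ a k) 2 halfLineMeasure := fun k =>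
    memLp_leftFactor h₁ htr₁ ha k.2
  have hg : ∀ k : Fin N, MemLp (rightFactor Γ₁ Γ₂ N a b u k) 2 halfLineMeasure := fun k =>
    memLp_rightFactor h₁ htr₁ h₂ htr₂ hdisj ha hb k
  have hK' : ∀ lam ξ : ℝ, -Khat N α β u Γ₁ Γ₂ lam ξ =
      ∑ k : Fin N, (-leftFactor Γ₁ a k) lam * rightFactor Γ₁ Γ₂ N a b u k ξ := fun lam ξ => by
    rw [hK, ← Finset.sum_neg_distrib]
    exact Finset.sum_congr rfl fun k _ => (neg_mul _ _).symm
  have hf' : ∀ k : Fin N, MemLp (-leftFactor Γ₁ a k) 2 halfLineMeasure := fun k => (hf k).neg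
  have : SigmaFinite halfLineMeasure := by unfold halfLineMeasure; infer_instance
  refine ⟨exists_isIntegralOperator_of_finiteRank hK hf hg,
    fredholmConverges_of_finiteRank hK' hf' hg, ?_⟩
  rw [measureReal_lastPassageTime_le P hN hα hβ W hIndep hLaw hu haR hbR,
    pathDet_columnRate_eq_det h₁ htr₁ h₂ htr₂ hdisj ha hb ha0 hb0 haR hbR hzR,
    fredholmDet_of_finiteRank hK' hf' hg, sub_eq_add_neg]
  congr 2
  ext l k
  rw [Matrix.neg_apply, Matrix.of_apply, Matrix.of_apply,
    ← integral_leftFactor_mul_rightFactor h₁ htr₁ h₂ htr₂ hdisj ha hb ha0 l.2 k, ← integral_neg]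
  exact integral_congr_ae (Filter.Eventually.of_forall fun ξ => (neg_mul _ _).symm)
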